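/- Let $n\ge 1$ be an integer. Let $Q(x)=x_0^2-x_1^2-\dots-x_n^2$ on $\mathbb R^{n+1}$, and let $\mathbb H^n=\{x : Q(x)=1,\ x_0>0\}$ be hyperbolic $n$-space in the linear (hyperboloid) model. Its ideal boundary is the set of light-like lines, i.e. the one-dimensional subspaces of $\mathbb R^{n+1}$ on which $Q$ vanishes. Let $I(\mathbb H^n)$ be the isometry group of $\mathbb H^n$, that is, the group of linear automorphisms of $\mathbb R^{n+1}$ that preserve $Q$ and map $\mathbb H^n$ onto itself. An element of $I(\mathbb H^n)$ is called elliptic if it fixes a point of $\mathbb H^n$ (so the identity is elliptic); a non-elliptic element is called hyperbolic if it has exactly two fixed points on the ideal boundary, and parabolic if it has exactly one. Two elements $x,y$ of a group $G$ are $z$-equivalent if their centralizers are conjugate subgroups of $G$, and the equivalence classes are called $z$-classes. For $u\ge 0$ let $p(u)$ be the number of partitions of $u$ (so $p(0)=1$). Then the number of $z$-classes in $I(\mathbb H^n)$ is finite, and: (i) the number of $z$-classes of elliptic elements is $$\sum_{k=0}^{\lfloor n/2\rfloor}(n+1-2k)\,p(k)=(n+1)p(0)+(n-1)p(1)+(n-3)p(2)+\dots+\epsilon\,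 p(\lfloor n/2\rfloor);$$ (ii) the number of $z$-classes of hyperbolic elements is $$\sum_{k=0}^{\lfloor (n-1)/2\rfloor}\Big(\Big\lfloor \tfrac{n-1}{2}\Big\rfloor+1-k\Big)p(k)=\Big(\Big\lfloor \tfrac{n-1}{2}\Big\rfloor+1\Big)p(0)+\Big\lfloor \tfrac{n-1}{2}\Big\rfloor p(1)+\dots+p\Big(\Big\lfloor \tfrac{n-1}{2}\Big\rfloor\Big);$$ (iii) the number of $z$-classes of parabolic elements is $$\sum_{k=0}^{\lfloor (n-2)/2\rfloor}(n-1-2k)\,p(k)=(n-1)p(0)+(n-3)p(1)+\dots+\epsilon\, p(\lfloor (n-2)/2\rfloor),$$ an empty sum, equal to $0$, when $n=1$. Here $\epsilon=1$ if $n$ is even and $\epsilon=2$ if $n$ is odd. -/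

import Mathlib

/-- Two elements of a group are `z`-equivalent if their centralizers are conjugate subgroups. -/
def ZEquiv {G : Type*} [Group G] (x y : G) : Prop :=
  ∃ g : G, (Subgroup.centralizer {x}).map (MulAut.conj g).toMonoidHom = Subgroup.centralizer {y}

theorem zEquiv_equivalence (G : Type*) [Group G] : Equivalence (ZEquiv (G := G)) where
  refl x := ⟨1, by ext; simp [Subgroup.mem_map]⟩
  symm := by
    rintro x y ⟨g, hg⟩
    refine ⟨g⁻¹, ?_⟩
    rw [← hg, Subgroup.map_map]
    ext; simp [Subgroup.mem_map, mul_assoc]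
  trans := by
    rintro x y w ⟨g, hg⟩ ⟨h, hh⟩
    refine ⟨h * g, ?_⟩
    rw [← hh, ← hg, Subgroup.map_map]
    congr 1
    ext; simp [mul_assoc]

/-- `z`-equivalence as a setoid. -/
def zSetoid (G : Type*) [Group G] : Setoid G := ⟨ZEquiv, zEquiv_equivalence G⟩

/-- The set of `z`-classes of a group. -/
def ZClass (G : Type*) [Group G] : Type _ := Quotient (zSetoid G)

/-- The `z`-class of an element. -/
def zClass {G : Type*} [Group G] (x : G) : ZClass G := Quotient.mk (zSetoid G) x

namespace Hyp

/-- The real vector space of dimension `n + 1` underlying the linear model. -/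
abbrev V (n : ℕ) : Type := Fin (n + 1) → ℝ

/-- The standard quadratic form of signature `(1, n)`. -/
def Q {n : ℕ} (v : V n) : ℝ := v 0 ^ 2 - ∑ i : Fin n, v i.succ ^ 2

/-- Hyperbolic `n`-space: the component of the hyperboloid `Q = 1` on which `v 0 > 0`. -/
def space (n : ℕ) : Set (V n) := {v | Q v = 1 ∧ 0 < v 0}

/-- The isometry group of hyperbolic `n`-space in the linear model: the linear automorphisms that
preserve `Q` and map the chosen component of the hyperboloid onto itself. -/
def Isom (n : ℕ) : Subgroup (V n ≃ₗ[ℝ] V n) where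
  carrier := {T | (∀ v, Q (T v) = Q v) ∧ T '' space n = space n}
  one_mem' := by simp
  mul_mem' := by
    rintro S T ⟨hS, hS'⟩ ⟨hT, hT'⟩
    refine ⟨fun v => by rw [LinearEquiv.mul_apply, hS, hT], ?_⟩
    calc (S * T : V n ≃ₗ[ℝ] V n) '' space n = S '' (T '' space n) := by
          rw [Set.image_image]; rfl
      _ = space n := by rw [hT', hS']
  inv_mem' := by
    rintro T ⟨hT, hT'⟩
    have h : ∀ v, (T⁻¹ : V n ≃ₗ[ℝ] V n) (T v) = v := fun v => T.symm_apply_apply v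
    have h' : ∀ v, T ((T⁻¹ : V n ≃ₗ[ℝ] V n) v) = v := fun v => T.apply_symm_apply v
    refine ⟨fun v => by rw [← hT, h'], ?_⟩
    conv_lhs => rw [← hT']
    rw [Set.image_image]
    simp [h]

/-- The ideal boundary of hyperbolic `n`-space in the linear model: the light-like lines. -/
def boundary (n : ℕ) : Set (Submodule ℝ (V n)) :=
  {L | Module.finrank ℝ L = 1 ∧ ∀ v ∈ L, Q v = 0}

/-- The points of the ideal boundary fixed by an isometry. -/
def fixedBoundary {n : ℕ} (T : Isom n) : Set (Submodule ℝ (V n)) :=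
  {L | L ∈ boundary n ∧ L.map ((T : V n ≃ₗ[ℝ] V n) : V n →ₗ[ℝ] V n) = L}

/-- Elliptic: there is a fixed point in hyperbolic space. -/
def IsElliptic {n : ℕ} (T : Isom n) : Prop :=
  ∃ v ∈ space n, (T : V n ≃ₗ[ℝ] V n) v = v

/-- Hyperbolic: non-elliptic, with exactly two fixed points on the ideal boundary. -/
def IsHyperbolic {n : ℕ} (T : Isom n) : Prop :=
  ¬ IsElliptic T ∧ (fixedBoundary T).encard = 2

/-- Parabolic: non-elliptic, with exactly one fixed point on the ideal boundary. -/
def IsParabolic {n : ℕ} (T : Isom n) : Prop :=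
  ¬ IsElliptic T ∧ (fixedBoundary T).encard = 1

end Hyp

/-- The partition function `p`; in particular `p 0 = 1`. -/
def partitionCount (u : ℕ) : ℕ := Fintype.card (Nat.Partition u)

/-! A centralizer forgets rotation angles and translation lengths; it remembers only how the space
decomposes. For a Euclidean isometry `A` the pieces are the eigenspaces `cosSpace` of `A + A⁻¹`:
those of `A` for `1` and `-1`, and for each `c` in `(-1, 1)` the sum of the planes that `A` rotates
by an angle with cosine `c`. Two arguments show that the dimensions of these pieces decide
everything.

Suppose `A'` commutes with all isometries that commute with `A`. Reflections in `A`-invariant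
subspaces commute with `A`, so `A'` preserves these subspaces, in particular the span of `x` and `A
x`; hence each `x` in a piece is an eigenvector of `A' + A'⁻¹`
(`CommutantLE.exists_add_symm_eq_smul`). So equal commutants force equal pieces. Conversely, if two
isometries have pieces of the same sizes, a conjugation gives them a common adapted orthonormal
frame; on each piece either one is then a combination of the identity and the other, and the
commutants agree (`exists_conj_isCosCombination`, `IsCosCombination.commute`).

An elliptic element is conjugate to the identity on a time-like line plus some `A` in dimension `n`.
The bicommutant sees its fixed points in hyperbolic space, so the eigenvalue `1` cannot be exchanged
with `-1` (`zEquiv_ell_iff`). An element without bounded orbits fixes a point at infinity and acts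
on the horosphere, of dimension `n - 1`, as a similarity. It is conjugate to a dilation with linear
part `A`, where `A` and `-A` have the same commutant and the signs may be exchanged
(`zEquiv_dilation_iff`), or to `A` followed by a translation along a nonzero fixed vector of `A`,
where `1` has positive multiplicity and is again distinguished (`zEquiv_translation_iff`).

The count comes from `cosDim_add_cosDim`. If there are `k` rotation planes in all, their grouping by
angle is one of `p(k)` partitions, and the dimensions for `1` and `-1` have a fixed sum. The
coefficients of `p(k)` count the possible splittings of that sum: ordered, unordered, and ordered
with the first dimension positive. -/

open Module

/-! ### Eigenspaces of `T + T⁻¹`. -/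

section CosSpace

variable {V V' : Type*} [AddCommGroup V] [Module ℝ V] [AddCommGroup V'] [Module ℝ V']

/-- The eigenspace of `T + T⁻¹` with eigenvalue `2 * c`. -/
def cosSpace (T : V ≃ₗ[ℝ] V) (c : ℝ) : Submodule ℝ V where
  carrier := {x | T x + T.symm x = (2 * c) • x}
  add_mem' := by
    intro x y hx hy
    simp only [Set.mem_ofPred_eq, map_add, smul_add] at *
    rw [← hx, ← hy]; abel
  zero_mem' := by simp
  smul_mem' := by
    intro r x hx
    simp only [Set.mem_ofPred_eq, map_smul] at *
    rw [← smul_add, hx, smul_comm]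

theorem mem_cosSpace {T : V ≃ₗ[ℝ] V} {c : ℝ} {x : V} :
    x ∈ cosSpace T c ↔ T x + T.symm x = (2 * c) • x := Iff.rfl

theorem mem_cosSpace_iff_sq {T : V ≃ₗ[ℝ] V} {c : ℝ} {x : V} :
    x ∈ cosSpace T c ↔ T (T x) = (2 * c) • T x - x := by
  rw [mem_cosSpace, ← T.injective.eq_iff, map_add, T.apply_symm_apply, map_smul, eq_sub_iff_add_eq]

theorem eq_of_mem_cosSpace {T : V ≃ₗ[ℝ] V} {c d : ℝ} {x : V} (hc : x ∈ cosSpace T c)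
    (hd : x ∈ cosSpace T d) (hx : x ≠ 0) : c = d := by
  rw [mem_cosSpace] at hc hd
  have := smul_left_injective ℝ hx (hc.symm.trans hd)
  linarith

theorem map_mem_cosSpace {T : V ≃ₗ[ℝ] V} {T' : V' ≃ₗ[ℝ] V'} (f : V →ₗ[ℝ] V')
    (h : ∀ x, T' (f x) = f (T x)) {c : ℝ} {x : V} (hx : x ∈ cosSpace T c) :
    f x ∈ cosSpace T' c := by
  rw [mem_cosSpace_iff_sq] at *
  rw [h, h, hx]; simp

/-- The dimension of `cosSpace T c`. -/
noncomputable def cosDim (T : V ≃ₗ[ℝ] V) (c : ℝ) : ℕ := finrank ℝ (cosSpace T c)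

theorem cosDim_eq_of_injective {T : V ≃ₗ[ℝ] V} {T' : V' ≃ₗ[ℝ] V'} {c : ℝ} (f : V →ₗ[ℝ] V')
    (hf : Function.Injective f) (h : ∀ x, x ∈ cosSpace T c → f x ∈ cosSpace T' c)
    (hsurj : ∀ y ∈ cosSpace T' c, ∃ x ∈ cosSpace T c, f x = y) : cosDim T c = cosDim T' c := by
  have : cosSpace T' c = (cosSpace T c).map f := by
    ext y
    rw [Submodule.mem_map]
    exact ⟨hsurj y, by rintro ⟨x, hx, rfl⟩; exact h x hx⟩
  unfold cosDim
  rw [this]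
  exact ((cosSpace T c).equivMapOfInjective f hf).finrank_eq

theorem cosDim_conj (T g : V ≃ₗ[ℝ] V) (c : ℝ) : cosDim (g * T * g⁻¹) c = cosDim T c := by
  symm
  have h1 : ∀ x, (g * T * g⁻¹) (g x) = g (T x) := fun x => by
    simp [LinearEquiv.mul_apply]
  have h2 : ∀ y, T (g⁻¹ y) = g⁻¹ ((g * T * g⁻¹) y) := fun y => by
    simp [LinearEquiv.mul_apply]
  refine cosDim_eq_of_injective (g : V →ₗ[ℝ] V) g.injective
    (fun x hx => map_mem_cosSpace (g : V →ₗ[ℝ] V) h1 hx) fun y hy => ⟨g⁻¹ y, ?_, ?_⟩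
  · exact map_mem_cosSpace (g⁻¹ : V ≃ₗ[ℝ] V).toLinearMap h2 hy
  · exact g.apply_symm_apply y

/-- The multiset of the numbers `d c / 2` for those `c` in the open interval `(-1, 1)` at which `d`
does not vanish. -/
noncomputable def halfType (d : ℝ → ℕ) : Multiset ℕ :=
  ∑ᶠ c ∈ {c | c ∈ Set.Ioo (-1 : ℝ) 1 ∧ d c ≠ 0}, {d c / 2}

theorem halfType_congr {d d' : ℝ → ℕ} (h : ∀ c ∈ Set.Ioo (-1 : ℝ) 1, d c = d' c) :
    halfType d = halfType d' := by
  unfold halfType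
  have : {c | c ∈ Set.Ioo (-1 : ℝ) 1 ∧ d c ≠ 0} = {c | c ∈ Set.Ioo (-1 : ℝ) 1 ∧ d' c ≠ 0} := by
    ext c
    simp only [Set.mem_ofPred_eq]
    exact and_congr_right fun hc => by rw [h c hc]
  rw [this]
  exact finsum_mem_congr rfl fun c hc => by rw [h c hc.1]

/-- The parameters `c` may be permuted. A nonzero eigenspace belongs to a single `c`, so matching
equal subspaces gives a bijection of parameters that preserves dimensions. -/
theorem halfType_eq_of_cosSpace {T T' : V ≃ₗ[ℝ] V}
    (h : ∀ c ∈ Set.Ioo (-1 : ℝ) 1, cosSpace T c ≠ ⊥ →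
      ∃ c' ∈ Set.Ioo (-1 : ℝ) 1, cosSpace T c = cosSpace T' c')
    (h' : ∀ c ∈ Set.Ioo (-1 : ℝ) 1, cosSpace T' c ≠ ⊥ →
      ∃ c' ∈ Set.Ioo (-1 : ℝ) 1, cosSpace T' c = cosSpace T c') [FiniteDimensional ℝ V] :
    halfType (cosDim T) = halfType (cosDim T') := by
  have hd : ∀ (S : V ≃ₗ[ℝ] V) c, cosDim S c ≠ 0 ↔ cosSpace S c ≠ ⊥ := fun S c => by
    rw [cosDim, Ne, Submodule.finrank_eq_zero]
  choose! σ hσ1 hσ2 using h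
  choose! τ hτ1 hτ2 using h'
  unfold halfType
  refine finsum_mem_eq_of_bijOn σ ⟨?_, ?_, ?_⟩ ?_
  · rintro c ⟨hc, hne⟩
    rw [hd] at hne
    refine ⟨hσ1 c hc hne, ?_⟩
    rw [hd, ← hσ2 c hc hne]; exact hne
  · rintro c ⟨hc, hne⟩ c' ⟨hc', hne'⟩ he
    rw [hd] at hne hne'
    obtain ⟨x, hx, hx0⟩ := Submodule.exists_mem_ne_zero_of_ne_bot hne
    refine eq_of_mem_cosSpace hx ?_ hx0
    rw [hσ2 c' hc' hne', ← he, ← hσ2 c hc hne]; exact hx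
  · rintro c ⟨hc, hne⟩
    rw [hd] at hne
    have hne' : cosSpace T (τ c) ≠ ⊥ := by rw [← hτ2 c hc hne]; exact hne
    refine ⟨τ c, ⟨hτ1 c hc hne, (hd _ _).2 hne'⟩, ?_⟩
    obtain ⟨x, hx, hx0⟩ := Submodule.exists_mem_ne_zero_of_ne_bot hne
    refine eq_of_mem_cosSpace ?_ hx hx0
    rw [← hσ2 _ (hτ1 c hc hne) hne', ← hτ2 c hc hne]; exact hx
  · rintro c ⟨hc, hne⟩
    rw [hd] at hne
    rw [cosDim, cosDim, hσ2 c hc hne]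

/-- `T'` is on each `cosSpace T c` a linear combination of the identity and `T`. -/
def IsCosCombination (T T' : V ≃ₗ[ℝ] V) : Prop :=
  ∀ c, ∃ α β : ℝ, ∀ x ∈ cosSpace T c, T' x = α • x + β • T x

/-- `S` preserves each `cosSpace T c`, and there `T'` is a polynomial in `T`. -/
theorem IsCosCombination.commute {T T' S : V ≃ₗ[ℝ] V} (h : IsCosCombination T T')
    (hT : ⨆ c, cosSpace T c = ⊤) (hS : ∀ x, S (T x) = T (S x)) (x : V) :
    S (T' x) = T' (S x) := by
  have hx : x ∈ ⨆ c, cosSpace T c := hT ▸ Submodule.mem_top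
  induction hx using Submodule.iSup_induction' with
  | mem c x hx =>
    obtain ⟨α, β, hαβ⟩ := h c
    rw [hαβ x hx, hαβ (S x) (map_mem_cosSpace (S : V →ₗ[ℝ] V) (fun x => (hS x).symm) hx)]
    simp [hS]
  | zero => simp
  | add x y _ _ hx hy => simp [hx, hy]

end CosSpace

/-! ### Bicommutants of Euclidean isometries. -/

section Isometry

open scoped InnerProductSpace

variable {E : Type*} [NormedAddCommGroup E] [InnerProductSpace ℝ E]

theorem inner_isometry_left (A : E ≃ₗᵢ[ℝ] E) (x y : E) : ⟪A x, y⟫_ℝ = ⟪x, A.symm y⟫_ℝ := by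
  rw [← A.inner_map_map x (A.symm y), A.apply_symm_apply]

theorem mem_cosSpace_isometry {A : E ≃ₗᵢ[ℝ] E} {c : ℝ} {x : E} :
    x ∈ cosSpace A.toLinearEquiv c ↔ A x + A.symm x = (2 * c) • x := Iff.rfl

theorem inner_map_self_of_mem_cosSpace {A : E ≃ₗᵢ[ℝ] E} {c : ℝ} {x : E}
    (hx : x ∈ cosSpace A.toLinearEquiv c) : ⟪x, A x⟫_ℝ = c * ⟪x, x⟫_ℝ := by
  have h := congrArg (fun y => ⟪x, y⟫_ℝ) (mem_cosSpace_isometry.1 hx)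
  simp only [inner_add_right, ← inner_isometry_left, inner_smul_right, real_inner_comm x (A x)] at h
  linarith [real_inner_comm x (A x)]

/-- `A x - c • x` is the part of `A x` orthogonal to `x`, so Pythagoras applies. This bounds `c` by
`1` in absolute value, makes `x` an eigenvector when `c ^ 2 = 1`, and otherwise supplies the second
axis of a rotation plane. -/
theorem inner_self_map_sub {A : E ≃ₗᵢ[ℝ] E} {c : ℝ} {x : E}
    (hx : x ∈ cosSpace A.toLinearEquiv c) :
    ⟪A x - c • x, A x - c • x⟫_ℝ = (1 - c ^ 2) * ⟪x, x⟫_ℝ := by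
  simp only [inner_sub_left, inner_sub_right, inner_smul_left, inner_smul_right, A.inner_map_map,
    real_inner_comm x (A x)]
  rw [real_inner_comm, inner_map_self_of_mem_cosSpace hx]
  simp
  ring

theorem sq_le_one_of_mem_cosSpace {A : E ≃ₗᵢ[ℝ] E} {c : ℝ} {x : E}
    (hx : x ∈ cosSpace A.toLinearEquiv c) (h0 : x ≠ 0) : c ^ 2 ≤ 1 := by
  have h1 := inner_self_map_sub hx
  have h2 : 0 < ⟪x, x⟫_ℝ := real_inner_self_pos.2 h0
  have h3 : 0 ≤ ⟪A x - c • x, A x - c • x⟫_ℝ := real_inner_self_nonneg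
  by_contra! h
  nlinarith

theorem map_eq_smul_of_mem_cosSpace {A : E ≃ₗᵢ[ℝ] E} {c : ℝ} {x : E}
    (hx : x ∈ cosSpace A.toLinearEquiv c) (hc : c ^ 2 = 1) : A x = c • x := by
  have h1 := inner_self_map_sub hx
  rw [hc, sub_self, zero_mul, inner_self_eq_zero, sub_eq_zero] at h1
  exact h1

theorem mem_cosSpace_of_map_eq_smul {A : E ≃ₗᵢ[ℝ] E} {c : ℝ} {x : E} (hx : A x = c • x)
    (hc : c ^ 2 = 1) : x ∈ cosSpace A.toLinearEquiv c := by
  rw [mem_cosSpace_iff_sq]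
  simp only [LinearIsometryEquiv.coe_toLinearEquiv, hx, map_smul, smul_smul]
  rw [← sub_eq_zero, ← one_smul ℝ x]
  simp only [smul_smul, ← sub_smul]
  rw [smul_eq_zero]; left; linear_combination -hc

theorem mem_cosSpace_one {A : E ≃ₗᵢ[ℝ] E} {x : E} :
    x ∈ cosSpace A.toLinearEquiv 1 ↔ A x = x :=
  ⟨fun h => by simpa using map_eq_smul_of_mem_cosSpace h (by norm_num),
    fun h => mem_cosSpace_of_map_eq_smul (by simpa using h) (by norm_num)⟩

theorem eq_one_or_neg_one_of_map_eq_smul {A : E ≃ₗᵢ[ℝ] E} {c r : ℝ} {x : E}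
    (hx : x ∈ cosSpace A.toLinearEquiv c) (h0 : x ≠ 0) (hr : A x = r • x) : c ^ 2 = 1 := by
  have h1 := inner_map_self_of_mem_cosSpace hx
  have h2 := A.inner_map_map x x
  have h3 : 0 < ⟪x, x⟫_ℝ := real_inner_self_pos.2 h0
  rw [hr] at h1 h2
  simp only [inner_smul_left, inner_smul_right, conj_trivial] at h1 h2
  have h4 : r = c := mul_right_cancel₀ h3.ne' h1
  subst h4
  apply mul_right_cancel₀ h3.ne'
  linarith

theorem inner_eq_zero_of_mem_cosSpace {A : E ≃ₗᵢ[ℝ] E} {c : ℝ} {x w : E}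
    (hx : x ∈ cosSpace A.toLinearEquiv c) (hw : A w = w) (hc : c ≠ 1) : ⟪x, w⟫_ℝ = 0 := by
  have h := congrArg (fun y => ⟪y, w⟫_ℝ) (mem_cosSpace_isometry.1 hx)
  have hw' : A.symm w = w := by rw [A.symm_apply_eq, hw]
  have h5 : ⟪A.symm x, w⟫_ℝ = ⟪x, w⟫_ℝ := by
    rw [inner_isometry_left A.symm, LinearIsometryEquiv.symm_symm, hw]
  simp only [inner_add_left, h5, inner_isometry_left A, hw', inner_smul_left] at h
  simp at h
  have : (1 - c) * ⟪x, w⟫_ℝ = 0 := by linarith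
  exact (mul_eq_zero.1 this).resolve_left (sub_ne_zero.2 hc.symm)

theorem map_span_pair_of_mem_cosSpace {A : E ≃ₗᵢ[ℝ] E} {c : ℝ} {x : E}
    (hx : x ∈ cosSpace A.toLinearEquiv c) :
    (Submodule.span ℝ {x, A x}).map (A.toLinearEquiv : E →ₗ[ℝ] E) = Submodule.span ℝ {x, A x} := by
  have h2 : A (A x) = (2 * c) • A x - x := mem_cosSpace_iff_sq.1 hx
  rw [Submodule.map_span, Set.image_pair]
  simp only [LinearEquiv.coe_coe, LinearIsometryEquiv.coe_toLinearEquiv, h2]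
  apply le_antisymm <;> rw [Submodule.span_le] <;> rintro y (rfl | rfl)
  · exact Submodule.subset_span (by simp)
  · exact Submodule.sub_mem _ (Submodule.smul_mem _ _ (Submodule.subset_span (by simp)))
      (Submodule.subset_span (by simp))
  · have : y = (2 * c) • A y - ((2 * c) • A y - y) := by abel
    rw [this]
    exact Submodule.sub_mem _ (Submodule.smul_mem _ _ (Submodule.subset_span (by simp)))
      (Submodule.subset_span (by simp))
  · exact Submodule.subset_span (by simp)

/-- Every isometry that commutes with `A` and fixes `w` commutes with `A'`. -/
def CommutantLE (A A' : E ≃ₗᵢ[ℝ] E) (w : E) : Prop :=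
  ∀ B : E ≃ₗᵢ[ℝ] E, (∀ x, B (A x) = A (B x)) → B w = w → ∀ x, B (A' x) = A' (B x)

variable [FiniteDimensional ℝ E]

/-- The reflection that negates `P` and fixes `Pᗮ` commutes with `A` and fixes `w`. So `A'` commutes
with it and preserves its `-1`-eigenspace, which is `P`. -/
theorem CommutantLE.map_mem_of_map_eq {A A' : E ≃ₗᵢ[ℝ] E} {w : E} (h : CommutantLE A A' w)
    {P : Submodule ℝ E} (hP : P.map (A.toLinearEquiv : E →ₗ[ℝ] E) = P) (hw : w ∈ Pᗮ) {x : E}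
    (hx : x ∈ P) : A' x ∈ P := by
  have hR : ∀ y, Pᗮ.reflection (A y) = A (Pᗮ.reflection y) := by
    intro y
    have := Submodule.reflection_map_apply A P (A y)
    rw [A.symm_apply_apply] at this
    simp only [Submodule.reflection_orthogonal_apply, map_neg, ← this]
    congr 2
    simp only [hP]
  have h1 := h _ hR (Submodule.reflection_mem_subspace_eq_self hw) x
  rw [Submodule.reflection_orthogonal_apply, Submodule.reflection_orthogonal_apply,
    Submodule.reflection_mem_subspace_eq_self hx, map_neg, neg_inj,
    Submodule.reflection_eq_self_iff] at h1
  exact h1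

/-- The span of `x` and `A x` is invariant under `A'`, hence contains `A' x + A'⁻¹ x`. As `A' +
A'⁻¹` is symmetric and commutes with `A`, this vector has no component along `A x - c • x`, which
leaves a multiple of `x`. The condition on `c` makes `w` orthogonal to the span. -/
theorem CommutantLE.exists_add_symm_eq_smul {A A' : E ≃ₗᵢ[ℝ] E} {w : E} (h : CommutantLE A A' w)
    (hw : A w = w) {c : ℝ} (hc : c ≠ 1 ∨ w = 0) {x : E} (hx : x ∈ cosSpace A.toLinearEquiv c) :
    ∃ r : ℝ, A' x + A'.symm x = r • x := by
  set P := Submodule.span ℝ {x, A x} with hPdef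
  have hxP : x ∈ P := Submodule.subset_span (by simp)
  have hP := map_span_pair_of_mem_cosSpace hx
  have hxw : ⟪x, w⟫_ℝ = 0 := by
    rcases hc with hc | rfl
    · exact inner_eq_zero_of_mem_cosSpace hx hw hc
    · simp
  have hwP : w ∈ Pᗮ := by
    rw [Submodule.mem_orthogonal]
    intro u hu
    obtain ⟨a, b, rfl⟩ := Submodule.mem_span_pair.1 hu
    have : ⟪A x, w⟫_ℝ = 0 := by
      conv_lhs => rw [← hw]
      rw [A.inner_map_map, hxw]
    simp [inner_add_left, inner_smul_left, hxw, this]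
  have hA'P : P.map (A'.toLinearEquiv : E →ₗ[ℝ] E) = P := by
    apply Submodule.eq_of_le_of_finrank_eq
    · rintro _ ⟨y, hy, rfl⟩
      exact h.map_mem_of_map_eq hP hwP hy
    · exact (A'.toLinearEquiv.submoduleMap P).finrank_eq.symm
  have hmem : A' x + A'.symm x ∈ P := by
    refine P.add_mem (h.map_mem_of_map_eq hP hwP hxP) ?_
    have : x ∈ P.map (A'.toLinearEquiv : E →ₗ[ℝ] E) := by rw [hA'P]; exact hxP
    obtain ⟨y, hy, hyx⟩ := this
    have : A'.symm x = y := by rw [A'.symm_apply_eq]; exact hyx.symm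
    rw [this]; exact hy
  obtain ⟨a, b, hab⟩ := Submodule.mem_span_pair.1 hmem
  have hcomm := h A (fun _ => rfl) hw
  have hcomm' : ∀ y, A (A'.symm y) = A'.symm (A y) := fun y => by
    rw [eq_comm, A'.symm_apply_eq, ← hcomm, A'.apply_symm_apply]
  set z := A' x + A'.symm x with hz
  -- `A' + A'⁻¹` is symmetric and commutes with `A`
  have h1 : ⟪z, A x⟫_ℝ = ⟪z, A.symm x⟫_ℝ := by
    have e1 : ⟪z, A x⟫_ℝ = ⟪x, A z⟫_ℝ := by
      rw [hz, map_add, inner_add_left, inner_add_right, hcomm, hcomm',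
        inner_isometry_left A', inner_isometry_left A'.symm, LinearIsometryEquiv.symm_symm, add_comm]
    rw [e1, real_inner_comm, inner_isometry_left]
  have h2 : ⟪z, A x⟫_ℝ = c * ⟪z, x⟫_ℝ := by
    have := congrArg (fun y => ⟪z, y⟫_ℝ) (mem_cosSpace_isometry.1 hx)
    simp only [inner_add_right, ← h1, inner_smul_right] at this
    linarith
  set y := A x - c • x with hy
  have hxy : ⟪x, y⟫_ℝ = 0 := by
    rw [hy, inner_sub_right, inner_map_self_of_mem_cosSpace hx, inner_smul_right, sub_self]
  have hzy : ⟪z, y⟫_ℝ = 0 := by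
    rw [hy, inner_sub_right, inner_smul_right, h2, sub_self]
  have hz' : z = (a + b * c) • x + b • y := by
    rw [hy, ← hab, smul_sub, add_smul, smul_smul]; abel
  have hb : b * ⟪y, y⟫_ℝ = 0 := by
    have := hzy
    rw [hz', inner_add_left, inner_smul_left, inner_smul_left, hxy] at this
    simpa using this
  have hby : b • y = 0 := by
    rcases mul_eq_zero.1 hb with h | h
    · simp [h]
    · simp [inner_self_eq_zero.1 h]
  exact ⟨a + b * c, by rw [hz', hby, add_zero]⟩

/-- A linear map for which every vector is an eigenvector is a scalar, so the factor in
`CommutantLE.exists_add_symm_eq_smul` does not depend on `x`. -/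
theorem CommutantLE.exists_cosSpace_le {A A' : E ≃ₗᵢ[ℝ] E} {w : E} (h : CommutantLE A A' w)
    (hw : A w = w) {c : ℝ} (hc : c ≠ 1 ∨ w = 0) :
    ∃ c', cosSpace A.toLinearEquiv c ≤ cosSpace A'.toLinearEquiv c' := by
  have key := fun x hx => h.exists_add_symm_eq_smul hw hc (x := x) hx
  let f : cosSpace A.toLinearEquiv c →ₗ[ℝ] cosSpace A.toLinearEquiv c :=
    ((A'.toLinearEquiv : E →ₗ[ℝ] E) + (A'.symm.toLinearEquiv : E →ₗ[ℝ] E)).restrict (by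
      intro x hx
      obtain ⟨r, hr⟩ := key x hx
      change A' x + A'.symm x ∈ _
      rw [hr]; exact Submodule.smul_mem _ _ hx)
  obtain ⟨a, ha⟩ := f.exists_eq_smul_id_of_forall_notLinearIndependent (by
    intro v hv
    obtain ⟨r, hr⟩ := key v v.2
    rw [LinearIndependent.pair_iff] at hv
    have := hv r (-1) (by ext; simp [f, hr])
    simp at this)
  refine ⟨a / 2, fun x hx => ?_⟩
  have := congrArg Subtype.val (LinearMap.congr_fun ha ⟨x, hx⟩)
  rw [mem_cosSpace_isometry, mul_div_cancel₀ _ two_ne_zero]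
  simpa [f] using this

/-- If `A` and `A'` have equal commutants up to fixing vectors `w` and `w'`, then they have the same
cosine eigenspaces, apart from the fixed vectors. -/
theorem CommutantLE.exists_cosSpace_eq {A A' : E ≃ₗᵢ[ℝ] E} {w w' : E} (h : CommutantLE A A' w)
    (h' : CommutantLE A' A w') (hw : A w = w) (hw' : A' w' = w')
    (hfix : (w = 0 ∧ w' = 0) ∨ cosSpace A.toLinearEquiv 1 = cosSpace A'.toLinearEquiv 1)
    {c : ℝ} (hc : c ≠ 1 ∨ (w = 0 ∧ w' = 0)) (hne : cosSpace A.toLinearEquiv c ≠ ⊥) :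
    ∃ c', cosSpace A.toLinearEquiv c = cosSpace A'.toLinearEquiv c' ∧ (c' ^ 2 = 1 → c ^ 2 = 1) := by
  obtain ⟨c', hc'⟩ := h.exists_cosSpace_le hw (hc.imp_right And.left)
  obtain ⟨x, hx, hx0⟩ := Submodule.exists_mem_ne_zero_of_ne_bot hne
  -- The reverse inclusion needs the same side condition. If `c'` were `1`, then `x` would lie in
  -- the common fixed space, forcing `c = 1`.
  have hcw' : c' ≠ 1 ∨ w' = 0 := by
    rcases hc with hc | hc
    · rcases hfix with hfix | hfix
      · exact Or.inr hfix.2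
      · left
        rintro rfl
        rw [← hfix] at hc'
        exact hc (eq_of_mem_cosSpace hx (hc' hx) hx0)
    · exact Or.inr hc.2
  obtain ⟨c'', hc''⟩ := h'.exists_cosSpace_le hw' hcw'
  obtain rfl : c = c'' := eq_of_mem_cosSpace hx (hc'' (hc' hx)) hx0
  refine ⟨c', le_antisymm hc' hc'', fun h1 => ?_⟩
  -- If `c' ^ 2 = 1`, the line through `x` is invariant under `A'`, hence under `A`, so `x` is an
  -- eigenvector of the isometry `A`.
  have hx' := hc' hx
  have hxA' := map_eq_smul_of_mem_cosSpace hx' h1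
  have hP : (Submodule.span ℝ {x}).map (A'.toLinearEquiv : E →ₗ[ℝ] E) = Submodule.span ℝ {x} := by
    have := map_span_pair_of_mem_cosSpace hx'
    rw [hxA', Set.pair_comm, Submodule.span_insert_eq_span
      (Submodule.mem_span_singleton.2 ⟨c', rfl⟩)] at this
    exact this
  have hwx : ⟪x, w'⟫_ℝ = 0 := by
    rcases hcw' with h | rfl
    · exact inner_eq_zero_of_mem_cosSpace hx' hw' h
    · simp
  have := h'.map_mem_of_map_eq hP (Submodule.mem_orthogonal_singleton_iff_inner_right.2 hwx)
    (Submodule.mem_span_singleton_self x)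
  obtain ⟨r, hr⟩ := Submodule.mem_span_singleton.1 this
  exact eq_one_or_neg_one_of_map_eq_smul hx hx0 hr.symm

theorem mem_Ioo_neg_one_one {c : ℝ} : c ∈ Set.Ioo (-1 : ℝ) 1 ↔ c ^ 2 ≤ 1 ∧ c ^ 2 ≠ 1 := by
  rw [← lt_iff_le_and_ne, sq_lt_one_iff_abs_lt_one, abs_lt, Set.mem_Ioo]

theorem CommutantLE.exists_cosSpace_eq_of_mem_Ioo {A A' : E ≃ₗᵢ[ℝ] E} {w w' : E}
    (h : CommutantLE A A' w) (h' : CommutantLE A' A w') (hw : A w = w) (hw' : A' w' = w')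
    (hfix : (w = 0 ∧ w' = 0) ∨ cosSpace A.toLinearEquiv 1 = cosSpace A'.toLinearEquiv 1)
    {c : ℝ} (hc : c ∈ Set.Ioo (-1 : ℝ) 1) (hne : cosSpace A.toLinearEquiv c ≠ ⊥) :
    ∃ c' ∈ Set.Ioo (-1 : ℝ) 1, cosSpace A.toLinearEquiv c = cosSpace A'.toLinearEquiv c' := by
  obtain ⟨c', h1, h2⟩ := h.exists_cosSpace_eq h' hw hw' hfix (Or.inl hc.2.ne) hne
  obtain ⟨x, hx, hx0⟩ := Submodule.exists_mem_ne_zero_of_ne_bot hne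
  refine ⟨c', mem_Ioo_neg_one_one.2 ⟨sq_le_one_of_mem_cosSpace (h1 ▸ hx) hx0, fun hc' => ?_⟩, h1⟩
  exact (mem_Ioo_neg_one_one.1 hc).2 (h2 hc')

theorem CommutantLE.halfType_eq {A A' : E ≃ₗᵢ[ℝ] E} {w w' : E}
    (h : CommutantLE A A' w) (h' : CommutantLE A' A w') (hw : A w = w) (hw' : A' w' = w')
    (hfix : (w = 0 ∧ w' = 0) ∨ cosSpace A.toLinearEquiv 1 = cosSpace A'.toLinearEquiv 1) :
    halfType (cosDim A.toLinearEquiv) = halfType (cosDim A'.toLinearEquiv) :=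
  halfType_eq_of_cosSpace
    (fun _ hc hne => h.exists_cosSpace_eq_of_mem_Ioo h' hw hw' hfix hc hne)
    (fun _ hc hne => h'.exists_cosSpace_eq_of_mem_Ioo h hw' hw
      (hfix.imp And.symm Eq.symm) hc hne)

theorem CommutantLE.exists_cosSpace_eq_of_sq_eq_one {A A' : E ≃ₗᵢ[ℝ] E} {w w' : E}
    (h : CommutantLE A A' w) (h' : CommutantLE A' A w') (hw : A w = w) (hw' : A' w' = w')
    (hfix : (w = 0 ∧ w' = 0) ∨ cosSpace A.toLinearEquiv 1 = cosSpace A'.toLinearEquiv 1)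
    {c : ℝ} (hc : c ≠ 1 ∨ (w = 0 ∧ w' = 0)) (hc1 : c ^ 2 = 1)
    (hne : cosSpace A.toLinearEquiv c ≠ ⊥) :
    ∃ c', c' ^ 2 = 1 ∧ cosSpace A.toLinearEquiv c = cosSpace A'.toLinearEquiv c' := by
  obtain ⟨c', h1, -⟩ := h.exists_cosSpace_eq h' hw hw' hfix hc hne
  refine ⟨c', ?_, h1⟩
  by_contra h2
  obtain ⟨x, hx, hx0⟩ := Submodule.exists_mem_ne_zero_of_ne_bot hne
  obtain ⟨c'', h3, h4⟩ := h'.exists_cosSpace_eq_of_mem_Ioo h hw' hw (hfix.imp And.symm Eq.symm)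
    (mem_Ioo_neg_one_one.2 ⟨sq_le_one_of_mem_cosSpace (h1 ▸ hx) hx0, h2⟩) (h1 ▸ hne)
  obtain rfl : c = c'' := eq_of_mem_cosSpace hx (h4 ▸ h1 ▸ hx) hx0
  exact (mem_Ioo_neg_one_one.1 h3).2 hc1

theorem CommutantLE.cosSpace_neg_one_le {A A' : E ≃ₗᵢ[ℝ] E} {w w' : E}
    (h : CommutantLE A A' w) (h' : CommutantLE A' A w') (hw : A w = w) (hw' : A' w' = w')
    (hfix : cosSpace A.toLinearEquiv 1 = cosSpace A'.toLinearEquiv 1) :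
    cosSpace A.toLinearEquiv (-1) ≤ cosSpace A'.toLinearEquiv (-1) := by
  by_cases hne : cosSpace A.toLinearEquiv (-1) = ⊥
  · rw [hne]; exact bot_le
  obtain ⟨c', h1, h2⟩ := h.exists_cosSpace_eq_of_sq_eq_one h' hw hw' (Or.inr hfix)
    (Or.inl (by norm_num)) (by norm_num) hne
  obtain ⟨x, hx, hx0⟩ := Submodule.exists_mem_ne_zero_of_ne_bot hne
  rcases eq_or_eq_neg_of_sq_eq_sq _ _ (h1.trans (one_pow 2).symm) with rfl | rfl
  · rw [← hfix] at h2
    have : (-1 : ℝ) = 1 := eq_of_mem_cosSpace hx (h2 ▸ hx) hx0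
    norm_num at this
  · exact h2.le

theorem CommutantLE.cosDim_neg_one_eq {A A' : E ≃ₗᵢ[ℝ] E} {w w' : E}
    (h : CommutantLE A A' w) (h' : CommutantLE A' A w') (hw : A w = w) (hw' : A' w' = w')
    (hfix : cosSpace A.toLinearEquiv 1 = cosSpace A'.toLinearEquiv 1) :
    cosDim A.toLinearEquiv (-1) = cosDim A'.toLinearEquiv (-1) := by
  rw [cosDim, cosDim, le_antisymm (h.cosSpace_neg_one_le h' hw hw' hfix)
    (h'.cosSpace_neg_one_le h hw' hw hfix.symm)]

/-- Eigenspaces for `1` and `-1` correspond to such eigenspaces, but nothing fixes the sign: `A` and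
`-A` have the same commutant. -/
theorem CommutantLE.cosDim_eq_one_or_neg_one {A A' : E ≃ₗᵢ[ℝ] E}
    (h : CommutantLE A A' 0) (h' : CommutantLE A' A 0) {c : ℝ} (hc : c ^ 2 = 1)
    (hne : cosDim A.toLinearEquiv c ≠ 0) :
    cosDim A.toLinearEquiv c = cosDim A'.toLinearEquiv 1 ∨
      cosDim A.toLinearEquiv c = cosDim A'.toLinearEquiv (-1) := by
  rw [cosDim, Ne, Submodule.finrank_eq_zero] at hne
  obtain ⟨c', h1, h2⟩ := h.exists_cosSpace_eq_of_sq_eq_one h' (map_zero _) (map_zero _)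
    (Or.inl ⟨rfl, rfl⟩) (Or.inr ⟨rfl, rfl⟩) hc hne
  rcases eq_or_eq_neg_of_sq_eq_sq _ _ (h1.trans (one_pow 2).symm) with rfl | rfl
  · left; rw [cosDim, h2, cosDim]
  · right; rw [cosDim, h2, cosDim]

end Isometry

/-! ### Orthonormal normal form of a Euclidean isometry. -/

section Frame

open scoped InnerProductSpace

variable {E : Type*} [NormedAddCommGroup E] [InnerProductSpace ℝ E]

/-- An orthonormal family adapted to an isometry `A`: eigenvectors with eigenvalues `ε i = ± 1`, and
planes rotated by angles with cosine `c j`. -/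
structure IsCosFrame {ι κ : Type*} (A : E ≃ₗᵢ[ℝ] E) (f : ι ⊕ κ ⊕ κ → E) (ε : ι → ℝ) (c : κ → ℝ) :
    Prop where
  orthonormal : Orthonormal ℝ f
  sq_eq_one : ∀ i, ε i ^ 2 = 1
  mem_Ioo : ∀ j, c j ∈ Set.Ioo (-1 : ℝ) 1
  map_inl : ∀ i, A (f (.inl i)) = ε i • f (.inl i)
  map_inr_inl : ∀ j, A (f (.inr (.inl j))) =
    c j • f (.inr (.inl j)) + √(1 - c j ^ 2) • f (.inr (.inr j))
  map_inr_inr : ∀ j, A (f (.inr (.inr j))) =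
    c j • f (.inr (.inr j)) - √(1 - c j ^ 2) • f (.inr (.inl j))

theorem orthonormal_option {I : Type*} {f : I → E} (hf : Orthonormal ℝ f) {v : E} (hv : ‖v‖ = 1)
    (h : ∀ i, ⟪v, f i⟫_ℝ = 0) : Orthonormal ℝ (fun o : Option I => o.elim v f) := by
  refine ⟨?_, ?_⟩
  · rintro (_ | i)
    · exact hv
    · exact hf.1 i
  · rintro (_ | i) (_ | j) hij
    · exact absurd rfl hij
    · exact h j
    · exact (real_inner_comm _ _).trans (h i)
    · exact hf.2 fun h => hij (congrArg some h)

theorem symm_mem_of_map_mem [FiniteDimensional ℝ E] (A : E ≃ₗᵢ[ℝ] E) {P : Submodule ℝ E}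
    (h : ∀ x ∈ P, A x ∈ P) {x : E} (hx : x ∈ P) : A.symm x ∈ P := by
  have hP : P.map (A.toLinearEquiv : E →ₗ[ℝ] E) = P := by
    apply Submodule.eq_of_le_of_finrank_eq
    · rintro _ ⟨y, hy, rfl⟩
      exact h y hy
    · exact (A.toLinearEquiv.submoduleMap P).finrank_eq.symm
  rw [← hP] at hx
  obtain ⟨y, hy, rfl⟩ := hx
  change A.symm (A y) ∈ P
  rwa [A.symm_apply_apply]

/-- `A + A⁻¹` is symmetric and preserves `U`, so it has an eigenvector there. -/
theorem exists_mem_cosSpace_of_invariant [FiniteDimensional ℝ E] (A : E ≃ₗᵢ[ℝ] E)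
    {U : Submodule ℝ E} (hU : U ≠ ⊥) (h : ∀ x ∈ U, A x ∈ U) :
    ∃ c, ∃ v ∈ U, v ∈ cosSpace A.toLinearEquiv c ∧ ‖v‖ = 1 := by
  let S : E →ₗ[ℝ] E := (A.toLinearEquiv : E →ₗ[ℝ] E) + (A.symm.toLinearEquiv : E →ₗ[ℝ] E)
  have hS : S.IsSymmetric := by
    intro x y
    change ⟪A x + A.symm x, y⟫_ℝ = ⟪x, A y + A.symm y⟫_ℝ
    rw [inner_add_left, inner_add_right, inner_isometry_left A, inner_isometry_left A.symm,
      LinearIsometryEquiv.symm_symm, add_comm]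
  have hSU : ∀ x ∈ U, S x ∈ U := fun x hx => U.add_mem (h x hx) (symm_mem_of_map_mem A h hx)
  have : Nontrivial U := Submodule.nontrivial_iff_ne_bot.2 hU
  obtain ⟨v, hv⟩ := (hS.restrict_invariant hSU).hasEigenvalue_iSup_of_finiteDimensional
    |>.exists_hasEigenvector
  set μ : ℝ := (⨆ x : {x : U // x ≠ 0}, _) with hμ
  have hv1 := congrArg Subtype.val hv.apply_eq_smul
  have hv0 : (v : E) ≠ 0 := fun h => hv.2 (Subtype.ext h)
  refine ⟨μ / 2, (‖(v : E)‖⁻¹ : ℝ) • (v : E), U.smul_mem _ v.2, Submodule.smul_mem _ _ ?_, ?_⟩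
  · rw [mem_cosSpace_isometry, mul_div_cancel₀ _ two_ne_zero]
    exact hv1
  · rw [norm_smul, norm_inv, norm_norm, inv_mul_cancel₀ (norm_ne_zero_iff.2 hv0)]

/-- The orthogonal complement of a partial frame is `A`-invariant and contains a unit eigenvector
`v` of `A + A⁻¹`. Either `v` is an eigenvector of `A` and joins the frame alone, or it joins
together with the normalized `A v - t • v`, which completes a rotation plane. -/
theorem IsCosFrame.exists_extension [FiniteDimensional ℝ E] {ι κ : Type} [Fintype ι] [Fintype κ]
    {A : E ≃ₗᵢ[ℝ] E} {f : ι ⊕ κ ⊕ κ → E} {ε : ι → ℝ} {c : κ → ℝ} (hf : IsCosFrame A f ε c)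
    (hlt : Fintype.card (ι ⊕ κ ⊕ κ) < finrank ℝ E) :
    ∃ (ι' κ' : Type) (_ : Fintype ι') (_ : Fintype κ') (f' : ι' ⊕ κ' ⊕ κ' → E) (ε' : ι' → ℝ)
      (c' : κ' → ℝ), IsCosFrame A f' ε' c' ∧
      Fintype.card (ι ⊕ κ ⊕ κ) < Fintype.card (ι' ⊕ κ' ⊕ κ') := by
  set P := Submodule.span ℝ (Set.range f) with hP
  have hmem : ∀ i, f i ∈ P := fun i => Submodule.subset_span ⟨i, rfl⟩
  have hAP : ∀ x ∈ P, A x ∈ P := by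
    have : P ≤ P.comap (A.toLinearEquiv : E →ₗ[ℝ] E) := by
      rw [hP, Submodule.span_le]
      rintro _ ⟨i | j | j, rfl⟩
      · change A _ ∈ P
        rw [hf.map_inl]; exact P.smul_mem _ (hmem _)
      · change A _ ∈ P
        rw [hf.map_inr_inl]; exact P.add_mem (P.smul_mem _ (hmem _)) (P.smul_mem _ (hmem _))
      · change A _ ∈ P
        rw [hf.map_inr_inr]; exact P.sub_mem (P.smul_mem _ (hmem _)) (P.smul_mem _ (hmem _))
    exact this
  have hU : Pᗮ ≠ ⊥ := by
    intro h
    have := finrank_span_eq_card hf.orthonormal.linearIndependent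
    rw [← hP, (Submodule.orthogonal_eq_bot_iff.1 h), finrank_top] at this
    omega
  have hAU : ∀ x ∈ Pᗮ, A x ∈ Pᗮ := by
    intro x hx
    rw [Submodule.mem_orthogonal] at *
    intro u hu
    have := hx _ (symm_mem_of_map_mem A hAP hu)
    rw [inner_isometry_left A.symm, LinearIsometryEquiv.symm_symm] at this
    exact this
  obtain ⟨t, v, hvU, hv, hv1⟩ := exists_mem_cosSpace_of_invariant A hU hAU
  have hv0 : v ≠ 0 := by rintro rfl; simp at hv1
  have hort : ∀ x ∈ Pᗮ, ∀ i, ⟪x, f i⟫_ℝ = 0 := fun x hx i => by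
    rw [real_inner_comm]; exact (Submodule.mem_orthogonal _ _).1 hx _ (hmem i)
  have hon := orthonormal_option hf.orthonormal hv1 (hort v hvU)
  have hvv : ⟪v, v⟫_ℝ = 1 := by rw [real_inner_self_eq_norm_sq, hv1, one_pow]
  by_cases ht : t ^ 2 = 1
  · let e : Option ι ⊕ κ ⊕ κ → Option (ι ⊕ κ ⊕ κ) :=
      Sum.elim (fun o => o.map Sum.inl) (fun x => some (Sum.inr x))
    have he : Function.Injective e := by
      clear * -
      rintro ((_ | i) | x) ((_ | j) | y) h <;> simp_all [e]
    refine ⟨Option ι, κ, inferInstance, inferInstance, _, fun o => o.elim t ε, c,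
      ⟨hon.comp e he, ?_, hf.mem_Ioo, ?_, hf.map_inr_inl, hf.map_inr_inr⟩, ?_⟩
    · rintro (_ | i)
      · exact ht
      · exact hf.sq_eq_one i
    · rintro (_ | i)
      · exact map_eq_smul_of_mem_cosSpace hv ht
      · exact hf.map_inl i
    · simp only [Fintype.card_sum, Fintype.card_option]; omega
  · have htI : t ∈ Set.Ioo (-1 : ℝ) 1 :=
      mem_Ioo_neg_one_one.2 ⟨sq_le_one_of_mem_cosSpace hv hv0, ht⟩
    have hpos : 0 < 1 - t ^ 2 := by nlinarith [htI.1, htI.2]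
    set s := √(1 - t ^ 2) with hs
    have hs0 : s ≠ 0 := (Real.sqrt_pos.2 hpos).ne'
    have hss : s ^ 2 = 1 - t ^ 2 := Real.sq_sqrt hpos.le
    set y := s⁻¹ • (A v - t • v) with hy
    have hAv : A v = t • v + s • y := by
      rw [hy, smul_smul, mul_inv_cancel₀ hs0, one_smul]; abel
    have hyy : ⟪y, y⟫_ℝ = 1 := by
      rw [hy, inner_smul_left, inner_smul_right, inner_self_map_sub hv, hvv, ← hss]
      simp only [conj_trivial]
      field_simp
    have hy1 : ‖y‖ = 1 := by
      rw [real_inner_self_eq_norm_sq] at hyy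
      exact (pow_eq_one_iff_of_nonneg (norm_nonneg _) two_ne_zero).1 hyy
    have hyv : ⟪y, v⟫_ℝ = 0 := by
      rw [hy, inner_smul_left, inner_sub_left, inner_smul_left, real_inner_comm,
        inner_map_self_of_mem_cosSpace hv]
      simp
    have hyU : y ∈ Pᗮ := Submodule.smul_mem _ _
      (Submodule.sub_mem _ (hAU v hvU) (Submodule.smul_mem _ _ hvU))
    have hAy : A y = t • y - s • v := by
      have h2 : A (A v) = (2 * t) • A v - v := mem_cosSpace_iff_sq.1 hv
      apply smul_right_injective E hs0
      simp only
      rw [← map_smul]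
      have : s • y = A v - t • v := by rw [hAv]; abel
      rw [this, map_sub, h2, map_smul, smul_sub, smul_comm s t, this, smul_smul, ← sq, hss]
      module
    have hon2 := orthonormal_option hon hy1 (by
      rintro (_ | i)
      · exact hyv
      · exact hort y hyU i)
    let e : ι ⊕ Option κ ⊕ Option κ → Option (Option (ι ⊕ κ ⊕ κ)) :=
      Sum.elim (fun i => some (some (.inl i)))
        (Sum.elim (fun o => some (o.map fun j => .inr (.inl j)))
          (fun o => o.elim none fun j => some (some (.inr (.inr j)))))
    have he : Function.Injective e := by
      clear * -
      rintro (i | (_ | i) | (_ | i)) (j | (_ | j) | (_ | j)) h <;> simp_all [e]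
    refine ⟨ι, Option κ, inferInstance, inferInstance, _, ε, fun o => o.elim t c,
      ⟨hon2.comp e he, hf.sq_eq_one, ?_, hf.map_inl, ?_, ?_⟩, ?_⟩
    · rintro (_ | i)
      · exact htI
      · exact hf.mem_Ioo i
    · rintro (_ | i)
      · exact hAv
      · exact hf.map_inr_inl i
    · rintro (_ | i)
      · exact hAy
      · exact hf.map_inr_inr i
    · simp only [Fintype.card_sum, Fintype.card_option]; omega

theorem exists_cosFrame [FiniteDimensional ℝ E] (A : E ≃ₗᵢ[ℝ] E) :
    ∃ (ι κ : Type) (_ : Fintype ι) (_ : Fintype κ) (b : OrthonormalBasis (ι ⊕ κ ⊕ κ) ℝ E)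
      (ε : ι → ℝ) (c : κ → ℝ), IsCosFrame A b ε c := by
  by_contra hcon
  -- Without a frame that is a basis, extension never stops and frames become larger than the
  -- dimension.
  have key : ∀ N : ℕ, ∃ (ι κ : Type) (_ : Fintype ι) (_ : Fintype κ) (f : ι ⊕ κ ⊕ κ → E)
      (ε : ι → ℝ) (c : κ → ℝ), IsCosFrame A f ε c ∧ N ≤ Fintype.card (ι ⊕ κ ⊕ κ) := by
    intro N
    induction N with
    | zero =>
      exact ⟨Empty, Empty, inferInstance, inferInstance, fun x => by rcases x with x | x | x <;>
        exact x.elim, fun x => x.elim, fun x => x.elim, ⟨⟨by rintro (x | x | x) <;> exact x.elim,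
          by rintro (x | x | x) <;> exact x.elim⟩, fun x => x.elim, fun x => x.elim,
          fun x => x.elim, fun x => x.elim, fun x => x.elim⟩, Nat.zero_le _⟩
    | succ N ih =>
      obtain ⟨ι, κ, _, _, f, ε, c, hf, hN⟩ := ih
      have hle := hf.orthonormal.linearIndependent.fintype_card_le_finrank
      rcases hle.lt_or_eq with hlt | heq
      · obtain ⟨ι', κ', i1, i2, f', ε', c', hf', hlt'⟩ := hf.exists_extension hlt
        exact ⟨ι', κ', i1, i2, f', ε', c', hf', by omega⟩
      · obtain ⟨b, hb⟩ := Orthonormal.exists_orthonormalBasis_extension_of_card_eq heq.symm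
          (v := f) (s := Set.univ) (hf.orthonormal.comp _ Subtype.val_injective)
        have hb' : (b : ι ⊕ κ ⊕ κ → E) = f := funext fun i => hb i trivial
        exact absurd ⟨ι, κ, _, _, b, ε, c, by rw [hb']; exact hf⟩ hcon
  obtain ⟨ι, κ, _, _, f, ε, c, hf, hN⟩ := key (finrank ℝ E + 1)
  have hle := hf.orthonormal.linearIndependent.fintype_card_le_finrank
  omega

theorem exists_isCosFrame {ι κ : Type*} [Fintype ι] [Fintype κ]
    (b : OrthonormalBasis (ι ⊕ κ ⊕ κ) ℝ E) {ε : ι → ℝ} {c : κ → ℝ} (hε : ∀ i, ε i ^ 2 = 1)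
    (hc : ∀ j, c j ∈ Set.Ioo (-1 : ℝ) 1) : ∃ A : E ≃ₗᵢ[ℝ] E, IsCosFrame A b ε c := by
  classical
  have : FiniteDimensional ℝ E := b.toBasis.finiteDimensional_of_finite
  let g : ι ⊕ κ ⊕ κ → E := Sum.elim (fun i => ε i • b (.inl i))
    (Sum.elim (fun j => c j • b (.inr (.inl j)) + √(1 - c j ^ 2) • b (.inr (.inr j)))
      (fun j => c j • b (.inr (.inr j)) - √(1 - c j ^ 2) • b (.inr (.inl j))))
  have hs : ∀ j, √(1 - c j ^ 2) * √(1 - c j ^ 2) = 1 - c j ^ 2 := fun j =>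
    Real.mul_self_sqrt (by nlinarith [(hc j).1, (hc j).2])
  have hb := orthonormal_iff_ite.1 b.orthonormal
  have hg : Orthonormal ℝ g := by
    rw [orthonormal_iff_ite]
    rintro (i | i | i) (j | j | j)
    all_goals
      simp only [g, Sum.elim_inl, Sum.elim_inr, inner_add_left, inner_add_right, inner_sub_left,
        inner_sub_right, inner_smul_left, inner_smul_right, hb, conj_trivial, Sum.inl.injEq,
        Sum.inr.injEq, reduceCtorEq, if_false, mul_zero, add_zero, sub_zero, zero_add, zero_sub]
    all_goals
      by_cases hij : i = j
      · subst hij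
        simp only [if_true]
        first
          | linear_combination hε i
          | linear_combination hs i
          | ring
      · simp [hij]
  obtain ⟨b', hb'⟩ := Orthonormal.exists_orthonormalBasis_extension_of_card_eq
    (finrank_eq_card_basis b.toBasis) (v := g) (s := Set.univ)
    (hg.comp _ Subtype.val_injective)
  have hA : ∀ i, b.equiv b' (Equiv.refl _) (b i) = g i := fun i => by
    rw [OrthonormalBasis.equiv_apply_basis]; exact hb' i trivial
  exact ⟨b.equiv b' (Equiv.refl _), b.orthonormal, hε, hc, fun i => hA _, fun j => hA _,
    fun j => hA _⟩

end Frame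

/-! ### Functions on a finite set, up to relabelling of points and values. -/

section Fibers

open Finset

/-- The multiset of the sizes of the nonempty fibers of a function on a finite type. -/
noncomputable def fiberSizes {κ β : Type*} [Fintype κ] [DecidableEq β] (c : κ → β) : Multiset ℕ :=
  (univ.image c).val.map fun t => #{j | c j = t}

theorem sum_fiberSizes {κ β : Type*} [Fintype κ] [DecidableEq β] (c : κ → β) :
    (fiberSizes c).sum = Fintype.card κ := by
  rw [fiberSizes, Finset.sum_map_val, ← Finset.card_eq_sum_card_image, Finset.card_univ]

theorem pos_of_mem_fiberSizes {κ β : Type*} [Fintype κ] [DecidableEq β] {c : κ → β} {u : ℕ}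
    (h : u ∈ fiberSizes c) : 0 < u := by
  rw [fiberSizes, Multiset.mem_map] at h
  obtain ⟨t, ht, rfl⟩ := h
  obtain ⟨j, -, rfl⟩ := Finset.mem_image.1 ht
  exact Finset.card_pos.2 ⟨j, by simp⟩

theorem fiberSizes_comp {κ X β : Type*} [Fintype κ] [Fintype X] [DecidableEq X] [DecidableEq β]
    {p : κ → X} (hp : Function.Surjective p) {φ : X → β} (hφ : Function.Injective φ) :
    fiberSizes (φ ∘ p) = univ.val.map fun x => #{k | p k = x} := by
  have : univ.image (φ ∘ p) = univ.map ⟨φ, hφ⟩ := by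
    rw [← Finset.image_image, Finset.image_univ_of_surjective hp, Finset.map_eq_image]; rfl
  rw [fiberSizes, this, Finset.map_val, Multiset.map_map]
  refine Multiset.map_congr rfl fun x _ => ?_
  simp [hφ.eq_iff]

theorem exists_equiv_of_card_fiber_eq {α β γ : Type*} [Fintype α] [Fintype β] [DecidableEq γ]
    {f : α → γ} {g : β → γ} (h : ∀ t, #{x | f x = t} = #{x | g x = t}) :
    ∃ e : α ≃ β, ∀ x, g (e x) = f x := by
  have e : ∀ t, {x // f x = t} ≃ {x // g x = t} := fun t =>
    Fintype.equivOfCardEq (by rw [Fintype.card_subtype, Fintype.card_subtype, h])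
  exact ⟨Equiv.ofFiberEquiv e, Equiv.ofFiberEquiv_map e⟩

theorem count_fiberSizes {κ β : Type*} [Fintype κ] [DecidableEq β] (c : κ → β) (u : ℕ) :
    #{t : univ.image c | #{j | c j = t} = u} = (fiberSizes c).count u := by
  rw [fiberSizes, Multiset.count_map]
  change _ = #{t ∈ univ.image c | u = #{j | c j = t}}
  refine Finset.card_bij (fun t _ => t.1) ?_ ?_ ?_
  · intro t ht
    simp only [Finset.mem_filter, Finset.mem_univ, true_and] at ht ⊢
    exact ⟨t.2, ht.symm⟩
  · intro a _ b _ hab; exact Subtype.ext hab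
  · intro t ht
    rw [Finset.mem_filter] at ht
    exact ⟨⟨t, ht.1⟩, by simpa using ht.2.symm, rfl⟩

/-- Match the values so that fiber sizes agree (`σ`), then match points inside corresponding fibers
(`e`). -/
theorem exists_equiv_of_fiberSizes_eq {κ κ' β : Type*} [Fintype κ] [Fintype κ'] [DecidableEq β]
    {c : κ → β} {c' : κ' → β} (h : fiberSizes c = fiberSizes c') :
    ∃ e : κ ≃ κ', ∀ i j, c i = c j ↔ c' (e i) = c' (e j) := by
  obtain ⟨σ, hσ⟩ := exists_equiv_of_card_fiber_eq
    (f := fun t : univ.image c => #{j | c j = t}) (g := fun t : univ.image c' => #{j | c' j = t})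
    fun u => by rw [count_fiberSizes, count_fiberSizes, h]
  have hm : ∀ i, c i ∈ univ.image c := fun i => by simp
  have hm' : ∀ i, c' i ∈ univ.image c' := fun i => by simp
  obtain ⟨e, he⟩ := exists_equiv_of_card_fiber_eq
    (f := fun i => σ ⟨c i, hm i⟩) (g := fun i => (⟨c' i, hm' i⟩ : univ.image c')) fun t => by
      obtain ⟨t, rfl⟩ := σ.surjective t
      have := hσ t
      simp only [Subtype.ext_iff, σ.injective.eq_iff]
      exact this.symm
  refine ⟨e, fun i j => ?_⟩
  have := congrArg₂ (fun a b => a = b) (he i) (he j)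
  simp only [σ.injective.eq_iff, Subtype.mk.injEq, eq_iff_iff] at this
  exact this.symm

end Fibers

/-! ### Types of isometries: invariance, realization, sufficiency. -/

section FrameDim

open scoped InnerProductSpace

variable {E : Type*} [NormedAddCommGroup E] [InnerProductSpace ℝ E]
  {I ι κ : Type*} [Fintype I] [Fintype ι] [Fintype κ]

/-- `A + A⁻¹` is symmetric, so a vector of one eigenspace has zero coefficients at basis vectors
belonging to the others. -/
theorem cosSpace_eq_span {A : E ≃ₗᵢ[ℝ] E} (b : OrthonormalBasis I ℝ E) {μ : I → ℝ}
    (h : ∀ i, b i ∈ cosSpace A.toLinearEquiv (μ i)) (t : ℝ) :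
    cosSpace A.toLinearEquiv t = Submodule.span ℝ (Set.range fun i : {i // μ i = t} => b i) := by
  apply le_antisymm
  · intro x hx
    rw [← b.sum_repr' x]
    refine Submodule.sum_mem _ fun i _ => ?_
    by_cases hi : μ i = t
    · exact Submodule.smul_mem _ _ (Submodule.subset_span ⟨⟨i, hi⟩, rfl⟩)
    · have h1 := congrArg (fun y => ⟪b i, y⟫_ℝ) (mem_cosSpace_isometry.1 hx)
      have h2 := congrArg (fun y => ⟪y, x⟫_ℝ) (mem_cosSpace_isometry.1 (h i))
      simp only [inner_add_left, inner_add_right, inner_smul_left, inner_smul_right,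
        inner_isometry_left, conj_trivial, LinearIsometryEquiv.symm_symm] at h1 h2
      have h3 : (μ i - t) * ⟪b i, x⟫_ℝ = 0 := by linarith
      rw [(mul_eq_zero.1 h3).resolve_left (sub_ne_zero.2 hi), zero_smul]
      exact Submodule.zero_mem _
  · rw [Submodule.span_le]
    rintro _ ⟨⟨i, rfl⟩, rfl⟩
    exact h i

theorem cosDim_eq_card {A : E ≃ₗᵢ[ℝ] E} (b : OrthonormalBasis I ℝ E) {μ : I → ℝ}
    (h : ∀ i, b i ∈ cosSpace A.toLinearEquiv (μ i)) (t : ℝ) :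
    cosDim A.toLinearEquiv t = Fintype.card {i // μ i = t} := by
  rw [cosDim, cosSpace_eq_span b h t]
  exact finrank_span_eq_card (b.orthonormal.linearIndependent.comp _ Subtype.val_injective)

theorem iSup_cosSpace_eq_top {A : E ≃ₗᵢ[ℝ] E} (b : OrthonormalBasis I ℝ E) {μ : I → ℝ}
    (h : ∀ i, b i ∈ cosSpace A.toLinearEquiv (μ i)) : ⨆ c, cosSpace A.toLinearEquiv c = ⊤ := by
  rw [eq_top_iff, ← b.toBasis.span_eq, Submodule.span_le]
  rintro _ ⟨i, rfl⟩
  rw [OrthonormalBasis.coe_toBasis]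
  exact Submodule.mem_iSup_of_mem (μ i) (h i)

variable {A A' : E ≃ₗᵢ[ℝ] E} {b : OrthonormalBasis (ι ⊕ κ ⊕ κ) ℝ E} {ε ε' : ι → ℝ} {c c' : κ → ℝ}

omit [Fintype ι] [Fintype κ] in
theorem IsCosFrame.sqrt_mul_self {f : ι ⊕ κ ⊕ κ → E} (hf : IsCosFrame A f ε c) (j : κ) :
    √(1 - c j ^ 2) * √(1 - c j ^ 2) = 1 - c j ^ 2 :=
  Real.mul_self_sqrt (by nlinarith [(hf.mem_Ioo j).1, (hf.mem_Ioo j).2])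

omit [Fintype ι] [Fintype κ] in
theorem IsCosFrame.mem_cosSpace {f : ι ⊕ κ ⊕ κ → E} (hf : IsCosFrame A f ε c) (i : ι ⊕ κ ⊕ κ) :
    f i ∈ cosSpace A.toLinearEquiv (Sum.elim ε (Sum.elim c c) i) := by
  rcases i with i | j | j
  · exact mem_cosSpace_of_map_eq_smul (hf.map_inl i) (hf.sq_eq_one i)
  · rw [mem_cosSpace_iff_sq]
    simp only [LinearIsometryEquiv.coe_toLinearEquiv, hf.map_inr_inl, hf.map_inr_inr, map_add,
      map_smul, Sum.elim_inl, Sum.elim_inr, smul_sub, smul_smul, hf.sqrt_mul_self]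
    module
  · rw [mem_cosSpace_iff_sq]
    simp only [LinearIsometryEquiv.coe_toLinearEquiv, hf.map_inr_inl, hf.map_inr_inr, map_sub,
      map_smul, Sum.elim_inr, smul_add, smul_smul, hf.sqrt_mul_self]
    module

theorem IsCosFrame.cosDim_of_sq_eq_one (hf : IsCosFrame A b ε c) {t : ℝ} (ht : t ^ 2 = 1) :
    cosDim A.toLinearEquiv t = Fintype.card {i // ε i = t} := by
  rw [cosDim_eq_card b hf.mem_cosSpace]
  have hc : ∀ j, c j ≠ t := fun j h => (mem_Ioo_neg_one_one.1 (hf.mem_Ioo j)).2 (by rw [h, ht])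
  refine Fintype.card_congr ⟨fun x => match x with
    | ⟨.inl i, h⟩ => ⟨i, h⟩
    | ⟨.inr (.inl j), h⟩ => absurd h (hc j)
    | ⟨.inr (.inr j), h⟩ => absurd h (hc j), fun x => ⟨.inl x.1, x.2⟩, ?_, fun _ => rfl⟩
  rintro ⟨i | j | j, h⟩
  · rfl
  · exact absurd h (hc j)
  · exact absurd h (hc j)

theorem IsCosFrame.cosDim_of_mem_Ioo (hf : IsCosFrame A b ε c) {t : ℝ}
    (ht : t ∈ Set.Ioo (-1 : ℝ) 1) :
    cosDim A.toLinearEquiv t = 2 * Fintype.card {j // c j = t} := by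
  rw [cosDim_eq_card b hf.mem_cosSpace, two_mul, ← Fintype.card_sum]
  have hε : ∀ i, ε i ≠ t := fun i h => (mem_Ioo_neg_one_one.1 ht).2 (by rw [← h, hf.sq_eq_one])
  refine Fintype.card_congr ⟨fun x => match x with
    | ⟨.inl i, h⟩ => absurd h (hε i)
    | ⟨.inr (.inl j), h⟩ => .inl ⟨j, h⟩
    | ⟨.inr (.inr j), h⟩ => .inr ⟨j, h⟩, fun x => match x with
    | .inl x => ⟨.inr (.inl x.1), x.2⟩
    | .inr x => ⟨.inr (.inr x.1), x.2⟩, ?_, ?_⟩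
  · rintro ⟨i | j | j, h⟩
    · exact absurd h (hε i)
    · rfl
    · rfl
  · rintro (x | x) <;> rfl

/-- Each rotation plane contributes two frame vectors, so the halving in `halfType` is exact and
counts planes. The frame also shows that only finitely many `c` occur, so the finite sum in
`halfType` is not a default value. -/
theorem IsCosFrame.halfType_eq (hf : IsCosFrame A b ε c) :
    halfType (cosDim A.toLinearEquiv) = fiberSizes c := by
  classical
  have hs : {t | t ∈ Set.Ioo (-1 : ℝ) 1 ∧ cosDim A.toLinearEquiv t ≠ 0} =
      ((Finset.univ.image c : Finset ℝ) : Set ℝ) := by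
    ext t
    simp only [Set.mem_ofPred_eq, Finset.coe_image, Finset.coe_univ, Set.image_univ, Set.mem_range]
    constructor
    · rintro ⟨ht, hne⟩
      rw [hf.cosDim_of_mem_Ioo ht] at hne
      have : Fintype.card {j // c j = t} ≠ 0 := fun h => hne (by rw [h])
      obtain ⟨⟨j, hj⟩⟩ := Fintype.card_pos_iff.1 (Nat.pos_of_ne_zero this)
      exact ⟨j, hj⟩
    · rintro ⟨j, rfl⟩
      refine ⟨hf.mem_Ioo j, ?_⟩
      rw [hf.cosDim_of_mem_Ioo (hf.mem_Ioo j)]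
      have : 0 < Fintype.card {i // c i = c j} := Fintype.card_pos_iff.2 ⟨⟨j, rfl⟩⟩
      omega
  have h2 : ∀ t ∈ Finset.univ.image c, ({cosDim A.toLinearEquiv t / 2} : Multiset ℕ) =
      {Finset.card {j | c j = t}} := by
    intro t ht
    obtain ⟨j, -, rfl⟩ := Finset.mem_image.1 ht
    rw [hf.cosDim_of_mem_Ioo (hf.mem_Ioo j), Fintype.card_subtype]
    congr 1; omega
  rw [halfType, hs, finsum_mem_coe_finset, Finset.sum_congr rfl h2, fiberSizes,
    ← Finset.sum_map_val]
  conv_rhs => rw [← Multiset.sum_map_singleton (Multiset.map _ _), Multiset.map_map]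
  rfl

/-- Frame vectors are counted. This is the only relation between the dimensions for `1` and `-1` and
the multiset of multiplicities, and it governs all three counts. -/
theorem cosDim_add_cosDim [FiniteDimensional ℝ E] (A : E ≃ₗᵢ[ℝ] E) :
    cosDim A.toLinearEquiv 1 + cosDim A.toLinearEquiv (-1) +
      2 * (halfType (cosDim A.toLinearEquiv)).sum = finrank ℝ E := by
  classical
  obtain ⟨ι, κ, _, _, b, ε, c, hf⟩ := exists_cosFrame A
  rw [hf.halfType_eq, sum_fiberSizes, hf.cosDim_of_sq_eq_one (by norm_num),
    hf.cosDim_of_sq_eq_one (by norm_num), finrank_eq_card_basis b.toBasis, Fintype.card_sum,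
    Fintype.card_sum, Fintype.card_subtype, Fintype.card_subtype]
  have : Fintype.card ι = Finset.card {i | ε i = 1} + Finset.card {i | ε i = -1} := by
    rw [← Finset.card_univ, ← Finset.card_filter_add_card_filter_not (fun i => ε i = 1)]
    congr 2
    ext i
    have h1 : ε i = 1 ∨ ε i = -1 :=
      eq_or_eq_neg_of_sq_eq_sq _ _ ((hf.sq_eq_one i).trans (one_pow 2).symm)
    simp only [Finset.mem_filter, Finset.mem_univ, true_and]
    constructor
    · exact h1.resolve_left
    · intro h h'; rw [h] at h'; norm_num at h'
  omega

theorem pos_of_mem_halfType [FiniteDimensional ℝ E] (A : E ≃ₗᵢ[ℝ] E) {u : ℕ}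
    (h : u ∈ halfType (cosDim A.toLinearEquiv)) : 0 < u := by
  obtain ⟨ι, κ, _, _, b, ε, c, hf⟩ := exists_cosFrame A
  rw [hf.halfType_eq] at h
  exact pos_of_mem_fiberSizes h

theorem exists_isometry_of_type {m a b : ℕ} {M : Multiset ℕ} (hM : ∀ u ∈ M, 0 < u)
    (h : a + b + 2 * M.sum = m) :
    ∃ A : EuclideanSpace ℝ (Fin m) ≃ₗᵢ[ℝ] EuclideanSpace ℝ (Fin m),
      cosDim A.toLinearEquiv 1 = a ∧ cosDim A.toLinearEquiv (-1) = b ∧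
      halfType (cosDim A.toLinearEquiv) = M := by
  classical
  induction M using Quotient.inductionOn with | _ l
  -- One index for each rotation plane: `l.get j` planes share the `j`-th angle.
  let κ := Σ j : Fin l.length, Fin (l.get j)
  have hp : Function.Surjective (Sigma.fst : κ → Fin l.length) := fun j =>
    ⟨⟨j, ⟨0, hM _ (by simp)⟩⟩, rfl⟩
  -- Any distinct cosines in `(-1, 1)` would do; the shift by `2` keeps the values below `1`.
  let φ : Fin l.length → ℝ := fun j => 1 / ((j : ℝ) + 2)
  have hφ : Function.Injective φ := by
    intro i j hij
    have : (i : ℝ) + 2 = j + 2 := by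
      simpa [φ] using hij
    exact Fin.ext (by exact_mod_cast add_right_cancel this)
  have hcard : ∀ j, Finset.card {k : κ | k.1 = j} = l.get j := fun j => by
    rw [← Fintype.card_subtype, Fintype.card_congr (Equiv.sigmaSubtype j), Fintype.card_fin]
  have hsz : fiberSizes (φ ∘ (Sigma.fst : κ → Fin l.length)) = (l : Multiset ℕ) := by
    rw [fiberSizes_comp hp hφ]
    rw [Multiset.map_congr (g := l.get) rfl fun j _ => by convert hcard j, Fin.univ_val_map,
      List.ofFn_get]
  have hκ : Fintype.card κ = (l : Multiset ℕ).sum := by rw [← hsz, sum_fiberSizes]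
  have hcardI : Fintype.card ((Fin a ⊕ Fin b) ⊕ κ ⊕ κ) = Fintype.card (Fin m) := by
    simp only [Fintype.card_sum, Fintype.card_fin, hκ]
    change _ + 2 * (l : Multiset ℕ).sum = _ at h
    omega
  let B := (EuclideanSpace.basisFun (Fin m) ℝ).reindex (Fintype.equivOfCardEq hcardI).symm
  obtain ⟨A, hA⟩ := exists_isCosFrame B (ε := Sum.elim (fun _ => 1) (fun _ => -1))
    (c := φ ∘ (Sigma.fst : κ → Fin l.length)) (by rintro (i | i) <;> simp) (by
      intro j
      change 1 / ((j.1 : ℕ) + 2 : ℝ) ∈ Set.Ioo (-1 : ℝ) 1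
      have : (0 : ℝ) ≤ (j.1 : ℕ) := Nat.cast_nonneg _
      refine ⟨lt_trans (by norm_num) (show (0 : ℝ) < _ by positivity), ?_⟩
      rw [div_lt_one (by positivity)]
      linarith)
  refine ⟨A, ?_, ?_, hA.halfType_eq.trans hsz⟩
  · rw [hA.cosDim_of_sq_eq_one (by norm_num), Fintype.card_subtype, Finset.card_filter,
      Fintype.sum_sum_type]
    norm_num
  · rw [hA.cosDim_of_sq_eq_one (by norm_num), Fintype.card_subtype, Finset.card_filter,
      Fintype.sum_sum_type]
    norm_num

/-- In a plane, a rotation with nonzero sine spans, together with the identity, all rotations of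
that plane. The hypothesis makes the coefficients constant on each eigenspace of `A + A⁻¹`. -/
theorem IsCosFrame.isCosCombination (hf : IsCosFrame A b ε c) (hf' : IsCosFrame A' b ε c')
    (h : ∀ i j, c i = c j → c' i = c' j) :
    IsCosCombination A.toLinearEquiv A'.toLinearEquiv := by
  -- it suffices to check the equation on the frame
  have key : ∀ t α β : ℝ, (∀ i, Sum.elim ε (Sum.elim c c) i = t →
      A' (b i) = α • b i + β • A (b i)) →
      ∀ x ∈ cosSpace A.toLinearEquiv t, A' x = α • x + β • A x := by
    intro t α β hb x hx
    rw [cosSpace_eq_span b hf.mem_cosSpace] at hx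
    induction hx using Submodule.span_induction with
    | mem x hx => obtain ⟨i, rfl⟩ := hx; exact hb i i.2
    | zero => simp
    | add x y _ _ hx hy => rw [map_add, map_add, hx, hy]; module
    | smul r x _ hx => rw [map_smul, map_smul, hx]; module
  intro t
  by_cases ht : t ^ 2 = 1
  · refine ⟨t, 0, key t t 0 ?_⟩
    rintro (i | j | j) hi
    · rw [hf'.map_inl, zero_smul, add_zero]
      exact congrArg (· • _) hi
    · exact absurd ht (hi ▸ (mem_Ioo_neg_one_one.1 (hf.mem_Ioo j)).2)
    · exact absurd ht (hi ▸ (mem_Ioo_neg_one_one.1 (hf.mem_Ioo j)).2)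
  by_cases hj : ∃ j, c j = t
  · obtain ⟨k, rfl⟩ := hj
    have hs : √(1 - c k ^ 2) ≠ 0 :=
      (Real.sqrt_pos.2 (by nlinarith [(hf.mem_Ioo k).1, (hf.mem_Ioo k).2])).ne'
    -- `β` matches the sines; the coefficient of the identity then corrects the cosines.
    set β := √(1 - c' k ^ 2) / √(1 - c k ^ 2) with hβ
    have hβs : β * √(1 - c k ^ 2) = √(1 - c' k ^ 2) := div_mul_cancel₀ _ hs
    refine ⟨c' k - β * c k, β, key _ _ _ ?_⟩
    rintro (i | j | j) hi
    · exact absurd (by rw [← hi]; exact hf.sq_eq_one i) ht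
    · have hi : c j = c k := hi
      rw [hf'.map_inr_inl, hf.map_inr_inl, hi, h j k hi, ← hβs]
      module
    · have hi : c j = c k := hi
      rw [hf'.map_inr_inr, hf.map_inr_inr, hi, h j k hi, ← hβs]
      module
  · refine ⟨0, 0, key t 0 0 ?_⟩
    rintro (i | j | j) hi
    · exact absurd (by rw [← hi]; exact hf.sq_eq_one i) ht
    · exact absurd ⟨j, hi⟩ hj
    · exact absurd ⟨j, hi⟩ hj

theorem IsCosFrame.cosSpace_one_le (hf : IsCosFrame A b ε c) (hf' : IsCosFrame A' b ε c') :
    cosSpace A.toLinearEquiv 1 ≤ cosSpace A'.toLinearEquiv 1 := by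
  rw [cosSpace_eq_span b hf.mem_cosSpace, Submodule.span_le]
  rintro _ ⟨⟨i | j | j, h⟩, rfl⟩
  · have h : ε i = 1 := h
    exact mem_cosSpace_one.2 (by rw [hf'.map_inl, h, one_smul])
  · exact absurd h (hf.mem_Ioo j).2.ne
  · exact absurd h (hf.mem_Ioo j).2.ne

omit [Fintype ι] [Fintype κ] in
theorem IsCosFrame.conj {f : ι ⊕ κ ⊕ κ → E} (hf : IsCosFrame A f ε c) (g : E ≃ₗᵢ[ℝ] E) :
    IsCosFrame (g * A * g⁻¹) (g ∘ f) ε c := by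
  have h : ∀ x, (g * A * g⁻¹) (g x) = g (A x) := fun x =>
    congrArg (fun y => g (A y)) (g.symm_apply_apply x)
  refine ⟨hf.orthonormal.comp_linearIsometryEquiv g, hf.sq_eq_one, hf.mem_Ioo, fun i => ?_,
    fun j => ?_, fun j => ?_⟩
  · rw [Function.comp, h, hf.map_inl, map_smul]
  · rw [Function.comp, h, hf.map_inr_inl, map_add, map_smul, map_smul]; rfl
  · rw [Function.comp, h, hf.map_inr_inr, map_sub, map_smul, map_smul]; rfl

omit [Fintype ι] [Fintype κ] in
theorem IsCosFrame.reindex {ι' κ' : Type*} {f : ι ⊕ κ ⊕ κ → E} (hf : IsCosFrame A f ε c)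
    (e₁ : ι' ≃ ι) (e₂ : κ' ≃ κ) :
    IsCosFrame A (f ∘ Equiv.sumCongr e₁ (Equiv.sumCongr e₂ e₂)) (ε ∘ e₁) (c ∘ e₂) :=
  ⟨hf.orthonormal.comp _ (Equiv.injective _), fun _ => hf.sq_eq_one _, fun _ => hf.mem_Ioo _,
    fun _ => hf.map_inl _, fun _ => hf.map_inr_inl _, fun _ => hf.map_inr_inr _⟩

/-- Isometries of the same type become, after a conjugation, combinations of each other. -/
theorem exists_conj_isCosCombination [FiniteDimensional ℝ E] {A A' : E ≃ₗᵢ[ℝ] E}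
    (h1 : cosDim A.toLinearEquiv (-1) = cosDim A'.toLinearEquiv (-1))
    (h2 : halfType (cosDim A.toLinearEquiv) = halfType (cosDim A'.toLinearEquiv)) :
    ∃ g : E ≃ₗᵢ[ℝ] E, IsCosCombination (g * A * g⁻¹).toLinearEquiv A'.toLinearEquiv ∧
      IsCosCombination A'.toLinearEquiv (g * A * g⁻¹).toLinearEquiv ∧
      cosSpace (g * A * g⁻¹).toLinearEquiv 1 = cosSpace A'.toLinearEquiv 1 := by
  classical
  -- The dimension formula recovers the multiplicity of `1` from the other data.
  have h3 : cosDim A.toLinearEquiv 1 = cosDim A'.toLinearEquiv 1 := by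
    have e1 := cosDim_add_cosDim A
    have e2 := cosDim_add_cosDim A'
    rw [h1, h2] at e1
    omega
  obtain ⟨ι, κ, _, _, b, ε, c, hf⟩ := exists_cosFrame A
  obtain ⟨ι', κ', _, _, b', ε', c', hf'⟩ := exists_cosFrame A'
  rw [hf.halfType_eq, hf'.halfType_eq] at h2
  rw [hf.cosDim_of_sq_eq_one (by norm_num), hf'.cosDim_of_sq_eq_one (by norm_num),
    Fintype.card_subtype, Fintype.card_subtype] at h1 h3
  obtain ⟨e₂, he₂⟩ := exists_equiv_of_fiberSizes_eq h2
  obtain ⟨e₁, he₁⟩ := exists_equiv_of_card_fiber_eq (f := ε) (g := ε') fun t => by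
    by_cases ht1 : t = 1
    · rw [ht1, h3]
    by_cases ht2 : t = -1
    · rw [ht2, h1]
    have : ¬ t ^ 2 = 1 := fun h =>
      (eq_or_eq_neg_of_sq_eq_sq _ _ (h.trans (one_pow 2).symm)).elim ht1 ht2
    rw [Finset.filter_false_of_mem (by rintro i - rfl; exact this (hf.sq_eq_one i)),
      Finset.filter_false_of_mem (by rintro i - rfl; exact this (hf'.sq_eq_one i))]
    rfl
  -- Carrying one frame to the other along the index matchings gives both isometries the same frame
  -- and signs, with cosines that coincide for the same pairs of indices.
  let g := b.equiv b' (Equiv.sumCongr e₁ (Equiv.sumCongr e₂ e₂))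
  have hg : g ∘ b = b'.reindex (Equiv.sumCongr e₁ (Equiv.sumCongr e₂ e₂)).symm := by
    ext1 i
    simp only [g, Function.comp, OrthonormalBasis.equiv_apply_basis,
      OrthonormalBasis.reindex_apply, Equiv.symm_symm]
  have hF := hf.conj g
  have hF' := hf'.reindex e₁ e₂
  have hb : b' ∘ Equiv.sumCongr e₁ (Equiv.sumCongr e₂ e₂) =
      b'.reindex (Equiv.sumCongr e₁ (Equiv.sumCongr e₂ e₂)).symm := by
    ext1 i
    simp only [Function.comp, OrthonormalBasis.reindex_apply, Equiv.symm_symm]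
  rw [hg] at hF
  rw [hb, show ε' ∘ e₁ = ε from funext he₁] at hF'
  exact ⟨g, hF.isCosCombination hF' fun i j => (he₂ i j).1,
    hF'.isCosCombination hF fun i j => (he₂ i j).2,
    le_antisymm (hF.cosSpace_one_le hF') (hF'.cosSpace_one_le hF)⟩

end FrameDim

/-! ### `z`-equivalence through equality of centralizers after conjugation. -/

section ZEquivLemmas

variable {G : Type*} [Group G]

theorem zClass_eq_iff {x y : G} : zClass x = zClass y ↔ ZEquiv x y :=
  Quotient.eq (r := zSetoid G)

theorem map_conj_centralizer (x g : G) :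
    (Subgroup.centralizer {x}).map (MulAut.conj g).toMonoidHom =
      Subgroup.centralizer {g * x * g⁻¹} := by
  ext y
  rw [Subgroup.mem_map]
  simp only [Subgroup.mem_centralizer_singleton_iff]
  constructor
  · rintro ⟨z, hz, rfl⟩
    simp only [MulEquiv.coe_toMonoidHom, MulAut.conj_apply]
    calc _ = g * (z * x) * g⁻¹ := by group
      _ = _ := by rw [hz]; group
  · intro h
    refine ⟨g⁻¹ * y * g, ?_, by simp [mul_assoc]⟩
    calc _ = g⁻¹ * (y * (g * x * g⁻¹)) * g := by group
      _ = _ := by rw [h]; group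

theorem zEquiv_iff {x y : G} :
    ZEquiv x y ↔ ∃ g : G, Subgroup.centralizer {g * x * g⁻¹} = Subgroup.centralizer {y} := by
  simp only [ZEquiv, map_conj_centralizer]

theorem zEquiv_conj (x g : G) : ZEquiv x (g * x * g⁻¹) := zEquiv_iff.2 ⟨g, rfl⟩

theorem mem_centralizer_iff_of_eq {x y : G}
    (h : Subgroup.centralizer {x} = Subgroup.centralizer {y}) (z : G) :
    z * x = x * z ↔ z * y = y * z := by
  rw [← Subgroup.mem_centralizer_singleton_iff, h, Subgroup.mem_centralizer_singleton_iff]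

end ZEquivLemmas

/-! ### The Lorentz form and the stabilizer of a point of hyperbolic space. -/

namespace Hyp

open scoped InnerProductSpace

/-- Euclidean space of dimension `n`. -/
abbrev Euc (n : ℕ) : Type := EuclideanSpace ℝ (Fin n)

/-- The splitting of `V n` into the time coordinate and the space coordinates. -/
def split (n : ℕ) : V n ≃ₗ[ℝ] ℝ × Euc n where
  toFun x := (x 0, WithLp.toLp 2 fun i => x i.succ)
  invFun p := Fin.cons p.1 p.2
  map_add' _ _ := rfl
  map_smul' _ _ := rfl
  left_inv x := by
    ext i
    refine Fin.cases ?_ (fun i => ?_) i <;> simp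
  right_inv p := by ext <;> simp

variable {n : ℕ}

@[simp] theorem split_fst (x : V n) : (split n x).1 = x 0 := rfl

@[simp] theorem split_symm_zero (p : ℝ × Euc n) : (split n).symm p 0 = p.1 := rfl

theorem Q_eq (x : V n) : Q x = x 0 ^ 2 - ‖(split n x).2‖ ^ 2 := by
  rw [Q, EuclideanSpace.real_norm_sq_eq]; rfl

/-- The bilinear form with quadratic form `Q`. -/
noncomputable def bil (x y : V n) : ℝ := x 0 * y 0 - ⟪(split n x).2, (split n y).2⟫_ℝ

theorem bil_self (x : V n) : bil x x = Q x := by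
  rw [Q_eq, bil, real_inner_self_eq_norm_sq, sq (x 0)]

theorem bil_comm (x y : V n) : bil x y = bil y x := by
  rw [bil, bil, real_inner_comm, mul_comm]

theorem bil_add_left (x y z : V n) : bil (x + y) z = bil x z + bil y z := by
  simp only [bil, map_add, Prod.snd_add, inner_add_left, Pi.add_apply]; ring

theorem bil_smul_left (r : ℝ) (x z : V n) : bil (r • x) z = r * bil x z := by
  simp only [bil, map_smul, Prod.smul_snd, inner_smul_left, Pi.smul_apply, smul_eq_mul,
    conj_trivial]; ring

theorem bil_add_right (x y z : V n) : bil x (y + z) = bil x y + bil x z := by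
  rw [bil_comm, bil_add_left, bil_comm y, bil_comm z]

theorem bil_smul_right (r : ℝ) (x z : V n) : bil x (r • z) = r * bil x z := by
  rw [bil_comm, bil_smul_left, bil_comm]

theorem Q_add (x y : V n) : Q (x + y) = Q x + Q y + 2 * bil x y := by
  rw [← bil_self, ← bil_self, ← bil_self, bil_add_left, bil_add_right, bil_add_right, bil_comm y x]
  ring

theorem Q_smul (r : ℝ) (x : V n) : Q (r • x) = r ^ 2 * Q x := by
  rw [← bil_self, ← bil_self, bil_smul_left, bil_smul_right]; ring

theorem Q_sub (x y : V n) : Q (x - y) = Q x + Q y - 2 * bil x y := by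
  rw [sub_eq_add_neg, ← neg_one_smul ℝ y, Q_add, Q_smul, bil_smul_right]; ring

theorem bil_map_of_Q_map {T : V n →ₗ[ℝ] V n} (hT : ∀ x, Q (T x) = Q x) (x y : V n) :
    bil (T x) (T y) = bil x y := by
  have h := hT (x + y)
  rw [map_add, Q_add, Q_add, hT, hT] at h
  linarith

theorem bil_map (T : Isom n) (x y : V n) : bil (T.1 x) (T.1 y) = bil x y :=
  bil_map_of_Q_map (T := (T.1 : V n →ₗ[ℝ] V n)) T.2.1 x y

theorem eq_zero_of_bil_eq_zero {x : V n} (h : ∀ y, bil x y = 0) : x = 0 := by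
  apply (split n).injective
  rw [map_zero]
  ext1
  · have := h ((split n).symm (1, 0))
    simpa [bil] using this
  · have := h ((split n).symm (0, (split n x).2))
    simpa [bil] using this

theorem map_mem_space (T : Isom n) {x : V n} (hx : x ∈ space n) : T.1 x ∈ space n := by
  rw [← T.2.2]; exact ⟨x, hx, rfl⟩

theorem isom_ext {S T : Isom n} (h : ∀ x, S.1 x = T.1 x) : S = T :=
  Subtype.ext (LinearEquiv.ext h)

theorem isom_mul_apply (S T : Isom n) (x : V n) : (S * T).1 x = S.1 (T.1 x) := rfl

theorem isom_inv_apply_self (S : Isom n) (x : V n) : (S⁻¹).1 (S.1 x) = x :=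
  S.1.symm_apply_apply x

theorem isom_apply_inv_self (S : Isom n) (x : V n) : S.1 ((S⁻¹).1 x) = x :=
  S.1.apply_symm_apply x

/-- An endomorphism of `V n` that preserves `Q` and the sign of the time coordinate on the
hyperboloid is an isometry. -/
theorem exists_isom (T : V n →ₗ[ℝ] V n) (hQ : ∀ x, Q (T x) = Q x)
    (hpos : ∀ x ∈ space n, 0 < T x 0) : ∃ S : Isom n, ∀ x, S.1 x = T x := by
  have hinj : Function.Injective T := by
    rw [← LinearMap.ker_eq_bot, LinearMap.ker_eq_bot']
    intro x hx
    refine eq_zero_of_bil_eq_zero fun y => ?_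
    rw [← bil_map_of_Q_map hQ, hx, bil]; simp
  refine ⟨⟨LinearEquiv.ofInjectiveEndo T hinj, hQ, ?_⟩, fun x => rfl⟩
  apply Set.Subset.antisymm
  · rintro _ ⟨x, hx, rfl⟩
    exact ⟨(hQ x).trans hx.1, hpos x hx⟩
  · intro y hy
    obtain ⟨x, rfl⟩ := (LinearEquiv.ofInjectiveEndo T hinj).surjective y
    have hy1 : Q (T x) = 1 := hy.1
    have hy2 : 0 < T x 0 := hy.2
    have hx1 : Q x = 1 := by rw [← hQ, hy1]
    refine ⟨x, ⟨hx1, ?_⟩, rfl⟩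
    -- Otherwise `-x` lies on the chosen sheet, and so does its image, contrary to the sign of `T x
    -- 0`.
    by_contra! h
    have h0 : x 0 ≠ 0 := by
      intro h0
      rw [Q_eq, h0] at hx1
      nlinarith [norm_nonneg (split n x).2]
    have := hpos (-x) ⟨by rw [← neg_one_smul ℝ x, Q_smul, hx1]; norm_num,
      by simpa using lt_of_le_of_ne h h0⟩
    rw [map_neg] at this
    simp only [Pi.neg_apply] at this
    linarith

/-- Reversed Cauchy–Schwarz inequality: `(1 + ab)² ≤ (1 + a²)(1 + b²)` for the norms `a`, `b` of the
space parts. -/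
theorem one_le_bil {x y : V n} (hx : x ∈ space n) (hy : y ∈ space n) : 1 ≤ bil x y := by
  obtain ⟨hx1, hx0⟩ := hx
  obtain ⟨hy1, hy0⟩ := hy
  rw [Q_eq] at hx1 hy1
  have h := real_inner_le_norm (split n x).2 (split n y).2
  rw [bil]
  set a := ‖(split n x).2‖
  set b := ‖(split n y).2‖
  have ha : 0 ≤ a := norm_nonneg _
  have hb : 0 ≤ b := norm_nonneg _
  have : 1 + a * b ≤ x 0 * y 0 := by
    refine (abs_le_of_sq_le_sq' ?_ (by positivity)).2
    have : (x 0 * y 0) ^ 2 = (1 + a ^ 2) * (1 + b ^ 2) := by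
      rw [mul_pow]; congr 1 <;> linarith
    rw [this]; nlinarith [sq_nonneg (a - b)]
  linarith

theorem mem_space_of_bil_pos {x y : V n} (hx : x ∈ space n) (hy : Q y = 1) (h : 0 < bil x y) :
    y ∈ space n := by
  refine ⟨hy, ?_⟩
  by_contra! h0
  obtain ⟨hx1, hx0⟩ := hx
  rw [Q_eq] at hx1 hy
  have h1 := abs_real_inner_le_norm (split n x).2 (split n y).2
  rw [abs_le] at h1
  rw [bil] at h
  set a := ‖(split n x).2‖
  set b := ‖(split n y).2‖
  have ha : 0 ≤ a := norm_nonneg _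
  have hb : 0 ≤ b := norm_nonneg _
  have h2 : a ≤ x 0 := by nlinarith
  have h3 : b ≤ -y 0 := by nlinarith
  have := mul_le_mul h2 h3 hb hx0.le
  linarith [h1.1]

/-- The symmetry in a point of hyperbolic space. -/
theorem exists_pointReflection {m : V n} (hm : m ∈ space n) :
    ∃ S : Isom n, ∀ x, S.1 x = (2 * bil x m) • m - x := by
  let T : V n →ₗ[ℝ] V n :=
    { toFun := fun x => (2 * bil x m) • m - x
      map_add' := fun x y => by rw [bil_add_left]; module
      map_smul' := fun r x => by rw [bil_smul_left]; simp only [RingHom.id_apply]; module }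
  have hQ : ∀ x, Q (T x) = Q x := fun x => by
    change Q ((2 * bil x m) • m - x) = Q x
    rw [Q_sub, Q_smul, bil_smul_left, hm.1, bil_comm m x]; ring
  refine exists_isom T hQ fun x hx => (mem_space_of_bil_pos hx ((hQ x).trans hx.1) ?_).2
  change 0 < bil x ((2 * bil x m) • m - x)
  rw [sub_eq_add_neg, ← neg_one_smul ℝ x, bil_add_right, bil_smul_right, bil_smul_right, bil_self,
    hx.1]
  nlinarith [one_le_bil hx hm]

/-- The base point of hyperbolic space. -/
def base (n : ℕ) : V n := (split n).symm (1, 0)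

theorem bil_base (x : V n) : bil x (base n) = x 0 := by
  simp [bil, base]

theorem base_mem_space : base n ∈ space n :=
  ⟨by rw [← bil_self, bil_base]; simp [base], by simp [base]⟩

/-- The symmetry in the midpoint of `v` and the base point exchanges them. -/
theorem exists_map_eq_base {v : V n} (hv : v ∈ space n) : ∃ S : Isom n, S.1 v = base n := by
  have h0 : 0 < 1 + v 0 := by linarith [hv.2]
  -- This normalizes the midpoint, since `Q (v + base n) = 2 * (1 + v 0)`.
  set r := (√(2 * (1 + v 0)))⁻¹ with hr
  have hr2 : r ^ 2 * (2 * (1 + v 0)) = 1 := by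
    rw [hr, inv_pow, Real.sq_sqrt (by positivity), inv_mul_cancel₀ (by positivity)]
  have hrpos : 0 < r := by positivity
  have hm : r • (v + base n) ∈ space n := by
    refine ⟨?_, ?_⟩
    · rw [Q_smul, Q_add, hv.1, base_mem_space.1, bil_base]; linarith
    · have : 0 < base n 0 := base_mem_space.2
      simp only [Pi.smul_apply, Pi.add_apply, smul_eq_mul]
      have := hv.2
      positivity
  obtain ⟨S, hS⟩ := exists_pointReflection hm
  refine ⟨S, ?_⟩
  rw [hS, bil_smul_right, bil_add_right, bil_self, hv.1, bil_base, smul_smul]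
  have : 2 * (r * (1 + v 0)) * r = 1 := by linarith
  rw [this, one_smul]; abel

/-- A point that is fixed by an isometry is fixed by its whole bicommutant. -/
theorem map_eq_self_of_commute {T T' : Isom n} (h : ∀ S : Isom n, S * T = T * S → S * T' = T' * S)
    {v : V n} (hv : v ∈ space n) (hT : T.1 v = v) : T'.1 v = v := by
  -- The symmetry in `v` commutes with `T`, hence with `T'`, and fixes only the multiples of `v`. So
  -- `T'.1 v` is a multiple of `v` on the same sheet.
  obtain ⟨S, hS⟩ := exists_pointReflection hv
  have h1 : S * T = T * S := isom_ext fun x => by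
    simp only [isom_mul_apply, hS, map_sub, map_smul, hT]
    have := bil_map T x v
    rw [hT] at this
    rw [this]
  have h2 := congrArg (fun R : Isom n => R.1 v) (h S h1)
  simp only [isom_mul_apply, hS, bil_self, hv.1] at h2
  have h3 : T'.1 v = bil (T'.1 v) v • v := by
    have e : (2 * (1 : ℝ)) • v - v = v := by module
    rw [e, sub_eq_iff_eq_add] at h2
    have : (2 : ℝ) • T'.1 v = (2 : ℝ) • (bil (T'.1 v) v • v) := by rw [smul_smul, h2]; module
    exact smul_right_injective _ two_ne_zero this
  have h4 := one_le_bil (map_mem_space T' hv) hv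
  have h5 : Q (T'.1 v) = 1 := (T'.2.1 v).trans hv.1
  rw [h3, Q_smul, hv.1, mul_one] at h5
  have h6 : bil (T'.1 v) v = 1 := by
    rw [h3]; rw [bil_smul_left, bil_self, hv.1, mul_one]; nlinarith
  rw [h3, h6, one_smul]

/-- The isometries that fix the base point. -/
theorem exists_ell (A : Euc n ≃ₗᵢ[ℝ] Euc n) :
    ∃ S : Isom n, ∀ x, S.1 x = (split n).symm (x 0, A (split n x).2) := by
  let T : V n →ₗ[ℝ] V n := (split n).symm.toLinearMap ∘ₗ
    (LinearMap.id.prodMap (A.toLinearEquiv : Euc n →ₗ[ℝ] Euc n)) ∘ₗ (split n).toLinearMap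
  have hT : ∀ x, T x = (split n).symm (x 0, A (split n x).2) := fun x => rfl
  obtain ⟨S, hS⟩ := exists_isom T (fun x => by rw [hT, Q_eq, Q_eq]; simp) fun x hx => hx.2
  exact ⟨S, hS⟩

/-- The isometry that fixes the base point and acts on its complement as `A`. -/
noncomputable def ell (A : Euc n ≃ₗᵢ[ℝ] Euc n) : Isom n := (exists_ell A).choose

theorem ell_apply (A : Euc n ≃ₗᵢ[ℝ] Euc n) (x : V n) :
    (ell A).1 x = (split n).symm (x 0, A (split n x).2) := (exists_ell A).choose_spec x

theorem split_ell (A : Euc n ≃ₗᵢ[ℝ] Euc n) (x : V n) :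
    split n ((ell A).1 x) = (x 0, A (split n x).2) := by
  rw [ell_apply, LinearEquiv.apply_symm_apply]

theorem ell_mul (A B : Euc n ≃ₗᵢ[ℝ] Euc n) : ell (A * B) = ell A * ell B :=
  isom_ext fun x => by
    rw [isom_mul_apply, ell_apply, ell_apply A, split_ell, ell_apply B]; rfl

theorem ell_one : ell (1 : Euc n ≃ₗᵢ[ℝ] Euc n) = 1 :=
  isom_ext fun x => by
    rw [ell_apply]
    exact (split n).symm_apply_apply x

theorem ell_inv (A : Euc n ≃ₗᵢ[ℝ] Euc n) : ell A⁻¹ = (ell A)⁻¹ := by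
  rw [eq_inv_iff_mul_eq_one, ← ell_mul, inv_mul_cancel, ell_one]

theorem ell_injective : Function.Injective (ell (n := n)) := fun A B h => by
  ext1 y
  have := congrArg (fun S : Isom n => (split n (S.1 ((split n).symm (0, y)))).2) h
  simpa [split_ell] using this

theorem ell_base (A : Euc n ≃ₗᵢ[ℝ] Euc n) : (ell A).1 (base n) = base n := by
  rw [ell_apply, base]; simp

theorem isElliptic_ell (A : Euc n ≃ₗᵢ[ℝ] Euc n) : IsElliptic (ell A) :=
  ⟨base n, base_mem_space, ell_base A⟩

/-- Pairing with the base point reads off the time coordinate, which `T` therefore preserves; what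
remains is a norm-preserving map of the space coordinates. -/
theorem exists_eq_ell {T : Isom n} (hT : T.1 (base n) = base n) :
    ∃ A : Euc n ≃ₗᵢ[ℝ] Euc n, T = ell A := by
  have h0 : ∀ x, T.1 x 0 = x 0 := fun x => by
    rw [← bil_base (T.1 x), ← bil_base x, ← bil_map T x (base n), hT]
  let L : Euc n →ₗ[ℝ] Euc n := LinearMap.snd ℝ ℝ (Euc n) ∘ₗ (split n).toLinearMap ∘ₗ
    (T.1 : V n →ₗ[ℝ] V n) ∘ₗ (split n).symm.toLinearMap ∘ₗ LinearMap.inr ℝ ℝ (Euc n)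
  have hL : ∀ y, L y = (split n (T.1 ((split n).symm (0, y)))).2 := fun y => rfl
  have hn : ∀ y, ‖L y‖ = ‖y‖ := fun y => by
    have := T.2.1 ((split n).symm (0, y))
    rw [Q_eq, Q_eq, h0, ← hL] at this
    simp only [LinearEquiv.apply_symm_apply] at this
    rw [← sq_eq_sq₀ (norm_nonneg _) (norm_nonneg _)]
    linarith
  let A : Euc n ≃ₗᵢ[ℝ] Euc n := LinearIsometry.toLinearIsometryEquiv ⟨L, hn⟩ rfl
  refine ⟨A, isom_ext fun x => ?_⟩
  apply (split n).injective
  rw [split_ell]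
  have hx : x = x 0 • base n + (split n).symm (0, (split n x).2) := by
    apply (split n).injective
    rw [map_add, map_smul, base]
    ext1 <;> simp
  have hA : A (split n x).2 = L (split n x).2 := rfl
  ext1
  · exact h0 x
  · rw [hA, hL]
    conv_lhs => rw [hx]
    rw [map_add, map_smul, hT, map_add, map_smul, base]
    simp

theorem IsElliptic.exists_conj_ell {T : Isom n} (h : IsElliptic T) :
    ∃ A : Euc n ≃ₗᵢ[ℝ] Euc n, ∃ S : Isom n, T = S * ell A * S⁻¹ := by
  obtain ⟨v, hv, hT⟩ := h
  obtain ⟨S, hS⟩ := exists_map_eq_base hv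
  obtain ⟨A, hA⟩ := exists_eq_ell (T := S * T * S⁻¹) (by
    rw [isom_mul_apply, isom_mul_apply, ← hS, isom_inv_apply_self, hT])
  exact ⟨A, S⁻¹, by rw [← hA]; group⟩

theorem IsElliptic.conj {T : Isom n} (h : IsElliptic T) (S : Isom n) :
    IsElliptic (S * T * S⁻¹) := by
  obtain ⟨v, hv, hT⟩ := h
  exact ⟨S.1 v, map_mem_space S hv, by
    rw [isom_mul_apply, isom_mul_apply, isom_inv_apply_self, hT]⟩

theorem isElliptic_conj_iff {T : Isom n} (S : Isom n) :
    IsElliptic (S * T * S⁻¹) ↔ IsElliptic T :=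
  ⟨fun h => by simpa [mul_assoc] using h.conj S⁻¹, fun h => h.conj S⟩

theorem cosDim_isom_conj (T S : Isom n) (t : ℝ) :
    cosDim (S * T * S⁻¹).1 t = cosDim T.1 t := cosDim_conj T.1 S.1 t

theorem mem_cosSpace_ell {A : Euc n ≃ₗᵢ[ℝ] Euc n} {t : ℝ} {x : V n} :
    x ∈ cosSpace (ell A).1 t ↔
      (t = 1 ∨ x 0 = 0) ∧ (split n x).2 ∈ cosSpace A.toLinearEquiv t := by
  rw [mem_cosSpace_iff_sq, mem_cosSpace_iff_sq, ← (split n).injective.eq_iff, map_sub, map_smul,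
    split_ell, split_ell, Prod.ext_iff, ell_apply]
  refine and_congr ?_ Iff.rfl
  simp only [split_symm_zero, Prod.fst_sub, Prod.smul_fst, split_fst, smul_eq_mul]
  constructor
  · intro h
    have : (t - 1) * x 0 = 0 := by linarith
    exact (mul_eq_zero.1 this).imp_left sub_eq_zero.1
  · rintro (rfl | h)
    · ring
    · rw [h]; ring

theorem cosDim_ell (A : Euc n ≃ₗᵢ[ℝ] Euc n) {t : ℝ} (ht : t ≠ 1) :
    cosDim (ell A).1 t = cosDim A.toLinearEquiv t := by
  symm
  refine cosDim_eq_of_injective ((split n).symm.toLinearMap ∘ₗ LinearMap.inr ℝ ℝ (Euc n)) ?_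
    (fun y hy => ?_) (fun x hx => ?_)
  · exact (split n).symm.injective.comp (LinearMap.inr_injective)
  · rw [mem_cosSpace_ell]
    exact ⟨Or.inr rfl, by simpa using hy⟩
  · rw [mem_cosSpace_ell] at hx
    refine ⟨_, hx.2, ?_⟩
    apply (split n).injective
    have h0 := hx.1.resolve_left ht
    ext1
    · simp [h0]
    · simp

end Hyp

/-! ### Types, and the `z`-classes of elliptic elements. -/

theorem iSup_cosSpace_isometry {E : Type*} [NormedAddCommGroup E] [InnerProductSpace ℝ E]
    [FiniteDimensional ℝ E] (A : E ≃ₗᵢ[ℝ] E) : ⨆ c, cosSpace A.toLinearEquiv c = ⊤ := by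
  obtain ⟨ι, κ, _, _, b, ε, c, hf⟩ := exists_cosFrame A
  exact iSup_cosSpace_eq_top b hf.mem_cosSpace

/-- The dimension of the `(-1)`-eigenspace of an isometry and the multiset of the multiplicities of
its rotation angles in `(0, π)`. -/
noncomputable def angleType {E : Type*} [NormedAddCommGroup E] [InnerProductSpace ℝ E]
    (A : E ≃ₗᵢ[ℝ] E) : ℕ × Multiset ℕ :=
  (cosDim A.toLinearEquiv (-1), halfType (cosDim A.toLinearEquiv))

theorem halfType_congr_of_ne_one {d d' : ℝ → ℕ} (h : ∀ t ≠ 1, d t = d' t) :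
    halfType d = halfType d' := halfType_congr fun c hc => h c hc.2.ne

theorem angleType_eq_of_cosDim {E : Type*} [NormedAddCommGroup E] [InnerProductSpace ℝ E]
    {A A' : E ≃ₗᵢ[ℝ] E} (h : ∀ t ≠ 1, cosDim A.toLinearEquiv t = cosDim A'.toLinearEquiv t) :
    angleType A = angleType A' := by
  rw [angleType, angleType, h (-1) (by norm_num), halfType_congr_of_ne_one h]

namespace Hyp

open scoped InnerProductSpace

variable {n : ℕ}

theorem commute_of_isCosCombination {T T' S : Isom n} (h : IsCosCombination T.1 T'.1)
    (hT : ⨆ c, cosSpace T.1 c = ⊤) (hS : S * T = T * S) : S * T' = T' * S :=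
  isom_ext fun x => h.commute hT
    (fun y => congrArg (fun R : Isom n => R.1 y) hS) x

theorem iSup_cosSpace_ell (A : Euc n ≃ₗᵢ[ℝ] Euc n) : ⨆ c, cosSpace (ell A).1 c = ⊤ := by
  rw [eq_top_iff]
  rintro x -
  have hx : x = x 0 • base n + (split n).symm (0, (split n x).2) := by
    apply (split n).injective
    rw [map_add, map_smul, base]
    ext1 <;> simp
  rw [hx]
  refine Submodule.add_mem _ (Submodule.smul_mem _ _ (Submodule.mem_iSup_of_mem 1 ?_)) ?_
  · rw [mem_cosSpace_ell]
    exact ⟨Or.inl rfl, by simp [base]⟩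
  · have hy : (split n x).2 ∈ ⨆ c, cosSpace A.toLinearEquiv c :=
      iSup_cosSpace_isometry A ▸ Submodule.mem_top
    generalize (split n x).2 = y at hy
    have : (⨆ c, cosSpace A.toLinearEquiv c) ≤ (⨆ c, cosSpace (ell A).1 c).comap
        ((split n).symm.toLinearMap ∘ₗ LinearMap.inr ℝ ℝ (Euc n)) := by
      refine iSup_le fun c y hy => Submodule.mem_iSup_of_mem c ?_
      rw [mem_cosSpace_ell]
      exact ⟨Or.inr rfl, by simpa using hy⟩
    exact this hy

theorem isCosCombination_ell {A A' : Euc n ≃ₗᵢ[ℝ] Euc n}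
    (h : IsCosCombination A.toLinearEquiv A'.toLinearEquiv)
    (h1 : cosSpace A.toLinearEquiv 1 ≤ cosSpace A'.toLinearEquiv 1) :
    IsCosCombination (ell A).1 (ell A').1 := by
  intro t
  by_cases ht : t = 1
  · subst ht
    refine ⟨1, 0, fun x hx => ?_⟩
    have h2 := mem_cosSpace_one.1 (h1 (mem_cosSpace_ell.1 hx).2)
    rw [one_smul, zero_smul, add_zero, ell_apply, h2]
    exact (split n).symm_apply_apply x
  · obtain ⟨α, β, hαβ⟩ := h t
    refine ⟨α, β, fun x hx => ?_⟩
    rw [mem_cosSpace_ell] at hx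
    have h0 := hx.1.resolve_left ht
    have h2 := hαβ _ hx.2
    simp only [LinearIsometryEquiv.coe_toLinearEquiv] at h2
    apply (split n).injective
    rw [map_add, map_smul, map_smul, split_ell, split_ell, h2, h0]
    ext1
    · simp [h0]
    · rfl

/-- A fixed vector `y` of `A` lifts to a fixed point of `ell A` in hyperbolic space by adjoining the
time coordinate `√(1 + ‖y‖ ^ 2)`, and the bicommutant fixes such points. -/
theorem cosSpace_one_le_of_centralizer_ell {A A' : Euc n ≃ₗᵢ[ℝ] Euc n}
    (h : ∀ S : Isom n, S * ell A = ell A * S → S * ell A' = ell A' * S) :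
    cosSpace A.toLinearEquiv 1 ≤ cosSpace A'.toLinearEquiv 1 := by
  intro y hy
  rw [mem_cosSpace_one] at *
  have hv : (split n).symm (√(1 + ‖y‖ ^ 2), y) ∈ space n := by
    refine ⟨?_, by rw [split_symm_zero]; positivity⟩
    rw [Q_eq, split_symm_zero, Real.sq_sqrt (by positivity), LinearEquiv.apply_symm_apply]
    ring
  have := map_eq_self_of_commute h hv (by rw [ell_apply, LinearEquiv.apply_symm_apply, hy]; rfl)
  rw [ell_apply, LinearEquiv.apply_symm_apply, (split n).symm.injective.eq_iff] at this
  exact (Prod.ext_iff.1 this).2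

theorem commutantLE_of_ell {A A' : Euc n ≃ₗᵢ[ℝ] Euc n}
    (h : ∀ S : Isom n, S * ell A = ell A * S → S * ell A' = ell A' * S) : CommutantLE A A' 0 := by
  intro B hB _ x
  have h1 : B * A = A * B := LinearIsometryEquiv.ext hB
  have h2 := h (ell B) (by rw [← ell_mul, h1, ell_mul])
  rw [← ell_mul, ← ell_mul] at h2
  exact congrArg (fun C : Euc n ≃ₗᵢ[ℝ] Euc n => C x) (ell_injective h2)

/-- Equal centralizers make the conjugate of `ell A` fix the base point as well, so the comparison
becomes Euclidean. Fixed spaces must then coincide, which prevents an exchange of `1` and `-1`. -/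
theorem zEquiv_ell_iff {A A' : Euc n ≃ₗᵢ[ℝ] Euc n} :
    ZEquiv (ell A) (ell A') ↔ angleType A = angleType A' := by
  constructor
  · intro h
    obtain ⟨g, hg⟩ := zEquiv_iff.1 h
    have hfix : (g * ell A * g⁻¹).1 (base n) = base n :=
      map_eq_self_of_commute (fun S => (mem_centralizer_iff_of_eq hg S).2) base_mem_space
        (ell_base A')
    obtain ⟨A₁, hA₁⟩ := exists_eq_ell hfix
    rw [hA₁] at hg
    have h1 := fun S => (mem_centralizer_iff_of_eq hg S).1
    have h2 := fun S => (mem_centralizer_iff_of_eq hg S).2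
    have hc := le_antisymm (cosSpace_one_le_of_centralizer_ell h1)
      (cosSpace_one_le_of_centralizer_ell h2)
    have e1 : angleType A₁ = angleType A' := by
      rw [angleType, angleType, (commutantLE_of_ell h1).cosDim_neg_one_eq (commutantLE_of_ell h2)
        (map_zero _) (map_zero _) hc, (commutantLE_of_ell h1).halfType_eq (commutantLE_of_ell h2)
        (map_zero _) (map_zero _) (Or.inr hc)]
    rw [← e1]
    refine angleType_eq_of_cosDim fun t ht => ?_
    rw [← cosDim_ell A ht, ← cosDim_ell A₁ ht, ← hA₁, cosDim_isom_conj]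
  · intro h
    rw [angleType, angleType, Prod.mk.injEq] at h
    obtain ⟨g, h1, h2, h3⟩ := exists_conj_isCosCombination h.1 h.2
    refine zEquiv_iff.2 ⟨ell g, ?_⟩
    rw [← ell_inv, ← ell_mul, ← ell_mul]
    ext S
    rw [Subgroup.mem_centralizer_singleton_iff, Subgroup.mem_centralizer_singleton_iff]
    exact ⟨commute_of_isCosCombination (isCosCombination_ell h1 h3.le) (iSup_cosSpace_ell _),
      commute_of_isCosCombination (isCosCombination_ell h2 h3.ge) (iSup_cosSpace_ell _)⟩

end Hyp

/-! ### Null coordinates and the stabilizer of a point at infinity. -/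

namespace Hyp

open scoped InnerProductSpace

variable {m : ℕ}

/-- Null coordinates: two light-like coordinates and `m` space-like ones. -/
noncomputable def nsplit (m : ℕ) : V (m + 1) ≃ₗ[ℝ] ℝ × ℝ × Euc m where
  toFun x := (x 0 + x 1, x 0 - x 1, WithLp.toLp 2 fun i => x i.succ.succ)
  invFun p := Fin.cons ((p.1 + p.2.1) / 2) (Fin.cons ((p.1 - p.2.1) / 2) p.2.2)
  map_add' x y := by
    ext
    · simp only [Pi.add_apply, Prod.fst_add]; ring
    · simp only [Pi.add_apply, Prod.fst_add, Prod.snd_add]; ring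
    · rfl
  map_smul' r x := by
    ext
    · simp only [Pi.smul_apply, Prod.smul_fst, smul_eq_mul, RingHom.id_apply]; ring
    · simp only [Pi.smul_apply, Prod.smul_fst, Prod.smul_snd, smul_eq_mul, RingHom.id_apply]; ring
    · rfl
  left_inv x := by
    ext i
    refine Fin.cases ?_ (fun i => Fin.cases ?_ (fun i => ?_) i) i
    · simp
    · simp
    · simp
  right_inv p := by
    have h1 : ∀ (a b : ℝ) (f : Fin m → ℝ), (Fin.cons a (Fin.cons b f) : Fin (m + 2) → ℝ) 1 = b :=
      fun _ _ _ => rfl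
    ext
    · simp only [Fin.cons_zero, h1]; ring
    · simp only [Fin.cons_zero, h1]; ring
    · simp

theorem nsplit_symm_zero (p : ℝ × ℝ × Euc m) : (nsplit m).symm p 0 = (p.1 + p.2.1) / 2 := rfl

theorem nsplit_fst_add (x : V (m + 1)) : (nsplit m x).1 + (nsplit m x).2.1 = 2 * x 0 := by
  simp only [nsplit, LinearEquiv.coe_mk, LinearMap.coe_mk, AddHom.coe_mk]; ring

theorem bil_eq_nsplit (x y : V (m + 1)) : bil x y =
    ((nsplit m x).1 * (nsplit m y).2.1 + (nsplit m x).2.1 * (nsplit m y).1) / 2 -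
      ⟪(nsplit m x).2.2, (nsplit m y).2.2⟫_ℝ := by
  have h : ⟪(split (m + 1) x).2, (split (m + 1) y).2⟫_ℝ =
      x 1 * y 1 + ⟪(nsplit m x).2.2, (nsplit m y).2.2⟫_ℝ := by
    simp only [PiLp.inner_apply, Fin.sum_univ_succ, RCLike.inner_apply, conj_trivial]
    rw [mul_comm (x 1)]
    rfl
  rw [bil, h]
  simp only [nsplit, LinearEquiv.coe_mk, LinearMap.coe_mk, AddHom.coe_mk]
  ring

theorem Q_eq_nsplit (x : V (m + 1)) :
    Q x = (nsplit m x).1 * (nsplit m x).2.1 - ‖(nsplit m x).2.2‖ ^ 2 := by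
  rw [← bil_self, bil_eq_nsplit, real_inner_self_eq_norm_sq]; ring

theorem mem_space_iff_nsplit {x : V (m + 1)} :
    x ∈ space (m + 1) ↔ Q x = 1 ∧ 0 < (nsplit m x).2.1 := by
  refine and_congr_right fun h => ?_
  rw [Q_eq_nsplit] at h
  have h1 := nsplit_fst_add x
  set u := (nsplit m x).1
  set v := (nsplit m x).2.1
  have h2 : 0 < u * v := by nlinarith [norm_nonneg (nsplit m x).2.2]
  constructor
  · intro h0
    by_contra! hv
    nlinarith
  · intro hv
    have := (pos_iff_pos_of_mul_pos h2).2 hv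
    linarith

/-- In null coordinates `Q` is `u * v - ‖y‖ ^ 2`. Once the images of `v` and `y` are chosen, the
image of `u` is what preservation of `Q` forces. -/
theorem exists_par {μ : ℝ} (hμ : 0 < μ) (B : Euc m ≃ₗᵢ[ℝ] Euc m) (z : Euc m) :
    ∃ S : Isom (m + 1), ∀ x, nsplit m (S.1 x) =
      (μ * ((nsplit m x).1 + 2 * ⟪B (nsplit m x).2.2, z⟫_ℝ + ‖z‖ ^ 2 * (nsplit m x).2.1),
        μ⁻¹ * (nsplit m x).2.1, B (nsplit m x).2.2 + (nsplit m x).2.1 • z) := by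
  let T₀ : ℝ × ℝ × Euc m →ₗ[ℝ] ℝ × ℝ × Euc m :=
    { toFun := fun p => (μ * (p.1 + 2 * ⟪B p.2.2, z⟫_ℝ + ‖z‖ ^ 2 * p.2.1), μ⁻¹ * p.2.1,
        B p.2.2 + p.2.1 • z)
      map_add' := fun p q => by
        ext1
        · simp only [Prod.fst_add, Prod.snd_add, map_add, inner_add_left]; ring
        · ext1
          · simp only [Prod.fst_add, Prod.snd_add]; ring
          · simp only [Prod.fst_add, Prod.snd_add, map_add, add_smul]; abel
      map_smul' := fun r p => by
        ext1
        · simp only [Prod.smul_fst, Prod.smul_snd, map_smul, inner_smul_left, smul_eq_mul,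
            conj_trivial, RingHom.id_apply]; ring
        · ext1
          · simp only [Prod.smul_fst, Prod.smul_snd, smul_eq_mul, RingHom.id_apply]; ring
          · simp only [Prod.smul_fst, Prod.smul_snd, map_smul, smul_eq_mul, RingHom.id_apply,
              smul_add, smul_smul] }
  let T : V (m + 1) →ₗ[ℝ] V (m + 1) :=
    (nsplit m).symm.toLinearMap ∘ₗ T₀ ∘ₗ (nsplit m).toLinearMap
  have hT : ∀ x, nsplit m (T x) = T₀ (nsplit m x) := fun x =>
    (nsplit m).apply_symm_apply _
  have hQ : ∀ x, Q (T x) = Q x := fun x => by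
    rw [Q_eq_nsplit, Q_eq_nsplit, hT]
    simp only [T₀, LinearMap.coe_mk, AddHom.coe_mk]
    rw [norm_add_sq_real, inner_smul_right, norm_smul, B.norm_map, mul_pow, Real.norm_eq_abs,
      sq_abs]
    field_simp
    ring
  obtain ⟨S, hS⟩ := exists_isom T hQ fun x hx => (mem_space_iff_nsplit.2
    ⟨(hQ x).trans hx.1, by
      rw [hT]; exact mul_pos (inv_pos.2 hμ) (mem_space_iff_nsplit.1 hx).2⟩).2
  exact ⟨S, fun x => by rw [hS, hT]; rfl⟩

open Classical in
/-- The isometry that fixes a point at infinity, multiplies the light-like vector there by `μ` and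
acts on the horosphere as the similarity with linear part `B` and translation part `z`. -/
noncomputable def par (μ : ℝ) (B : Euc m ≃ₗᵢ[ℝ] Euc m) (z : Euc m) : Isom (m + 1) :=
  if hμ : 0 < μ then (exists_par hμ B z).choose else 1

theorem nsplit_par {μ : ℝ} (hμ : 0 < μ) (B : Euc m ≃ₗᵢ[ℝ] Euc m) (z : Euc m) (x : V (m + 1)) :
    nsplit m ((par μ B z).1 x) =
      (μ * ((nsplit m x).1 + 2 * ⟪B (nsplit m x).2.2, z⟫_ℝ + ‖z‖ ^ 2 * (nsplit m x).2.1),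
        μ⁻¹ * (nsplit m x).2.1, B (nsplit m x).2.2 + (nsplit m x).2.1 • z) := by
  rw [par, dif_pos hμ]
  exact (exists_par hμ B z).choose_spec x

theorem par_mul {μ ν : ℝ} (hμ : 0 < μ) (hν : 0 < ν) (A B : Euc m ≃ₗᵢ[ℝ] Euc m) (w z : Euc m) :
    par μ A w * par ν B z = par (μ * ν) (A * B) (A z + ν⁻¹ • w) := by
  refine isom_ext fun x => (nsplit m).injective ?_
  rw [isom_mul_apply, nsplit_par hμ, nsplit_par hν, nsplit_par (mul_pos hμ hν)]
  have hAB : ∀ y, (A * B) y = A (B y) := fun _ => rfl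
  ext1
  · simp only [hAB, map_add, map_smul, inner_add_left, inner_add_right, inner_smul_left,
      inner_smul_right, A.inner_map_map, conj_trivial]
    rw [norm_add_sq_real, inner_smul_right, norm_smul, A.norm_map, mul_pow, Real.norm_eq_abs,
      sq_abs]
    field_simp
    ring
  · ext1
    · simp only [mul_inv]; ring
    · simp only [hAB, map_add, map_smul, smul_add, smul_smul]
      rw [mul_comm ν⁻¹]; abel

theorem par_one : par 1 (1 : Euc m ≃ₗᵢ[ℝ] Euc m) 0 = 1 := by
  refine isom_ext fun x => (nsplit m).injective ?_
  rw [nsplit_par one_pos]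
  ext1
  · simp
  · ext1
    · simp
    · simp

theorem par_injective {μ ν : ℝ} (hμ : 0 < μ) (hν : 0 < ν) {A B : Euc m ≃ₗᵢ[ℝ] Euc m} {w z : Euc m}
    (h : par μ A w = par ν B z) : μ = ν ∧ A = B ∧ w = z := by
  have key : ∀ p, _ := fun p => congrArg (fun S : Isom (m + 1) =>
    nsplit m (S.1 ((nsplit m).symm p))) h
  simp only [nsplit_par hμ, nsplit_par hν, LinearEquiv.apply_symm_apply] at key
  have h1 := (Prod.ext_iff.1 (Prod.ext_iff.1 (key (0, 1, 0))).2)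
  simp only [mul_one, map_zero, one_smul, zero_add, inv_inj] at h1
  refine ⟨h1.1, LinearIsometryEquiv.ext fun y => ?_, h1.2⟩
  simpa using (Prod.ext_iff.1 (Prod.ext_iff.1 (key (0, 0, y))).2).2

theorem par_inv {μ : ℝ} (hμ : 0 < μ) (B : Euc m ≃ₗᵢ[ℝ] Euc m) (z : Euc m) :
    (par μ B z)⁻¹ = par μ⁻¹ B⁻¹ (-(μ • B⁻¹ z)) := by
  symm
  rw [eq_inv_iff_mul_eq_one, par_mul (inv_pos.2 hμ) hμ, inv_mul_cancel₀ hμ.ne', inv_mul_cancel,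
    smul_neg, smul_smul, inv_mul_cancel₀ hμ.ne', one_smul, add_neg_cancel, par_one]

/-- The scale factors commute, so only linear and translation parts of the two products need
comparison. -/
theorem par_commute_iff {μ ν : ℝ} (hμ : 0 < μ) (hν : 0 < ν) {A B : Euc m ≃ₗᵢ[ℝ] Euc m}
    {w z : Euc m} : par μ A w * par ν B z = par ν B z * par μ A w ↔
      A * B = B * A ∧ A z + ν⁻¹ • w = B w + μ⁻¹ • z := by
  rw [par_mul hμ hν, par_mul hν hμ]
  constructor
  · intro h
    exact (par_injective (mul_pos hμ hν) (mul_pos hν hμ) h).2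
  · rintro ⟨h1, h2⟩
    rw [h1, h2, mul_comm]

/-- A light-like vector on the line fixed by all `par μ B z`. -/
noncomputable def nullVec (m : ℕ) : V (m + 1) := (nsplit m).symm (1, 0, 0)

theorem nsplit_nullVec : nsplit m (nullVec m) = (1, 0, 0) := (nsplit m).apply_symm_apply _

theorem par_nullVec {μ : ℝ} (hμ : 0 < μ) (B : Euc m ≃ₗᵢ[ℝ] Euc m) (z : Euc m) :
    (par μ B z).1 (nullVec m) = μ • nullVec m := by
  apply (nsplit m).injective
  rw [nsplit_par hμ, map_smul, nsplit_nullVec]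
  ext1
  · simp
  · ext1 <;> simp

theorem bil_nullVec (x : V (m + 1)) : bil x (nullVec m) = (nsplit m x).2.1 / 2 := by
  rw [bil_eq_nsplit, nsplit_nullVec]; simp

/-- Pairing with `nullVec m` shows that `T` scales the second null coordinate by `μ⁻¹`, and
positivity of that coordinate on hyperbolic space gives `0 < μ`. Invariance of `Q` and `bil` then
determines the first null coordinates from `B` and `z`. -/
theorem exists_eq_par {T : Isom (m + 1)} {μ : ℝ} (hT : T.1 (nullVec m) = μ • nullVec m) :
    0 < μ ∧ ∃ B z, T = par μ B z := by
  have hv : ∀ x, μ * (nsplit m (T.1 x)).2.1 = (nsplit m x).2.1 := fun x => by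
    have := bil_map T x (nullVec m)
    rw [hT, bil_smul_right, bil_nullVec, bil_nullVec] at this
    linarith
  have hμ : 0 < μ := by
    have h1 := (mem_space_iff_nsplit.1 (map_mem_space T (base_mem_space (n := m + 1)))).2
    have h2 := (mem_space_iff_nsplit.1 (base_mem_space (n := m + 1))).2
    rw [← hv] at h2
    exact (pos_iff_pos_of_mul_pos h2).2 h1
  refine ⟨hμ, ?_⟩
  have hv' : ∀ x, (nsplit m (T.1 x)).2.1 = μ⁻¹ * (nsplit m x).2.1 := fun x => by
    rw [← hv x, inv_mul_cancel_left₀ hμ.ne']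
  let L : Euc m →ₗ[ℝ] Euc m := LinearMap.snd ℝ ℝ (Euc m) ∘ₗ LinearMap.snd ℝ ℝ (ℝ × Euc m) ∘ₗ
    (nsplit m).toLinearMap ∘ₗ (T.1 : V (m + 1) →ₗ[ℝ] V (m + 1)) ∘ₗ (nsplit m).symm.toLinearMap ∘ₗ
    LinearMap.inr ℝ ℝ (ℝ × Euc m) ∘ₗ LinearMap.inr ℝ ℝ (Euc m)
  have hL : ∀ y, (nsplit m (T.1 ((nsplit m).symm (0, 0, y)))).2.2 = L y := fun y => rfl
  have hv0 : ∀ y, (nsplit m (T.1 ((nsplit m).symm (0, 0, y)))).2.1 = 0 := fun y => by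
    rw [hv', LinearEquiv.apply_symm_apply, mul_zero]
  have hn : ∀ y, ‖L y‖ = ‖y‖ := fun y => by
    have := T.2.1 ((nsplit m).symm (0, 0, y))
    rw [Q_eq_nsplit, Q_eq_nsplit, hv0, hL] at this
    simp only [LinearEquiv.apply_symm_apply] at this
    rw [← sq_eq_sq₀ (norm_nonneg _) (norm_nonneg _)]
    linarith
  let B : Euc m ≃ₗᵢ[ℝ] Euc m := LinearIsometry.toLinearIsometryEquiv ⟨L, hn⟩ rfl
  have hB : ∀ y, B y = L y := fun y => rfl
  set f : V (m + 1) := (nsplit m).symm (0, 1, 0) with hf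
  have hfs : nsplit m f = (0, 1, 0) := (nsplit m).apply_symm_apply _
  set z := (nsplit m (T.1 f)).2.2 with hz
  have hTf1 : (nsplit m (T.1 f)).2.1 = μ⁻¹ := by rw [hv', hfs, mul_one]
  have hTf0 : (nsplit m (T.1 f)).1 = μ * ‖z‖ ^ 2 := by
    have := T.2.1 f
    rw [Q_eq_nsplit, Q_eq_nsplit, hTf1, hfs, ← hz] at this
    simp only [zero_mul, norm_zero] at this
    field_simp at this
    linarith
  have hTy0 : ∀ y, (nsplit m (T.1 ((nsplit m).symm (0, 0, y)))).1 = μ * (2 * ⟪B y, z⟫_ℝ) := by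
    intro y
    have := bil_map T ((nsplit m).symm (0, 0, y)) f
    rw [bil_eq_nsplit, bil_eq_nsplit, hTf1, hv0, hfs, hL, ← hz, ← hB,
      LinearEquiv.apply_symm_apply] at this
    simp only [zero_mul, inner_zero_right] at this
    field_simp at this
    linarith
  refine ⟨B, z, isom_ext fun x => (nsplit m).injective ?_⟩
  have hx : x = (nsplit m x).1 • nullVec m + (nsplit m x).2.1 • f +
      (nsplit m).symm (0, 0, (nsplit m x).2.2) := by
    apply (nsplit m).injective
    rw [map_add, map_add, map_smul, map_smul, nsplit_nullVec, hfs, LinearEquiv.apply_symm_apply]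
    ext1
    · simp
    · ext1 <;> simp
  rw [nsplit_par hμ]
  ext1
  · conv_lhs => rw [hx]
    simp only [map_add, map_smul, hT, Prod.fst_add, Prod.smul_fst, smul_eq_mul, hTf0, hTy0,
      nsplit_nullVec]
    ring
  · ext1
    · exact hv' x
    · conv_lhs => rw [hx]
      simp only [map_add, map_smul, hT, Prod.snd_add, Prod.smul_snd, hL, ← hz, hB,
        nsplit_nullVec, smul_zero, zero_add]
      abel

end Hyp

/-! ### Boundary fixed points, normal forms and their centralizers. -/

namespace Hyp

open scoped InnerProductSpace

section Boundary

variable {n : ℕ}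

theorem mem_fixedBoundary_iff {T : Isom n} {L : Submodule ℝ (V n)} :
    L ∈ fixedBoundary T ↔ ∃ p ≠ 0, Q p = 0 ∧ (∃ τ : ℝ, T.1 p = τ • p) ∧
      L = Submodule.span ℝ {p} := by
  constructor
  · rintro ⟨⟨h1, h2⟩, h3⟩
    obtain ⟨⟨p, hp⟩, hp0, hspan⟩ := finrank_eq_one_iff'.1 h1
    have hp0' : p ≠ 0 := fun h => hp0 (Subtype.ext h)
    have hL : L = Submodule.span ℝ {p} := by
      apply le_antisymm
      · intro x hx
        obtain ⟨r, hr⟩ := hspan ⟨x, hx⟩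
        exact Submodule.mem_span_singleton.2 ⟨r, congrArg Subtype.val hr⟩
      · rw [Submodule.span_singleton_le_iff_mem]; exact hp
    refine ⟨p, hp0', h2 p hp, ?_, hL⟩
    have : T.1 p ∈ L := by
      rw [← h3]; exact Submodule.mem_map_of_mem hp
    rw [hL] at this
    obtain ⟨τ, hτ⟩ := Submodule.mem_span_singleton.1 this
    exact ⟨τ, hτ.symm⟩
  · rintro ⟨p, hp0, hQ, ⟨τ, hτ⟩, rfl⟩
    refine ⟨⟨finrank_span_singleton hp0, fun v hv => ?_⟩, ?_⟩
    · obtain ⟨r, rfl⟩ := Submodule.mem_span_singleton.1 hv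
      rw [Q_smul, hQ, mul_zero]
    · have hτ0 : τ ≠ 0 := by
        rintro rfl
        rw [zero_smul, LinearEquiv.map_eq_zero_iff] at hτ
        exact hp0 hτ
      rw [Submodule.map_span, Set.image_singleton]
      change Submodule.span ℝ {T.1 p} = _
      rw [hτ, Submodule.span_singleton_smul_eq hτ0.isUnit]

theorem fixedBoundary_conj (T S : Isom n) :
    fixedBoundary (S * T * S⁻¹) =
      (fun L => L.map (S.1 : V n →ₗ[ℝ] V n)) '' fixedBoundary T := by
  have key : ∀ (S T : Isom n), ∀ L ∈ fixedBoundary T,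
      L.map (S.1 : V n →ₗ[ℝ] V n) ∈ fixedBoundary (S * T * S⁻¹) := by
    intro S T L hL
    rw [mem_fixedBoundary_iff] at hL ⊢
    obtain ⟨p, hp0, hQ, ⟨τ, hτ⟩, rfl⟩ := hL
    refine ⟨S.1 p, (LinearEquiv.map_ne_zero_iff _).2 hp0, (S.2.1 p).trans hQ, ⟨τ, ?_⟩, ?_⟩
    · rw [isom_mul_apply, isom_mul_apply, isom_inv_apply_self, hτ, map_smul]
    · rw [Submodule.map_span, Set.image_singleton]; rfl
  apply Set.Subset.antisymm
  · intro L hL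
    refine ⟨L.map (S⁻¹.1 : V n →ₗ[ℝ] V n), by simpa [mul_assoc] using key S⁻¹ _ L hL, ?_⟩
    simp only
    rw [← Submodule.map_comp]
    have : (S.1 : V n →ₗ[ℝ] V n) ∘ₗ (S⁻¹.1 : V n →ₗ[ℝ] V n) = LinearMap.id :=
      LinearMap.ext fun x => isom_apply_inv_self S x
    rw [this, Submodule.map_id]
  · rintro _ ⟨L, hL, rfl⟩
    exact key S T L hL

theorem encard_fixedBoundary_conj (T S : Isom n) :
    (fixedBoundary (S * T * S⁻¹)).encard = (fixedBoundary T).encard := by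
  rw [fixedBoundary_conj]
  exact (Submodule.map_injective_of_injective S.1.injective).encard_image _

theorem isHyperbolic_conj_iff {T : Isom n} (S : Isom n) :
    IsHyperbolic (S * T * S⁻¹) ↔ IsHyperbolic T := by
  rw [IsHyperbolic, IsHyperbolic, isElliptic_conj_iff, encard_fixedBoundary_conj]

theorem isParabolic_conj_iff {T : Isom n} (S : Isom n) :
    IsParabolic (S * T * S⁻¹) ↔ IsParabolic T := by
  rw [IsParabolic, IsParabolic, isElliptic_conj_iff, encard_fixedBoundary_conj]

end Boundary

variable {m : ℕ}

theorem eq_smul_nullVec {p : V (m + 1)} (hQ : Q p = 0) (hv : (nsplit m p).2.1 = 0) :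
    p = (nsplit m p).1 • nullVec m := by
  apply (nsplit m).injective
  rw [map_smul, nsplit_nullVec]
  rw [Q_eq_nsplit, hv] at hQ
  have hy : (nsplit m p).2.2 = 0 := by
    rw [← norm_eq_zero]; nlinarith
  ext1
  · simp
  · ext1
    · simpa using hv
    · simpa using hy

/-- A fixed vector `w` is orthogonal to the image of `A - 1`, so a nonzero multiple of it cannot be
cancelled. This excludes fixed points of `par 1 A w` off the null line. -/
theorem eq_zero_of_map_add_smul_eq {A : Euc m ≃ₗᵢ[ℝ] Euc m} {w y : Euc m} {v : ℝ}
    (hA : A w = w) (hw : w ≠ 0) (h : A y + v • w = y) : v = 0 := by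
  have h1 := congrArg (fun x => ⟪x, w⟫_ℝ) h
  have h2 : ⟪A y, w⟫_ℝ = ⟪y, w⟫_ℝ := by
    conv_lhs => rw [← hA]
    exact A.inner_map_map _ _
  simp only [inner_add_left, inner_smul_left, h2, conj_trivial] at h1
  have h3 : v * ⟪w, w⟫_ℝ = 0 := by linarith
  exact (mul_eq_zero.1 h3).resolve_right (inner_self_ne_zero.2 hw)

theorem eq_inv_imp_eq_one {r : ℝ} (hr : 0 < r) (h : r = r⁻¹) : r = 1 := by
  have : r * r = 1 := by
    calc r * r = r * r⁻¹ := by rw [← h]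
      _ = 1 := mul_inv_cancel₀ hr.ne'
  nlinarith

theorem not_isElliptic_dilation {r : ℝ} (hr : 0 < r) (hr1 : r ≠ 1) (A : Euc m ≃ₗᵢ[ℝ] Euc m) :
    ¬ IsElliptic (par r A 0) := by
  rintro ⟨x, hx, hT⟩
  have h := congrArg (fun x => (nsplit m x).2.1) hT
  simp only [nsplit_par hr] at h
  have hv := (mem_space_iff_nsplit.1 hx).2
  have : r⁻¹ = 1 := mul_right_cancel₀ hv.ne' (by rw [h, one_mul])
  exact hr1 (inv_eq_one.1 this)

theorem not_isElliptic_translation {A : Euc m ≃ₗᵢ[ℝ] Euc m} {w : Euc m} (hA : A w = w)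
    (hw : w ≠ 0) : ¬ IsElliptic (par 1 A w) := by
  rintro ⟨x, hx, hT⟩
  have h := congrArg (fun x => (nsplit m x).2.2) hT
  simp only [nsplit_par one_pos] at h
  exact (mem_space_iff_nsplit.1 hx).2.ne' (eq_zero_of_map_add_smul_eq hA hw h)

theorem isElliptic_par_one_zero (A : Euc m ≃ₗᵢ[ℝ] Euc m) : IsElliptic (par 1 A 0) := by
  refine ⟨(nsplit m).symm (1, 1, 0), mem_space_iff_nsplit.2 ⟨?_, ?_⟩, ?_⟩
  · rw [Q_eq_nsplit, LinearEquiv.apply_symm_apply]; simp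
  · rw [LinearEquiv.apply_symm_apply]; exact one_pos
  · apply (nsplit m).injective
    rw [nsplit_par one_pos, LinearEquiv.apply_symm_apply]
    simp

/-- The two null coordinate axes have distinct eigenvalues `r` and `r⁻¹`, so a null eigenvector
cannot have both null coordinates nonzero. -/
theorem encard_fixedBoundary_dilation {r : ℝ} (hr : 0 < r) (hr1 : r ≠ 1)
    (A : Euc m ≃ₗᵢ[ℝ] Euc m) : (fixedBoundary (par r A 0)).encard = 2 := by
  set f : V (m + 1) := (nsplit m).symm (0, 1, 0) with hf
  have hfs : nsplit m f = (0, 1, 0) := (nsplit m).apply_symm_apply _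
  have hes := nsplit_nullVec (m := m)
  have hset : fixedBoundary (par r A 0) =
      {Submodule.span ℝ {nullVec m}, Submodule.span ℝ {f}} := by
    ext L
    rw [mem_fixedBoundary_iff, Set.mem_insert_iff, Set.mem_singleton_iff]
    constructor
    · rintro ⟨p, hp0, hQ, ⟨τ, hτ⟩, rfl⟩
      have h := congrArg (nsplit m) hτ
      rw [nsplit_par hr, map_smul] at h
      have hu : r * (nsplit m p).1 = τ * (nsplit m p).1 := by
        simpa using congrArg Prod.fst h
      have hv : r⁻¹ * (nsplit m p).2.1 = τ * (nsplit m p).2.1 := by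
        simpa using congrArg (fun x => x.2.1) h
      by_cases hv0 : (nsplit m p).2.1 = 0
      · left
        have hp := eq_smul_nullVec hQ hv0
        have hu0 : (nsplit m p).1 ≠ 0 := fun h0 => hp0 (by rw [hp, h0, zero_smul])
        rw [hp, Submodule.span_singleton_smul_eq hu0.isUnit]
      · right
        have hτ' : r⁻¹ = τ := mul_right_cancel₀ hv0 hv
        have hu0 : (nsplit m p).1 = 0 := by
          by_contra hu0
          have := mul_right_cancel₀ hu0 hu
          exact hr1 (eq_inv_imp_eq_one hr (this.trans hτ'.symm))
        have hy0 : (nsplit m p).2.2 = 0 := by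
          rw [Q_eq_nsplit, hu0] at hQ
          rw [← norm_eq_zero]; nlinarith
        have hp : p = (nsplit m p).2.1 • f := by
          apply (nsplit m).injective
          rw [map_smul, hfs]
          ext1
          · simpa using hu0
          · ext1
            · simp
            · simpa using hy0
        rw [hp, Submodule.span_singleton_smul_eq (Ne.isUnit hv0)]
    · rintro (rfl | rfl)
      · refine ⟨nullVec m, ?_, ?_, ⟨r, par_nullVec hr A 0⟩, rfl⟩
        · intro h; simpa [h] using congrArg Prod.fst hes
        · rw [Q_eq_nsplit, hes]; simp
      · refine ⟨f, ?_, ?_, ⟨r⁻¹, ?_⟩, rfl⟩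
        · intro h; simpa [h] using congrArg (fun x => x.2.1) hfs
        · rw [Q_eq_nsplit, hfs]; simp
        · apply (nsplit m).injective
          rw [nsplit_par hr, map_smul, hfs]; simp
  rw [hset, Set.encard_pair]
  intro h
  have : nullVec m ∈ Submodule.span ℝ {f} := h ▸ Submodule.mem_span_singleton_self _
  obtain ⟨s, hs⟩ := Submodule.mem_span_singleton.1 this
  have := congrArg (fun x => (nsplit m x).1) hs
  simp [hfs, hes] at this

theorem encard_fixedBoundary_translation {A : Euc m ≃ₗᵢ[ℝ] Euc m} {w : Euc m} (hA : A w = w)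
    (hw : w ≠ 0) : (fixedBoundary (par 1 A w)).encard = 1 := by
  have hes := nsplit_nullVec (m := m)
  rw [Set.encard_eq_one]
  refine ⟨Submodule.span ℝ {nullVec m}, ?_⟩
  ext L
  rw [mem_fixedBoundary_iff, Set.mem_singleton_iff]
  constructor
  · rintro ⟨p, hp0, hQ, ⟨τ, hτ⟩, rfl⟩
    have h := congrArg (nsplit m) hτ
    rw [nsplit_par one_pos, map_smul] at h
    have hv : (nsplit m p).2.1 = τ * (nsplit m p).2.1 := by
      simpa using congrArg (fun x => x.2.1) h
    have hv0 : (nsplit m p).2.1 = 0 := by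
      by_contra hv0
      have hτ1 : τ = 1 := mul_right_cancel₀ hv0 (by rw [← hv, one_mul])
      rw [hτ1, one_smul] at h
      exact hv0 (eq_zero_of_map_add_smul_eq hA hw (congrArg (fun x => x.2.2) h))
    have hp := eq_smul_nullVec hQ hv0
    have hu0 : (nsplit m p).1 ≠ 0 := fun h0 => hp0 (by rw [hp, h0, zero_smul])
    rw [hp, Submodule.span_singleton_smul_eq hu0.isUnit]
  · rintro rfl
    refine ⟨nullVec m, ?_, ?_, ⟨1, par_nullVec one_pos A w⟩, rfl⟩
    · intro h; simpa [h] using congrArg Prod.fst hes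
    · rw [Q_eq_nsplit, hes]; simp

theorem isHyperbolic_dilation {r : ℝ} (hr : 0 < r) (hr1 : r ≠ 1) (A : Euc m ≃ₗᵢ[ℝ] Euc m) :
    IsHyperbolic (par r A 0) :=
  ⟨not_isElliptic_dilation hr hr1 A, encard_fixedBoundary_dilation hr hr1 A⟩

theorem isParabolic_translation {A : Euc m ≃ₗᵢ[ℝ] Euc m} {w : Euc m} (hA : A w = w)
    (hw : w ≠ 0) : IsParabolic (par 1 A w) :=
  ⟨not_isElliptic_translation hA hw, encard_fixedBoundary_translation hA hw⟩

theorem exists_map_eq_smul_nullVec {p : V (m + 1)} (hp0 : p ≠ 0) (hQ : Q p = 0) :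
    ∃ S : Isom (m + 1), ∃ r : ℝ, r ≠ 0 ∧ S.1 p = r • nullVec m := by
  set y := (split (m + 1) p).2 with hy
  have hny : p 0 ^ 2 = ‖y‖ ^ 2 := by rw [Q_eq] at hQ; linarith
  -- The signed length `p 0` is used rather than the norm, so that the rotated vector has equal time
  -- and first space coordinates, whatever the sign.
  set δ : Euc (m + 1) := EuclideanSpace.single 0 (p 0) with hδ
  have hn : ‖y‖ = ‖δ‖ := by
    rw [hδ, PiLp.norm_single, Real.norm_eq_abs, ← Real.sqrt_sq_eq_abs, hny,
      Real.sqrt_sq (norm_nonneg _)]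
  have h1 : (ℝ ∙ (y - δ))ᗮ.reflection y = δ := Submodule.reflection_sub hn
  refine ⟨ell (ℝ ∙ (y - δ))ᗮ.reflection, 2 * p 0, ?_, ?_⟩
  · intro h0
    have hp : p 0 = 0 := by linarith
    apply hp0
    apply (split (m + 1)).injective
    rw [map_zero]
    ext1
    · exact hp
    · rw [hp] at hny
      have : ‖y‖ = 0 := by nlinarith
      exact norm_eq_zero.1 this
  · rw [ell_apply, ← hy, h1]
    ext i
    refine Fin.cases ?_ (fun i => Fin.cases ?_ (fun i => ?_) i) i
    · rw [split_symm_zero, Pi.smul_apply, nullVec, nsplit_symm_zero]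
      simp only [smul_eq_mul]; ring
    · change δ 0 = 2 * p 0 * ((1 - 0) / 2)
      rw [hδ, PiLp.single_apply, if_pos rfl]; ring
    · change δ i.succ = 2 * p 0 * 0
      rw [hδ]; simp

theorem exists_conj_par {T : Isom (m + 1)} (h : (fixedBoundary T).Nonempty) :
    ∃ S : Isom (m + 1), ∃ μ > 0, ∃ B z, S * T * S⁻¹ = par μ B z := by
  obtain ⟨L, hL⟩ := h
  obtain ⟨p, hp0, hQ, ⟨τ, hτ⟩, -⟩ := mem_fixedBoundary_iff.1 hL
  obtain ⟨S, r, hr, hS⟩ := exists_map_eq_smul_nullVec hp0 hQ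
  have : (S * T * S⁻¹).1 (nullVec m) = τ • nullVec m := by
    have h1 : nullVec m = r⁻¹ • S.1 p := by rw [hS, smul_smul, inv_mul_cancel₀ hr, one_smul]
    rw [isom_mul_apply, isom_mul_apply, h1, map_smul, isom_inv_apply_self, map_smul, hτ, map_smul,
      map_smul, smul_comm]
  obtain ⟨hμ, B, z, h⟩ := exists_eq_par this
  exact ⟨S, τ, hμ, B, z, h⟩

theorem exists_sub_smul_eq (B : Euc m ≃ₗᵢ[ℝ] Euc m) {r : ℝ} (hr : 0 < r) (hr1 : r ≠ 1)
    (z : Euc m) : ∃ s, B s - r • s = z := by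
  let f : Euc m →ₗ[ℝ] Euc m := (B.toLinearEquiv : Euc m →ₗ[ℝ] Euc m) - r • LinearMap.id
  have hf : Function.Injective f := by
    rw [← LinearMap.ker_eq_bot, LinearMap.ker_eq_bot']
    intro x hx
    have h1 : B x = r • x := sub_eq_zero.1 hx
    have h2 := congrArg norm h1
    rw [B.norm_map, norm_smul, Real.norm_of_nonneg hr.le] at h2
    by_contra hx0
    exact hr1 (mul_right_cancel₀ (norm_ne_zero_iff.2 hx0) (by rw [← h2, one_mul]))
  exact LinearMap.injective_iff_surjective.1 hf z

/-- Project `z` orthogonally to the range of `B - 1`; the remainder is fixed by `B`, because the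
complement of that range is the fixed space. -/
theorem exists_sub_sub_fixed (B : Euc m ≃ₗᵢ[ℝ] Euc m) (z : Euc m) :
    ∃ s, B (z - (B s - s)) = z - (B s - s) := by
  let f : Euc m →ₗ[ℝ] Euc m := (B.toLinearEquiv : Euc m →ₗ[ℝ] Euc m) - LinearMap.id
  obtain ⟨⟨_, ⟨s, rfl⟩⟩, a, ha, hz⟩ : ∃ b : f.range, ∃ a ∈ f.rangeᗮ, z = b + a := by
    obtain ⟨b, hb, a, ha, h⟩ := f.range.exists_add_mem_mem_orthogonal z
    exact ⟨⟨b, hb⟩, a, ha, h⟩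
  refine ⟨s, ?_⟩
  have h1 : z - (B s - s) = a := by
    rw [hz]; change B s - s + a - (B s - s) = a; abel
  rw [h1]
  have h2 : B.symm a = a := by
    rw [← sub_eq_zero]
    refine ext_inner_right ℝ fun y => ?_
    have := (Submodule.mem_orthogonal' _ _).1 ha (f y) ⟨y, rfl⟩
    change ⟪a, B y - y⟫_ℝ = 0 at this
    rw [inner_sub_left, inner_isometry_left B.symm, LinearIsometryEquiv.symm_symm, inner_zero_left,
      ← inner_sub_right, this]
  rw [← B.symm_apply_eq.1 h2]

/-- The normal forms of the isometries that fix a point of the ideal boundary. -/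
theorem exists_normalForm {T : Isom (m + 1)} (hT : ¬ IsElliptic T)
    (h : (fixedBoundary T).Nonempty) :
    (∃ S : Isom (m + 1), ∃ r > 0, r ≠ 1 ∧ ∃ A, S * T * S⁻¹ = par r A 0) ∨
      ∃ S : Isom (m + 1), ∃ A w, A w = w ∧ w ≠ 0 ∧ S * T * S⁻¹ = par 1 A w := by
  obtain ⟨S, μ, hμ, B, z, hS⟩ := exists_conj_par h
  -- Conjugation by a horospherical translation changes `z` by `B s - μ⁻¹ • s`. This kills `z` when
  -- `μ ≠ 1` and leaves only a fixed vector of `B` when `μ = 1`; that vector is nonzero because `T`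
  -- is not elliptic.
  have hconj : ∀ s, par 1 1 s * S * T * (par 1 1 s * S)⁻¹ =
      par μ B (z - (B s - μ⁻¹ • s)) := fun s => by
    have : par 1 1 s * S * T * (par 1 1 s * S)⁻¹ =
        par 1 1 s * (S * T * S⁻¹) * (par 1 1 s)⁻¹ := by group
    rw [this, hS, par_inv one_pos, par_mul one_pos hμ,
      par_mul (mul_pos one_pos hμ) (inv_pos.2 one_pos)]
    simp only [inv_one, one_mul, mul_one, one_smul]
    congr 1
    rw [map_neg]
    change -B s + (z + _) = _
    abel
  by_cases hμ1 : μ = 1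
  · right
    subst hμ1
    obtain ⟨s, hs⟩ := exists_sub_sub_fixed B z
    have hc := hconj s
    rw [inv_one, one_smul] at hc
    refine ⟨_, B, _, hs, fun h0 => hT ?_, hc⟩
    rw [h0] at hc
    exact (isElliptic_conj_iff _).1 (hc ▸ isElliptic_par_one_zero B)
  · left
    obtain ⟨s, hs⟩ := exists_sub_smul_eq B (inv_pos.2 hμ) (fun h => hμ1 (inv_eq_one.1 h)) z
    exact ⟨_, μ, hμ, hμ1, B, by rw [hconj s, hs, sub_self]⟩

theorem exists_eq_par_of_map_nullVec {S : Isom (m + 1)}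
    (h : (nsplit m (S.1 (nullVec m))).2.1 = 0) : ∃ μ > 0, ∃ B z, S = par μ B z := by
  obtain ⟨hμ, B, z, h⟩ := exists_eq_par (eq_smul_nullVec ((S.2.1 _).trans (by
    rw [Q_eq_nsplit, nsplit_nullVec]; simp)) h)
  exact ⟨_, hμ, B, z, h⟩

/-- `S` preserves the `r`-eigenvectors, hence the null line, so it has the form `par μ B z`; then `A
z = r⁻¹ • z`, and norms give `z = 0`. The resulting centralizer does not depend on `r`. -/
theorem commute_dilation_iff {r : ℝ} (hr : 0 < r) (hr1 : r ≠ 1) {A : Euc m ≃ₗᵢ[ℝ] Euc m}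
    {S : Isom (m + 1)} : S * par r A 0 = par r A 0 * S ↔
      ∃ μ > 0, ∃ B, B * A = A * B ∧ S = par μ B 0 := by
  constructor
  · intro h
    have h1 := congrArg (fun R : Isom (m + 1) => (nsplit m (R.1 (nullVec m))).2.1) h
    simp only [isom_mul_apply, par_nullVec hr, map_smul, nsplit_par hr, Prod.smul_snd,
      Prod.smul_fst, smul_eq_mul] at h1
    obtain ⟨μ, hμ, B, z, rfl⟩ := exists_eq_par_of_map_nullVec (S := S) (by
      by_contra h0
      exact hr1 (eq_inv_imp_eq_one hr (mul_right_cancel₀ h0 h1)))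
    obtain ⟨h2, h3⟩ := (par_commute_iff hμ hr).1 h
    rw [map_zero, zero_add] at h3
    have hz : z = 0 := by
      have h4 := congrArg norm h3
      rw [smul_zero, add_zero, A.norm_map, norm_smul, norm_inv, Real.norm_of_nonneg hr.le] at h4
      by_contra hz
      have : r⁻¹ = 1 := mul_right_cancel₀ (norm_ne_zero_iff.2 hz) (by rw [h4, one_mul])
      exact hr1 (inv_eq_one.1 this)
    exact ⟨μ, hμ, B, h2, by rw [hz]⟩
  · rintro ⟨μ, hμ, B, hB, rfl⟩
    exact (par_commute_iff hμ hr).2 ⟨hB, by simp⟩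

theorem commute_translation_iff {A : Euc m ≃ₗᵢ[ℝ] Euc m} {w : Euc m} (hA : A w = w)
    (hw : w ≠ 0) {S : Isom (m + 1)} : S * par 1 A w = par 1 A w * S ↔
      ∃ B z, B * A = A * B ∧ B w = w ∧ A z = z ∧ S = par 1 B z := by
  constructor
  · intro h
    have h1 := congrArg (fun R : Isom (m + 1) => (nsplit m (R.1 (nullVec m))).2.2) h
    simp only [isom_mul_apply, par_nullVec one_pos, nsplit_par one_pos, one_smul] at h1
    obtain ⟨μ, hμ, B, z, rfl⟩ := exists_eq_par_of_map_nullVec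
      (eq_zero_of_map_add_smul_eq hA hw h1.symm)
    obtain ⟨h2, h3⟩ := (par_commute_iff hμ one_pos).1 h
    rw [inv_one, one_smul] at h3
    have hABw : A (B w) = B w := by
      have := congrArg (fun C : Euc m ≃ₗᵢ[ℝ] Euc m => C w) h2
      change B (A w) = A (B w) at this
      rw [← this, hA]
    -- The commutation relation also writes `d` as `A z - z`. So `d` is fixed by `A` and lies in the
    -- range of `A - 1`; these spaces are orthogonal, hence `d = 0`.
    set d := B w - μ⁻¹ • w with hd
    have hd1 : A d = d := by rw [hd, map_sub, map_smul, hABw, hA]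
    have hd2 : d = A z - z := by
      rw [hd, sub_eq_sub_iff_add_eq_add, h3]
    have hd0 : d = 0 := by
      have h4 : ⟪A z, d⟫_ℝ = ⟪z, d⟫_ℝ := by
        conv_lhs => rw [← hd1]
        exact A.inner_map_map _ _
      have h5 : ⟪d, d⟫_ℝ = 0 := by
        conv_lhs => enter [2]; rw [hd2]
        rw [inner_sub_left, h4, sub_self]
      exact inner_self_eq_zero.1 h5
    have hz : A z = z := sub_eq_zero.1 (hd2.symm.trans hd0)
    have hBw : B w = μ⁻¹ • w := sub_eq_zero.1 hd0
    have hμ1 : μ⁻¹ = 1 := by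
      have h4 := congrArg norm hBw
      rw [B.norm_map, norm_smul, norm_inv, Real.norm_of_nonneg hμ.le] at h4
      exact mul_right_cancel₀ (norm_ne_zero_iff.2 hw) (by rw [← h4, one_mul])
    rw [hμ1, one_smul] at hBw
    exact ⟨B, z, h2, hBw, hz, by rw [inv_eq_one.1 hμ1]⟩
  · rintro ⟨B, z, hB, hBw, hAz, rfl⟩
    refine (par_commute_iff one_pos one_pos).2 ⟨hB, ?_⟩
    rw [hBw, hAz, inv_one, one_smul, one_smul, add_comm]

end Hyp

/-! ### Orbits: every non-elliptic isometry fixes a point at infinity. -/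

namespace Hyp

open Filter Topology

variable {n : ℕ}

theorem continuous_Q : Continuous (Q (n := n)) := by
  unfold Q; fun_prop

theorem continuous_isom (T : Isom n) : Continuous T.1 :=
  LinearMap.continuous_of_finiteDimensional (T.1 : V n →ₗ[ℝ] V n)

theorem norm_le_of_mem_space {x : V n} (hx : x ∈ space n) : ‖x‖ ≤ x 0 := by
  rw [pi_norm_le_iff_of_nonneg hx.2.le]
  refine Fin.cases ?_ fun i => ?_
  · rw [Real.norm_of_nonneg hx.2.le]
  · have h1 : x i.succ ^ 2 ≤ ∑ j : Fin n, x j.succ ^ 2 :=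
      Finset.single_le_sum (f := fun j : Fin n => x j.succ ^ 2) (fun j _ => sq_nonneg _)
        (Finset.mem_univ i)
    have h2 : x 0 ^ 2 - ∑ j : Fin n, x j.succ ^ 2 = 1 := hx.1
    exact abs_le_of_sq_le_sq (by linarith) hx.2.le

theorem bil_sum_left {I : Type*} (s : Finset I) (f : I → V n) (y : V n) :
    bil (∑ i ∈ s, f i) y = ∑ i ∈ s, bil (f i) y := by
  classical
  induction s using Finset.induction_on with
  | empty => simp [bil]
  | insert a s ha ih => rw [Finset.sum_insert ha, Finset.sum_insert ha, bil_add_left, ih]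

/-- All pairings of the points are at least `1`, and `Q` of the average is the mean of these
pairings. So averages stay away from the light cone. -/
theorem one_le_Q_average {N : ℕ} {f : ℕ → V n} (hf : ∀ k, f k ∈ space n) :
    1 ≤ Q (((N : ℝ) + 1)⁻¹ • ∑ k ∈ Finset.range (N + 1), f k) := by
  have h1 : ∀ i, (N : ℝ) + 1 ≤ bil (∑ k ∈ Finset.range (N + 1), f k) (f i) := fun i => by
    rw [bil_sum_left]
    calc (N : ℝ) + 1 = ∑ k ∈ Finset.range (N + 1), (1 : ℝ) := by simp
      _ ≤ _ := Finset.sum_le_sum fun k _ => one_le_bil (hf k) (hf i)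
  have h2 : ((N : ℝ) + 1) * (N + 1) ≤ Q (∑ k ∈ Finset.range (N + 1), f k) := by
    rw [← bil_self, bil_sum_left]
    calc ((N : ℝ) + 1) * (N + 1) = ∑ k ∈ Finset.range (N + 1), ((N : ℝ) + 1) := by
          rw [Finset.sum_const, Finset.card_range, nsmul_eq_mul]; push_cast; ring
      _ ≤ _ := Finset.sum_le_sum fun k _ => by rw [bil_comm]; exact h1 k
  rw [Q_smul, inv_pow, ← div_eq_inv_mul, le_div_iff₀ (by positivity)]
  linarith

/-- An isometry with a bounded orbit is elliptic. -/
theorem isElliptic_of_bounded {T : Isom n} {x : V n} (hx : x ∈ space n) {C : ℝ}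
    (hC : ∀ k : ℕ, (T ^ k).1 x 0 ≤ C) : IsElliptic T := by
  have hmem : ∀ k, (T ^ k).1 x ∈ space n := fun k => map_mem_space _ hx
  have hnorm : ∀ k, ‖(T ^ k).1 x‖ ≤ C := fun k => (norm_le_of_mem_space (hmem k)).trans (hC k)
  have hsucc : ∀ k, T.1 ((T ^ k).1 x) = (T ^ (k + 1)).1 x := fun k => by
    rw [pow_succ', isom_mul_apply]
  set y : ℕ → V n := fun N => ((N : ℝ) + 1)⁻¹ • ∑ k ∈ Finset.range (N + 1), (T ^ k).1 x with hy
  have hyball : ∀ N, y N ∈ Metric.closedBall (0 : V n) C := fun N => by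
    rw [mem_closedBall_zero_iff, hy]
    simp only
    rw [norm_smul, norm_inv, Real.norm_of_nonneg (by positivity), ← div_eq_inv_mul,
      div_le_iff₀ (by positivity)]
    refine (norm_sum_le _ _).trans ((Finset.sum_le_sum fun k _ => hnorm k).trans ?_)
    simp [mul_comm]
  obtain ⟨p, -, φ, hφ, hlim⟩ := (isCompact_closedBall (0 : V n) C).tendsto_subseq hyball
  have hQ : 1 ≤ Q p := ge_of_tendsto' ((continuous_Q.tendsto p).comp hlim) fun N =>
    one_le_Q_average hmem
  have hp0 : 0 ≤ p 0 := by
    refine ge_of_tendsto' (((continuous_apply (0 : Fin (n + 1))).tendsto p).comp hlim) fun N => ?_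
    simp only [Function.comp, hy, Pi.smul_apply, Finset.sum_apply, smul_eq_mul]
    exact mul_nonneg (by positivity) (Finset.sum_nonneg fun k _ => (hmem k).2.le)
  have hTy : ∀ N, T.1 (y N) - y N = ((N : ℝ) + 1)⁻¹ • ((T ^ (N + 1)).1 x - x) := fun N => by
    simp only [hy]
    rw [map_smul, ← smul_sub, map_sum, ← Finset.sum_sub_distrib]
    congr 1
    simp only [hsucc]
    rw [Finset.sum_range_sub (fun k => (T ^ k).1 x)]
    rfl
  have hfix : T.1 p - p = 0 := by
    have h1 : Tendsto (fun j => T.1 (y (φ j)) - y (φ j)) atTop (𝓝 (T.1 p - p)) :=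
      (((continuous_isom T).sub continuous_id).tendsto p).comp hlim
    have h2 : Tendsto (fun N => T.1 (y N) - y N) atTop (𝓝 0) := by
      rw [tendsto_zero_iff_norm_tendsto_zero]
      have h3 : Tendsto (fun N : ℕ => ((N : ℝ) + 1)⁻¹ * (C + ‖x‖)) atTop (𝓝 0) := by
        have := (tendsto_one_div_add_atTop_nhds_zero_nat (𝕜 := ℝ)).mul_const (C + ‖x‖)
        simpa only [one_div, zero_mul] using this
      refine squeeze_zero (fun N => norm_nonneg _) (fun N => ?_) h3
      rw [hTy, norm_smul, norm_inv, Real.norm_of_nonneg (by positivity : (0 : ℝ) ≤ N + 1)]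
      gcongr
      exact (norm_sub_le _ _).trans (by gcongr; exact hnorm _)
    exact tendsto_nhds_unique h1 (h2.comp hφ.tendsto_atTop)
  have hQ0 : 0 < Q p := by linarith
  have hs : 0 < √(Q p) := Real.sqrt_pos.2 hQ0
  have hp0' : 0 < p 0 := by
    refine lt_of_le_of_ne hp0 fun h => ?_
    rw [Q_eq, ← h] at hQ0
    nlinarith [norm_nonneg (split n p).2]
  refine ⟨(√(Q p))⁻¹ • p, ⟨?_, ?_⟩, ?_⟩
  · rw [Q_smul, inv_pow, Real.sq_sqrt hQ0.le, inv_mul_cancel₀ hQ0.ne']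
  · exact mul_pos (inv_pos.2 hs) hp0'
  · rw [map_smul, sub_eq_zero.1 hfix]

/-- Orbit points divided by their diverging time coordinates accumulate at a null vector `p`. Since
`T` commutes with its powers, `T p` is null and orthogonal to `p`, hence proportional to it. -/
theorem fixedBoundary_nonempty_of_unbounded {T : Isom n} {x : V n} (hx : x ∈ space n)
    (h : ∀ C : ℝ, ∃ k : ℕ, C < (T ^ k).1 x 0) : (fixedBoundary T).Nonempty := by
  choose k hk using fun j : ℕ => h j
  have hmem : ∀ j, (T ^ k j).1 x ∈ space n := fun j => map_mem_space _ hx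
  set t : ℕ → ℝ := fun j => (T ^ k j).1 x 0 with ht
  have htpos : ∀ j, 0 < t j := fun j => (hmem j).2
  have htop : Tendsto t atTop atTop :=
    tendsto_atTop_mono (fun j => (hk j).le) tendsto_natCast_atTop_atTop
  have hinv : Tendsto (fun j => (t j)⁻¹ ^ 2) atTop (𝓝 0) := by
    have := (tendsto_inv_atTop_zero.comp htop).pow 2
    simpa using this
  set y : ℕ → V n := fun j => (t j)⁻¹ • (T ^ k j).1 x with hy
  have hyball : ∀ j, y j ∈ Metric.closedBall (0 : V n) 1 := fun j => by
    rw [mem_closedBall_zero_iff, hy]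
    simp only
    rw [norm_smul, norm_inv, Real.norm_of_nonneg (htpos j).le, ← div_eq_inv_mul,
      div_le_one (htpos j)]
    exact norm_le_of_mem_space (hmem j)
  obtain ⟨p, -, φ, hφ, hlim⟩ := (isCompact_closedBall (0 : V n) 1).tendsto_subseq hyball
  have hinvφ := hinv.comp hφ.tendsto_atTop
  have hp0 : p 0 = 1 := by
    have h1 := ((continuous_apply (0 : Fin (n + 1))).tendsto p).comp hlim
    have h2 : ∀ j, y j 0 = 1 := fun j => inv_mul_cancel₀ (htpos j).ne'
    simp only [Function.comp_def, h2] at h1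
    exact tendsto_nhds_unique h1 tendsto_const_nhds
  have hQp : Q p = 0 := by
    have h1 := (continuous_Q.tendsto p).comp hlim
    have h2 : ∀ j, Q (y j) = (t j)⁻¹ ^ 2 := fun j => by
      simp only [hy]
      rw [Q_smul, (hmem j).1, mul_one]
    simp only [Function.comp_def, h2] at h1
    exact tendsto_nhds_unique h1 hinvφ
  have hQT : Q (p + T.1 p) = 0 := by
    have hc : Continuous fun z : V n => Q (z + T.1 z) :=
      continuous_Q.comp (continuous_id.add (continuous_isom T))
    have h1 := (hc.tendsto p).comp hlim
    have h2 : ∀ j, Q (y j + T.1 (y j)) = (t j)⁻¹ ^ 2 * Q (x + T.1 x) := fun j => by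
      simp only [hy]
      rw [map_smul, ← smul_add, Q_smul]
      congr 1
      have : T.1 ((T ^ k j).1 x) = (T ^ k j).1 (T.1 x) := by
        rw [← isom_mul_apply, ← isom_mul_apply, ← pow_succ', pow_succ]
      rw [this, ← map_add, (T ^ k j).2.1]
    simp only [Function.comp_def, h2] at h1
    have h3 := hinvφ.mul_const (Q (x + T.1 x))
    rw [zero_mul] at h3
    exact tendsto_nhds_unique h1 h3
  have hbil : bil (T.1 p) p = 0 := by
    rw [Q_add, T.2.1, hQp, bil_comm] at hQT
    linarith
  refine ⟨_, mem_fixedBoundary_iff.2 ⟨p, ?_, hQp, ⟨T.1 p 0, ?_⟩, rfl⟩⟩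
  · rintro rfl; simp at hp0
  · rw [← sub_eq_zero]
    -- `d` is null with zero time coordinate, hence zero.
    set d := T.1 p - T.1 p 0 • p with hd
    have hd0 : d 0 = 0 := by
      simp only [hd, Pi.sub_apply, Pi.smul_apply, hp0, smul_eq_mul, mul_one, sub_self]
    have hdQ : Q d = 0 := by
      rw [hd, Q_sub, Q_smul, bil_smul_right, T.2.1, hQp, hbil]; ring
    rw [Q_eq, hd0] at hdQ
    have : ‖(split n d).2‖ = 0 := by nlinarith
    apply (split n).injective
    rw [map_zero]
    ext1
    · exact hd0
    · exact norm_eq_zero.1 this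

theorem isElliptic_or_fixedBoundary_nonempty (T : Isom n) :
    IsElliptic T ∨ (fixedBoundary T).Nonempty := by
  by_cases h : ∃ C : ℝ, ∀ k : ℕ, (T ^ k).1 (base n) 0 ≤ C
  · obtain ⟨C, hC⟩ := h
    exact Or.inl (isElliptic_of_bounded base_mem_space hC)
  · push Not at h
    exact Or.inr (fixedBoundary_nonempty_of_unbounded base_mem_space h)

end Hyp

/-! ### The `z`-classes of hyperbolic and parabolic elements. -/

theorem mul_comm_of_isCosCombination {E : Type*} [NormedAddCommGroup E] [InnerProductSpace ℝ E]
    [FiniteDimensional ℝ E] {A A' B : E ≃ₗᵢ[ℝ] E}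
    (h : IsCosCombination A.toLinearEquiv A'.toLinearEquiv) (hB : B * A = A * B) :
    B * A' = A' * B :=
  LinearIsometryEquiv.ext fun x => h.commute (S := B.toLinearEquiv) (iSup_cosSpace_isometry A)
    (fun y => congrArg (fun C : E ≃ₗᵢ[ℝ] E => C y) hB) x

/-- The analogue of `angleType` up to exchanging the eigenvalues `1` and `-1`. -/
noncomputable def unsignedAngleType {E : Type*} [NormedAddCommGroup E] [InnerProductSpace ℝ E]
    (A : E ≃ₗᵢ[ℝ] E) : ℕ × Multiset ℕ :=
  (min (cosDim A.toLinearEquiv 1) (cosDim A.toLinearEquiv (-1)), halfType (cosDim A.toLinearEquiv))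

theorem unsignedAngleType_eq_of_cosDim {E : Type*} [NormedAddCommGroup E] [InnerProductSpace ℝ E]
    {A A' : E ≃ₗᵢ[ℝ] E} (h : ∀ t ≤ 1, cosDim A.toLinearEquiv t = cosDim A'.toLinearEquiv t) :
    unsignedAngleType A = unsignedAngleType A' := by
  rw [unsignedAngleType, unsignedAngleType, h 1 le_rfl, h (-1) (by norm_num),
    halfType_congr fun c hc => h c hc.2.le]

theorem CommutantLE.unsignedAngleType_eq {E : Type*} [NormedAddCommGroup E]
    [InnerProductSpace ℝ E] [FiniteDimensional ℝ E] {A A' : E ≃ₗᵢ[ℝ] E} (h : CommutantLE A A' 0)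
    (h' : CommutantLE A' A 0) : unsignedAngleType A = unsignedAngleType A' := by
  have hM := h.halfType_eq h' (map_zero _) (map_zero _) (Or.inl ⟨rfl, rfl⟩)
  rw [unsignedAngleType, unsignedAngleType, hM]
  have e1 := cosDim_add_cosDim A
  have e2 := cosDim_add_cosDim A'
  rw [hM] at e1
  have h1 := h.cosDim_eq_one_or_neg_one h' (c := 1) (by norm_num)
  have h2 := h.cosDim_eq_one_or_neg_one h' (c := -1) (by norm_num)
  congr 1
  omega

namespace Hyp

open scoped InnerProductSpace

variable {m : ℕ}

theorem par_conj {r : ℝ} (hr : 0 < r) (A g : Euc m ≃ₗᵢ[ℝ] Euc m) (w : Euc m) :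
    par 1 g 0 * par r A w * (par 1 g 0)⁻¹ = par r (g * A * g⁻¹) (g w) := by
  rw [par_inv one_pos, par_mul one_pos hr, par_mul (mul_pos one_pos hr) (inv_pos.2 one_pos)]
  simp

section Dilation

/-- The null axes belong to the parameter `(r + r⁻¹) / 2`, which exceeds `1`; below that threshold
only `A` contributes. -/
theorem cosDim_dilation {r : ℝ} (hr : 0 < r) (hr1 : r ≠ 1) (A : Euc m ≃ₗᵢ[ℝ] Euc m) {t : ℝ}
    (ht : t ≤ 1) : cosDim (par r A 0).1 t = cosDim A.toLinearEquiv t := by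
  have hmem : ∀ x : V (m + 1), x ∈ cosSpace (par r A 0).1 t ↔ (nsplit m x).1 = 0 ∧
      (nsplit m x).2.1 = 0 ∧ (nsplit m x).2.2 ∈ cosSpace A.toLinearEquiv t := by
    intro x
    have key : ∀ s : ℝ, 0 < s → s ≠ 1 → ∀ a : ℝ,
        s * (s * a) = 2 * t * (s * a) - a ↔ a = 0 := by
      intro s hs hs1 a
      constructor
      · intro h
        have h1 : (s ^ 2 - 2 * t * s + 1) * a = 0 := by linarith
        refine (mul_eq_zero.1 h1).resolve_left (ne_of_gt ?_)
        have : 0 < (s - 1) ^ 2 := sq_pos_of_ne_zero (sub_ne_zero.2 hs1)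
        nlinarith
      · rintro rfl; ring
    rw [mem_cosSpace_iff_sq, mem_cosSpace_iff_sq, ← (nsplit m).injective.eq_iff, map_sub, map_smul,
      nsplit_par hr, nsplit_par hr, Prod.ext_iff, Prod.ext_iff]
    simp only [inner_zero_right, mul_zero, add_zero, norm_zero, smul_zero, ne_eq, OfNat.ofNat_ne_zero,
      not_false_eq_true, zero_pow, zero_mul, Prod.fst_sub, Prod.snd_sub, Prod.smul_fst,
      Prod.smul_snd, smul_eq_mul]
    rw [key r hr hr1, key r⁻¹ (inv_pos.2 hr) (fun h => hr1 (inv_eq_one.1 h))]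
    rfl
  symm
  refine cosDim_eq_of_injective ((nsplit m).symm.toLinearMap ∘ₗ
    LinearMap.inr ℝ ℝ (ℝ × Euc m) ∘ₗ LinearMap.inr ℝ ℝ (Euc m)) ?_ (fun y hy => ?_) (fun x hx => ?_)
  · exact (nsplit m).symm.injective.comp (LinearMap.inr_injective.comp LinearMap.inr_injective)
  · rw [hmem]
    simpa using hy
  · rw [hmem] at hx
    refine ⟨_, hx.2.2, (nsplit m).injective ?_⟩
    ext1
    · simp [hx.1]
    · ext1 <;> simp [hx.2.1]

theorem commutantLE_of_dilation {r s : ℝ} (hr : 0 < r) (hr1 : r ≠ 1) (hs : 0 < s)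
    {A A' : Euc m ≃ₗᵢ[ℝ] Euc m}
    (h : ∀ S : Isom (m + 1), S * par r A 0 = par r A 0 * S → S * par s A' 0 = par s A' 0 * S) :
    CommutantLE A A' 0 := by
  intro B hB _ x
  have h1 : B * A = A * B := LinearIsometryEquiv.ext hB
  have h2 := h (par 1 B 0) ((commute_dilation_iff hr hr1).2 ⟨1, one_pos, B, h1, rfl⟩)
  exact congrArg (fun C : Euc m ≃ₗᵢ[ℝ] Euc m => C x) ((par_commute_iff one_pos hs).1 h2).1

theorem zEquiv_dilation_of_eq {r s : ℝ} (hr : 0 < r) (hr1 : r ≠ 1) (hs : 0 < s) (hs1 : s ≠ 1)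
    {A A' : Euc m ≃ₗᵢ[ℝ] Euc m}
    (h1 : cosDim A.toLinearEquiv (-1) = cosDim A'.toLinearEquiv (-1))
    (h2 : halfType (cosDim A.toLinearEquiv) = halfType (cosDim A'.toLinearEquiv)) :
    ZEquiv (par r A 0) (par s A' 0) := by
  obtain ⟨g, hg1, hg2, -⟩ := exists_conj_isCosCombination h1 h2
  refine zEquiv_iff.2 ⟨par 1 g 0, ?_⟩
  rw [par_conj hr, map_zero]
  ext S
  rw [Subgroup.mem_centralizer_singleton_iff, Subgroup.mem_centralizer_singleton_iff,
    commute_dilation_iff hr hr1, commute_dilation_iff hs hs1]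
  constructor
  · rintro ⟨μ, hμ, B, hB, rfl⟩
    exact ⟨μ, hμ, B, mul_comm_of_isCosCombination hg1 hB, rfl⟩
  · rintro ⟨μ, hμ, B, hB, rfl⟩
    exact ⟨μ, hμ, B, mul_comm_of_isCosCombination hg2 hB, rfl⟩

theorem cosSpace_neg (A : Euc m ≃ₗᵢ[ℝ] Euc m) (t : ℝ) :
    cosSpace (A.trans (LinearIsometryEquiv.neg ℝ)).toLinearEquiv t =
      cosSpace A.toLinearEquiv (-t) := by
  ext x
  rw [mem_cosSpace_iff_sq, mem_cosSpace_iff_sq]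
  simp

theorem zEquiv_dilation_iff {r s : ℝ} (hr : 0 < r) (hr1 : r ≠ 1) (hs : 0 < s) (hs1 : s ≠ 1)
    {A A' : Euc m ≃ₗᵢ[ℝ] Euc m} :
    ZEquiv (par r A 0) (par s A' 0) ↔ unsignedAngleType A = unsignedAngleType A' := by
  constructor
  · intro h
    obtain ⟨g, hg⟩ := zEquiv_iff.1 h
    -- The conjugate commutes with itself, so it lies in the known centralizer of the other element
    -- and has the form `par μ A₁ 0`.
    obtain ⟨μ, hμ, A₁, -, hA₁⟩ := (commute_dilation_iff hs hs1).1
      ((mem_centralizer_iff_of_eq hg (g * par r A 0 * g⁻¹)).1 rfl)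
    have hμ1 : μ ≠ 1 := by
      rintro rfl
      have := isElliptic_par_one_zero A₁
      rw [← hA₁, isElliptic_conj_iff] at this
      exact not_isElliptic_dilation hr hr1 A this
    rw [hA₁] at hg
    rw [← (commutantLE_of_dilation hμ hμ1 hs
      fun S => (mem_centralizer_iff_of_eq hg S).1).unsignedAngleType_eq
      (commutantLE_of_dilation hs hs1 hμ fun S => (mem_centralizer_iff_of_eq hg S).2)]
    refine unsignedAngleType_eq_of_cosDim fun t ht => ?_
    rw [← cosDim_dilation hr hr1 A ht, ← cosDim_dilation hμ hμ1 A₁ ht, ← hA₁, cosDim_isom_conj]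
  · intro h
    rw [unsignedAngleType, unsignedAngleType, Prod.mk.injEq] at h
    have e1 := cosDim_add_cosDim A
    have e2 := cosDim_add_cosDim A'
    rw [h.2] at e1
    have h1 := h.1
    by_cases hb : cosDim A.toLinearEquiv (-1) = cosDim A'.toLinearEquiv (-1)
    · exact zEquiv_dilation_of_eq hr hr1 hs hs1 hb h.2
    · have hb' : cosDim A.toLinearEquiv 1 = cosDim A'.toLinearEquiv (-1) := by omega
      -- If the multiplicities of `1` and `-1` are exchanged, replace `A` by `-A`; this changes
      -- neither the centralizer nor the multiset.
      set A₂ := A.trans (LinearIsometryEquiv.neg ℝ) with hA₂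
      refine (zEquiv_equivalence _).trans (y := par r A₂ 0) (zEquiv_iff.2 ⟨1, ?_⟩)
        (zEquiv_dilation_of_eq hr hr1 hs hs1 ?_ ?_)
      · ext S
        rw [one_mul, inv_one, mul_one, Subgroup.mem_centralizer_singleton_iff,
          Subgroup.mem_centralizer_singleton_iff, commute_dilation_iff hr hr1,
          commute_dilation_iff hr hr1]
        have : ∀ B : Euc m ≃ₗᵢ[ℝ] Euc m, B * A = A * B ↔ B * A₂ = A₂ * B := fun B => by
          rw [LinearIsometryEquiv.ext_iff, LinearIsometryEquiv.ext_iff]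
          refine forall_congr' fun x => ?_
          change B (A x) = A (B x) ↔ B (-A x) = -A (B x)
          rw [map_neg, neg_inj]
        simp only [this]
      · rw [cosDim, cosSpace_neg, neg_neg]; exact hb'
      · rw [← h.2]
        have hI : ∀ c ∈ Set.Ioo (-1 : ℝ) 1, -c ∈ Set.Ioo (-1 : ℝ) 1 := fun c hc =>
          ⟨by linarith [hc.2], by linarith [hc.1]⟩
        exact halfType_eq_of_cosSpace (fun c hc _ => ⟨-c, hI c hc, cosSpace_neg A c⟩)
          (fun c hc _ => ⟨-c, hI c hc, by rw [cosSpace_neg, neg_neg]⟩)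

end Dilation

section Translation

/-- The null coordinates only add generalized eigenvectors for the eigenvalue `1`, and `w` is
orthogonal to the other pieces of `A`. -/
theorem cosDim_translation {A : Euc m ≃ₗᵢ[ℝ] Euc m} {w : Euc m} (hA : A w = w) {t : ℝ}
    (ht : t ≠ 1) : cosDim (par 1 A w).1 t = cosDim A.toLinearEquiv t := by
  have hmap : ∀ y, ⟪A y, w⟫_ℝ = ⟪y, w⟫_ℝ := fun y => by
    conv_lhs => rw [← hA]
    exact A.inner_map_map _ _
  have key : ∀ a : ℝ, a = 2 * t * a - a ↔ a = 0 := by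
    intro a
    constructor
    · intro h
      have h1 : (t - 1) * a = 0 := by linarith
      exact (mul_eq_zero.1 h1).resolve_left (sub_ne_zero.2 ht)
    · rintro rfl; ring
  have hmem : ∀ x : V (m + 1), x ∈ cosSpace (par 1 A w).1 t ↔ (nsplit m x).1 = 0 ∧
      (nsplit m x).2.1 = 0 ∧ (nsplit m x).2.2 ∈ cosSpace A.toLinearEquiv t := by
    intro x
    rw [mem_cosSpace_iff_sq, ← (nsplit m).injective.eq_iff, map_sub, map_smul,
      nsplit_par one_pos, nsplit_par one_pos, Prod.ext_iff, Prod.ext_iff]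
    simp only [inv_one, one_mul, Prod.fst_sub, Prod.snd_sub, Prod.smul_fst, Prod.smul_snd,
      smul_eq_mul, map_add, map_smul, hA, hmap, inner_add_left, inner_smul_left, conj_trivial]
    rw [key]
    constructor
    · rintro ⟨h1, h2, h3⟩
      simp only [h2, zero_smul, add_zero, mul_zero] at h1 h3
      have h4 : (nsplit m x).2.2 ∈ cosSpace A.toLinearEquiv t := mem_cosSpace_iff_sq.2 h3
      rw [inner_eq_zero_of_mem_cosSpace h4 hA ht] at h1
      exact ⟨(key _).1 (by linarith), h2, h4⟩
    · rintro ⟨h1, h2, h4⟩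
      have h3 := mem_cosSpace_iff_sq.1 h4
      simp only [LinearIsometryEquiv.coe_toLinearEquiv] at h3
      rw [h1, h2, inner_eq_zero_of_mem_cosSpace h4 hA ht]
      refine ⟨by simp, rfl, ?_⟩
      simp only [zero_smul, add_zero, h3]
  symm
  refine cosDim_eq_of_injective ((nsplit m).symm.toLinearMap ∘ₗ
    LinearMap.inr ℝ ℝ (ℝ × Euc m) ∘ₗ LinearMap.inr ℝ ℝ (Euc m)) ?_ (fun y hy => ?_) (fun x hx => ?_)
  · exact (nsplit m).symm.injective.comp (LinearMap.inr_injective.comp LinearMap.inr_injective)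
  · rw [hmem]
    simpa using hy
  · rw [hmem] at hx
    refine ⟨_, hx.2.2, (nsplit m).injective ?_⟩
    ext1
    · simp [hx.1]
    · ext1 <;> simp [hx.2.1]

variable {A A' : Euc m ≃ₗᵢ[ℝ] Euc m} {w w' : Euc m}

theorem commutantLE_of_translation (hA : A w = w) (hw : w ≠ 0)
    (h : ∀ S : Isom (m + 1), S * par 1 A w = par 1 A w * S → S * par 1 A' w' = par 1 A' w' * S) :
    CommutantLE A A' w := by
  intro B hB hBw x
  have h1 : B * A = A * B := LinearIsometryEquiv.ext hB
  have h2 := h (par 1 B 0) ((commute_translation_iff hA hw).2 ⟨B, 0, h1, hBw, map_zero _, rfl⟩)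
  exact congrArg (fun C : Euc m ≃ₗᵢ[ℝ] Euc m => C x) ((par_commute_iff one_pos one_pos).1 h2).1

/-- Translations along fixed vectors `z` of `A` lie in the centralizer; commuting with `par 1 A' w'`
forces `A' z = z`. -/
theorem cosSpace_one_le_of_translation (hA : A w = w) (hw : w ≠ 0)
    (h : ∀ S : Isom (m + 1), S * par 1 A w = par 1 A w * S → S * par 1 A' w' = par 1 A' w' * S) :
    cosSpace A.toLinearEquiv 1 ≤ cosSpace A'.toLinearEquiv 1 := by
  intro z hz
  rw [mem_cosSpace_one] at *
  have h1 := h (par 1 1 z) ((commute_translation_iff hA hw).2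
    ⟨1, z, by rw [one_mul, mul_one], rfl, hz, rfl⟩)
  have h2 := ((par_commute_iff one_pos one_pos).1 h1).2
  rw [inv_one, one_smul, one_smul] at h2
  change w' + z = A' z + w' at h2
  rw [add_comm w'] at h2
  exact (add_right_cancel h2).symm

theorem zEquiv_translation_iff (hA : A w = w) (hw : w ≠ 0) (hA' : A' w' = w') (hw' : w' ≠ 0) :
    ZEquiv (par 1 A w) (par 1 A' w') ↔ angleType A = angleType A' := by
  constructor
  · intro h
    obtain ⟨g, hg⟩ := zEquiv_iff.1 h
    obtain ⟨A₁, w₁, -, -, hA'w₁, hA₁⟩ := (commute_translation_iff hA' hw').1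
      ((mem_centralizer_iff_of_eq hg (g * par 1 A w * g⁻¹)).1 rfl)
    have hw₁ : w₁ ≠ 0 := by
      rintro rfl
      have := isElliptic_par_one_zero A₁
      rw [← hA₁, isElliptic_conj_iff] at this
      exact not_isElliptic_translation hA hw this
    rw [hA₁] at hg
    have h1 := fun S => (mem_centralizer_iff_of_eq hg S).1
    have h2 := fun S => (mem_centralizer_iff_of_eq hg S).2
    have hle := cosSpace_one_le_of_translation hA' hw' h2
    have hA₁w : A₁ w₁ = w₁ := mem_cosSpace_one.1 (hle (mem_cosSpace_one.2 hA'w₁))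
    have hc := le_antisymm (cosSpace_one_le_of_translation hA₁w hw₁ h1) hle
    have c1 := commutantLE_of_translation hA₁w hw₁ h1
    have c2 := commutantLE_of_translation hA' hw' h2
    have e1 : angleType A₁ = angleType A' := by
      rw [angleType, angleType, c1.cosDim_neg_one_eq c2 hA₁w hA' hc,
        c1.halfType_eq c2 hA₁w hA' (Or.inr hc)]
    rw [← e1]
    refine angleType_eq_of_cosDim fun t ht => ?_
    rw [← cosDim_translation hA ht, ← cosDim_translation hA₁w ht, ← hA₁, cosDim_isom_conj]
  · intro h
    rw [angleType, angleType, Prod.mk.injEq] at h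
    obtain ⟨g, hg1, hg2, hg3⟩ := exists_conj_isCosCombination h.1 h.2
    set C := g * A * g⁻¹ with hC
    -- Only the stabilizer of the translation vector enters the centralizer, so its length is
    -- irrelevant and matching `g w` with a multiple of `w'` suffices.
    set ρ := ‖w‖ / ‖w'‖ with hρ
    have hρ0 : ρ ≠ 0 := div_ne_zero (norm_ne_zero_iff.2 hw) (norm_ne_zero_iff.2 hw')
    have hCg : C (g w) = g w := by
      change g (A (g.symm (g w))) = g w
      rw [g.symm_apply_apply, hA]
    have hA'g : A' (g w) = g w := mem_cosSpace_one.1 (hg3 ▸ mem_cosSpace_one.2 hCg)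
    have hn : ‖g w‖ = ‖ρ • w'‖ := by
      rw [g.norm_map, norm_smul, hρ, norm_div, norm_norm, norm_norm,
        div_mul_cancel₀ _ (norm_ne_zero_iff.2 hw')]
    -- This reflection takes `g w` to `ρ • w'`. It commutes with `A'`, which fixes the vector
    -- defining it, and hence with `C`.
    set k := (ℝ ∙ (g w - ρ • w'))ᗮ.reflection with hk
    have hkw : k (g w) = ρ • w' := Submodule.reflection_sub hn
    have hkA' : k * A' = A' * k := by
      have hfix : A' (g w - ρ • w') = g w - ρ • w' := by rw [map_sub, map_smul, hA'g, hA']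
      have hmap : (ℝ ∙ (g w - ρ • w')).map (A'.toLinearEquiv : Euc m →ₗ[ℝ] Euc m) =
          ℝ ∙ (g w - ρ • w') := by
        rw [Submodule.map_span, Set.image_singleton]
        exact congrArg (fun x => ℝ ∙ x) hfix
      refine LinearIsometryEquiv.ext fun x => ?_
      change k (A' x) = A' (k x)
      have := Submodule.reflection_map_apply A' (ℝ ∙ (g w - ρ • w')) (A' x)
      rw [A'.symm_apply_apply] at this
      rw [hk, Submodule.reflection_orthogonal_apply, Submodule.reflection_orthogonal_apply,
        map_neg, ← this]
      congr 2
      simp only [hmap]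
    have hkC : k * C = C * k := mul_comm_of_isCosCombination hg2 hkA'
    refine zEquiv_iff.2 ⟨par 1 (k * g) 0, ?_⟩
    have hconj : k * g * A * (k * g)⁻¹ = C := by
      rw [mul_inv_rev, ← mul_assoc, mul_assoc k, mul_assoc k, ← hC, hkC, mul_inv_cancel_right]
    rw [par_conj one_pos, hconj]
    have hkg : (k * g) w = ρ • w' := hkw
    have hCw' : C w' = w' := mem_cosSpace_one.1 (hg3.symm ▸ mem_cosSpace_one.2 hA')
    rw [hkg]
    ext S
    rw [Subgroup.mem_centralizer_singleton_iff, Subgroup.mem_centralizer_singleton_iff,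
      commute_translation_iff (by rw [map_smul, hCw']) (smul_ne_zero hρ0 hw'),
      commute_translation_iff hA' hw']
    have hz : ∀ z, C z = z ↔ A' z = z := fun z => by
      rw [← mem_cosSpace_one, ← mem_cosSpace_one, hg3]
    have hB : ∀ B : Euc m ≃ₗᵢ[ℝ] Euc m, B * C = C * B ↔ B * A' = A' * B := fun B =>
      ⟨mul_comm_of_isCosCombination hg1, mul_comm_of_isCosCombination hg2⟩
    have hBw : ∀ B : Euc m ≃ₗᵢ[ℝ] Euc m, B (ρ • w') = ρ • w' ↔ B w' = w' := fun B => by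
      rw [map_smul]; exact (smul_right_injective (Euc m) hρ0).eq_iff
    simp only [hz, hB, hBw]

end Translation

end Hyp

/-! ### Counting the types. -/

theorem encard_range_zClass {G Y X : Type*} [Group G] {ρ : Y → G} {f : Y → X}
    (h : ∀ y y', ZEquiv (ρ y) (ρ y') ↔ f y = f y') :
    (Set.range fun y => zClass (ρ y)).encard = (Set.range f).encard := by
  have hk : Setoid.ker (fun y => zClass (ρ y)) = Setoid.ker f := by
    ext y y'
    rw [Setoid.ker_def, Setoid.ker_def, zClass_eq_iff, h]
  exact Set.encard_congr ((Setoid.quotientKerEquivRange _).symm.trans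
    ((Quotient.congrRight fun y y' => by rw [hk]).trans (Setoid.quotientKerEquivRange f)))

/-- Sort the pairs by `k = p.2.sum`: the multiset is then a partition of `k`, and the first entry
has `g k` possible values. -/
theorem encard_types {g : ℕ → ℕ} {K : ℕ} (hg : ∀ k ≥ K, g k = 0) :
    {p : ℕ × Multiset ℕ | (∀ u ∈ p.2, 0 < u) ∧ p.1 < g p.2.sum}.encard =
      ((∑ k ∈ Finset.range K, g k * partitionCount k : ℕ) : ℕ∞) := by
  classical
  let s : Finset (Σ k : ℕ, ℕ × Nat.Partition k) :=
    (Finset.range K).sigma fun k => Finset.range (g k) ×ˢ Finset.univ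
  let φ : (Σ k : ℕ, ℕ × Nat.Partition k) → ℕ × Multiset ℕ := fun x => (x.2.1, x.2.2.parts)
  have hφ : Function.Injective φ := by
    rintro ⟨k, b, p⟩ ⟨k', b', p'⟩ h
    obtain ⟨rfl, h2⟩ := Prod.mk.inj h
    have hk : k = k' := by rw [← p.parts_sum, ← p'.parts_sum]; exact congrArg Multiset.sum h2
    subst hk
    obtain rfl : p = p' := Nat.Partition.ext h2
    rfl
  have hs : {p : ℕ × Multiset ℕ | (∀ u ∈ p.2, 0 < u) ∧ p.1 < g p.2.sum} =
      ((s.image φ : Finset _) : Set (ℕ × Multiset ℕ)) := by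
    ext ⟨b, M⟩
    rw [Finset.mem_coe, Finset.mem_image]
    constructor
    · rintro ⟨h1, h2⟩
      refine ⟨⟨M.sum, b, ⟨M, fun {u} hu => h1 u hu, rfl⟩⟩, ?_, rfl⟩
      simp only [s, Finset.mem_sigma, Finset.mem_product, Finset.mem_range, Finset.mem_univ,
        and_true]
      refine ⟨?_, h2⟩
      by_contra! hK
      have h2 : b < g M.sum := h2
      rw [hg _ hK] at h2
      exact absurd h2 (Nat.not_lt_zero _)
    · rintro ⟨⟨k, b', p⟩, hx, h⟩
      obtain ⟨rfl, rfl⟩ := Prod.mk.inj h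
      simp only [s, Finset.mem_sigma, Finset.mem_product, Finset.mem_range, Finset.mem_univ,
        and_true] at hx
      refine ⟨fun u hu => p.parts_pos hu, ?_⟩
      change b' < g p.parts.sum
      rw [p.parts_sum]; exact hx.2
  rw [hs, Set.encard_coe_eq_coe_finsetCard, Finset.card_image_of_injective _ hφ,
    Finset.card_sigma]
  simp only [Finset.card_product, Finset.card_range, Finset.card_univ, partitionCount]

namespace Hyp

theorem range_angleType (n : ℕ) :
    (Set.range fun A : Euc n ≃ₗᵢ[ℝ] Euc n => angleType A) =
      {p | (∀ u ∈ p.2, 0 < u) ∧ p.1 < n + 1 - 2 * p.2.sum} := by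
  ext ⟨b, M⟩
  constructor
  · rintro ⟨A, hA⟩
    obtain ⟨rfl, rfl⟩ := Prod.mk.inj hA
    have h := cosDim_add_cosDim A
    rw [finrank_euclideanSpace_fin] at h
    refine ⟨fun u hu => pos_of_mem_halfType A hu, ?_⟩
    simp only
    omega
  · rintro ⟨h1, h2⟩
    simp only at h1 h2
    obtain ⟨A, -, hb, hM⟩ := exists_isometry_of_type (m := n) (a := n - b - 2 * M.sum) (b := b) h1
      (by omega)
    exact ⟨A, by simp only [angleType, hb, hM]⟩

theorem range_angleType_fixed (m : ℕ) :
    (Set.range fun p : {p : (Euc m ≃ₗᵢ[ℝ] Euc m) × Euc m // p.1 p.2 = p.2 ∧ p.2 ≠ 0} =>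
      angleType p.1.1) = {p | (∀ u ∈ p.2, 0 < u) ∧ p.1 < m - 2 * p.2.sum} := by
  ext ⟨b, M⟩
  constructor
  · rintro ⟨⟨⟨A, w⟩, hAw, hw⟩, hA⟩
    obtain ⟨rfl, rfl⟩ := Prod.mk.inj hA
    have h := cosDim_add_cosDim A
    rw [finrank_euclideanSpace_fin] at h
    -- The translation vector occupies one dimension of the fixed space, which leaves one choice
    -- fewer than in the elliptic count for the same dimension.
    have h1 : 0 < cosDim A.toLinearEquiv 1 := by
      rw [cosDim, Nat.pos_iff_ne_zero, Ne, Submodule.finrank_eq_zero]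
      intro h0
      have : w ∈ cosSpace A.toLinearEquiv 1 := mem_cosSpace_one.2 hAw
      rw [h0] at this
      exact hw this
    refine ⟨fun u hu => pos_of_mem_halfType A hu, ?_⟩
    simp only
    omega
  · rintro ⟨h1, h2⟩
    simp only at h1 h2
    obtain ⟨A, ha, hb, hM⟩ := exists_isometry_of_type (m := m) (a := m - b - 2 * M.sum) (b := b) h1
      (by omega)
    have hne : cosSpace A.toLinearEquiv 1 ≠ ⊥ := by
      rw [Ne, ← Submodule.finrank_eq_zero]
      change cosDim A.toLinearEquiv 1 ≠ 0
      omega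
    obtain ⟨w, hw, hw0⟩ := Submodule.exists_mem_ne_zero_of_ne_bot hne
    exact ⟨⟨(A, w), mem_cosSpace_one.1 hw, hw0⟩, by simp only [angleType, hb, hM]⟩

theorem range_unsignedAngleType (m : ℕ) :
    (Set.range fun p : {r : ℝ // 0 < r ∧ r ≠ 1} × (Euc m ≃ₗᵢ[ℝ] Euc m) =>
      unsignedAngleType p.2) = {p | (∀ u ∈ p.2, 0 < u) ∧ p.1 < m / 2 + 1 - p.2.sum} := by
  ext ⟨b, M⟩
  constructor
  · rintro ⟨⟨r, A⟩, hA⟩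
    obtain ⟨rfl, rfl⟩ := Prod.mk.inj hA
    have h := cosDim_add_cosDim A
    rw [finrank_euclideanSpace_fin] at h
    refine ⟨fun u hu => pos_of_mem_halfType A hu, ?_⟩
    simp only
    omega
  · rintro ⟨h1, h2⟩
    simp only at h1 h2
    obtain ⟨A, ha, hb, hM⟩ := exists_isometry_of_type (m := m) (a := m - b - 2 * M.sum) (b := b) h1
      (by omega)
    -- Any positive dilation factor other than `1` serves.
    refine ⟨⟨⟨2, by norm_num⟩, A⟩, ?_⟩
    simp only [unsignedAngleType, ha, hb, hM]
    congr 1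
    omega

theorem setOf_zClass_elliptic (n : ℕ) :
    {c : ZClass (Isom n) | ∃ T, IsElliptic T ∧ zClass T = c} =
      Set.range fun A : Euc n ≃ₗᵢ[ℝ] Euc n => zClass (ell A) := by
  ext c
  constructor
  · rintro ⟨T, hT, rfl⟩
    obtain ⟨A, S, rfl⟩ := hT.exists_conj_ell
    exact ⟨A, zClass_eq_iff.2 (zEquiv_conj _ _)⟩
  · rintro ⟨A, rfl⟩
    exact ⟨_, isElliptic_ell A, rfl⟩

theorem nonempty_of_encard_eq {α : Type*} {s : Set α} {k : ℕ∞} (h : s.encard = k) (hk : k ≠ 0) :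
    s.Nonempty := by
  rw [← Set.encard_ne_zero, h]; exact hk

theorem setOf_zClass_hyperbolic (m : ℕ) :
    {c : ZClass (Isom (m + 1)) | ∃ T, IsHyperbolic T ∧ zClass T = c} =
      Set.range fun p : {r : ℝ // 0 < r ∧ r ≠ 1} × (Euc m ≃ₗᵢ[ℝ] Euc m) =>
        zClass (par p.1 p.2 0) := by
  ext c
  constructor
  · rintro ⟨T, hT, rfl⟩
    rcases exists_normalForm hT.1 (nonempty_of_encard_eq hT.2 two_ne_zero) with
      ⟨S, r, hr, hr1, A, h⟩ | ⟨S, A, w, hA, hw, h⟩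
    · exact ⟨⟨⟨r, hr, hr1⟩, A⟩, by
        simp only [← h]; exact (zClass_eq_iff.2 (zEquiv_conj _ _)).symm⟩
    · have h1 := ((isHyperbolic_conj_iff S).2 hT).2
      rw [h, encard_fixedBoundary_translation hA hw] at h1
      norm_num at h1
  · rintro ⟨⟨⟨r, hr, hr1⟩, A⟩, rfl⟩
    exact ⟨_, isHyperbolic_dilation hr hr1 A, rfl⟩

theorem setOf_zClass_parabolic (m : ℕ) :
    {c : ZClass (Isom (m + 1)) | ∃ T, IsParabolic T ∧ zClass T = c} =
      Set.range fun p : {p : (Euc m ≃ₗᵢ[ℝ] Euc m) × Euc m // p.1 p.2 = p.2 ∧ p.2 ≠ 0} =>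
        zClass (par 1 p.1.1 p.1.2) := by
  ext c
  constructor
  · rintro ⟨T, hT, rfl⟩
    rcases exists_normalForm hT.1 (nonempty_of_encard_eq hT.2 one_ne_zero) with
      ⟨S, r, hr, hr1, A, h⟩ | ⟨S, A, w, hA, hw, h⟩
    · have h1 := ((isParabolic_conj_iff S).2 hT).2
      rw [h, encard_fixedBoundary_dilation hr hr1] at h1
      norm_num at h1
    · exact ⟨⟨⟨A, w⟩, hA, hw⟩, by
        simp only [← h]; exact (zClass_eq_iff.2 (zEquiv_conj _ _)).symm⟩
  · rintro ⟨⟨⟨A, w⟩, hA, hw⟩, rfl⟩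
    exact ⟨_, isParabolic_translation hA hw, rfl⟩

theorem elliptic_or_hyperbolic_or_parabolic {m : ℕ} (T : Isom (m + 1)) :
    IsElliptic T ∨ IsHyperbolic T ∨ IsParabolic T := by
  by_cases hT : IsElliptic T
  · exact Or.inl hT
  rcases exists_normalForm hT ((isElliptic_or_fixedBoundary_nonempty T).resolve_left hT) with
    ⟨S, r, hr, hr1, A, h⟩ | ⟨S, A, w, hA, hw, h⟩
  · exact Or.inr (Or.inl ((isHyperbolic_conj_iff S).1 (h ▸ isHyperbolic_dilation hr hr1 A)))
  · exact Or.inr (Or.inr ((isParabolic_conj_iff S).1 (h ▸ isParabolic_translation hA hw)))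

end Hyp

theorem theorem1p3 (n : ℕ) (hn : 1 ≤ n) :
    Finite (ZClass (Hyp.Isom n)) ∧
    {c : ZClass (Hyp.Isom n) | ∃ T, Hyp.IsElliptic T ∧ zClass T = c}.encard =
      ((∑ k ∈ Finset.range (n / 2 + 1), (n + 1 - 2 * k) * partitionCount k : ℕ) : ℕ∞) ∧
    {c : ZClass (Hyp.Isom n) | ∃ T, Hyp.IsHyperbolic T ∧ zClass T = c}.encard =
      ((∑ k ∈ Finset.range ((n - 1) / 2 + 1),
        ((n - 1) / 2 + 1 - k) * partitionCount k : ℕ) : ℕ∞) ∧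
    {c : ZClass (Hyp.Isom n) | ∃ T, Hyp.IsParabolic T ∧ zClass T = c}.encard =
      ((∑ k ∈ Finset.range (n / 2), (n - 1 - 2 * k) * partitionCount k : ℕ) : ℕ∞) := by
  -- Null coordinates use up one space dimension, so the horosphere has dimension `m = n - 1`.
  obtain ⟨m, rfl⟩ : ∃ m, n = m + 1 := ⟨n - 1, by omega⟩
  rw [Nat.add_sub_cancel]
  have hE : {c : ZClass (Hyp.Isom (m + 1)) | ∃ T, Hyp.IsElliptic T ∧ zClass T = c}.encard =
      ((∑ k ∈ Finset.range ((m + 1) / 2 + 1),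
        (m + 1 + 1 - 2 * k) * partitionCount k : ℕ) : ℕ∞) := by
    rw [Hyp.setOf_zClass_elliptic, encard_range_zClass fun A A' => Hyp.zEquiv_ell_iff,
      Hyp.range_angleType]
    exact encard_types (g := fun k => m + 1 + 1 - 2 * k) fun k hk => by omega
  have hH : {c : ZClass (Hyp.Isom (m + 1)) | ∃ T, Hyp.IsHyperbolic T ∧ zClass T = c}.encard =
      ((∑ k ∈ Finset.range (m / 2 + 1), (m / 2 + 1 - k) * partitionCount k : ℕ) : ℕ∞) := by
    rw [Hyp.setOf_zClass_hyperbolic, encard_range_zClass fun p q => Hyp.zEquiv_dilation_iff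
      p.1.2.1 p.1.2.2 q.1.2.1 q.1.2.2, Hyp.range_unsignedAngleType]
    exact encard_types (g := fun k => m / 2 + 1 - k) fun k hk => by omega
  have hP : {c : ZClass (Hyp.Isom (m + 1)) | ∃ T, Hyp.IsParabolic T ∧ zClass T = c}.encard =
      ((∑ k ∈ Finset.range ((m + 1) / 2), (m - 2 * k) * partitionCount k : ℕ) : ℕ∞) := by
    rw [Hyp.setOf_zClass_parabolic, encard_range_zClass fun p q => Hyp.zEquiv_translation_iff
      p.2.1 p.2.2 q.2.1 q.2.2, Hyp.range_angleType_fixed]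
    exact encard_types (g := fun k => m - 2 * k) fun k hk => by omega
  refine ⟨?_, hE, hH, hP⟩
  -- Every class lies in one of the three sets just counted, each of which is finite.
  rw [← Set.finite_univ_iff]
  refine (((Set.finite_of_encard_eq_coe hE).union (Set.finite_of_encard_eq_coe hH)).union
    (Set.finite_of_encard_eq_coe hP)).subset ?_
  rintro c -
  induction c using Quotient.inductionOn with | _ T
  rcases Hyp.elliptic_or_hyperbolic_or_parabolic T with h | h | h
  · exact Or.inl (Or.inl ⟨T, h, rfl⟩)
  · exact Or.inl (Or.inr ⟨T, h, rfl⟩)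
  · exact Or.inr ⟨T, h, rfl⟩
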